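/- Let $V\subseteq\mathbb R^n$ be open and let a gauge theory on $V$ be given: fields $\Psi^A$ with Grassmann parity $|A|$ and ghost number $\mathrm{gh}(A)$ (the undifferentiated even fields ranging over an open set), jet coordinates $y^a,\Psi^A_{(a)}$, total derivatives $\partial_a$, and an odd nilpotent BRST differential $s$ of ghost number one with $s\Psi^A=S^A[\Psi,y]$, $sy^a=0$, $[s,\partial_a]=0$. Local functions depend smoothly on finitely many even coordinates and polynomially on finitely many odd ones. *Parent formulation.* Its fields on an open set of points $x$ are $\Psi^A_{(\lambda)[\nu]}(x)$, with $(\lambda)$ a symmetric and $[\nu]$ a skew multi-index, the components of superfields in $y^\lambda$ and the odd $\theta^\nu$, with parity $|A|+l$ and ghost number $\mathrm{gh}(A)-l$ for $l$ skew indices; their $x$-jets are $\Psi^A_{(\mu)(\lambda)[\nu]}$. On a collection of superfields $\Psi^t$ (here $t=A(\lambda)$) let $\partial^F_{\theta^\nu}$, $d^F$ be the left vector fields, vanishing on $x^\mu$, with $$\partial^F_{\theta^\nu}\Psi^t_{(\mu)|\nu_1\dots\nu_k}=(-1)^{|t|}\Psi^t_{(\mu)|\nu\nu_1\dots\nu_k},\qquad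 d^F\Psi^t_{(\mu)|\nu_1\dots\nu_p}=(-1)^{|t|}\sum_i(-1)^{i-1}\Psi^t_{(\mu)\nu_i|\nu_1\dots\widehat{\nu_i}\dots\nu_p},$$ and let $\sigma^F$ be defined like $d^F$ but with $\nu_i$ added to the indices $(\lambda)$. Let $\bar s$ be the vector field with $\bar s x^\mu=0$, with $\bar s\Psi^A$ equal to $S^A$ in which the jet indices are replaced by indices $(\lambda)$ and the explicit space-time coordinates by $x$, and which commutes (in the graded sense) with the total derivatives $\partial_\mu$, with $\partial^F_{\theta^\nu}$ and with $\partial/\partial x^\lambda+\partial^F_{y^\lambda}$. The parent differential is $s^P=d^F-\sigma^F+\bar s$. *Parametrized parent formulation.* Let the extended jet space have coordinates $\Psi^A_{(a)},y^a,\xi^a$, with $\xi^a$ odd of ghost number one, and differential $\tilde s=s+\xi^a\partial_a$, so that $\tilde s y^a=\xi^a$, $\tilde s\xi^a=0$. The parametrized parent formulation on an open set $U\subseteq\mathbb R^n$ is the AKSZ-type sigma model with source coordinates $x^\mu\in U$, $\theta^\mu$ and this target: its fields are the $\theta$-components of superfields $\Psi^A_{(a)}(x,\theta),y^a(x,\theta),\xi^a(x,\theta)$,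 and its differential is $s^{AKSZ}=d^F+\bar{\tilde s}$, where $\bar{\tilde s}$ is the extension of $\tilde s$ that commutes with $\partial_\mu$ and $\partial^F_{\theta^\nu}$. *Elimination.* Fields $w,v$ are generalized auxiliary fields, with remaining fields $\varphi$, if $\varphi,w,v$ together with their $x$-derivatives and $x$ are obtained by an invertible change of coordinates of the jet space, and if the equations $sw|_{w=0}=0$, as algebraic equations in the space of fields and their derivatives, are equivalent to $v=V[\varphi]$ (that is, together with $w$ and its derivatives, both systems with all their derivatives generate the same ideal). The reduced differential is $s_R\varphi=(s\varphi)|_{w=0,\,v=V[\varphi]}$ on $\varphi$ and its derivatives. **Proposition.** Let $Y:U\to V$ be an invertible smooth change of space-time coordinates with smooth inverse, $y^a=Y^a(x)$. Then in the parametrized parent formulation on $U$ the fields $$w:\ y^a-Y^a(x),\quad y^a_{\nu_1\dots\nu_k}\ (k>0);\qquad v:\ \xi^a,\quad \xi^a_\nu+\frac{\partial Y^a}{\partial x^\nu},\quad \xi^a_{\nu_1\dots\nu_k}\ (k>1)$$ are generalized auxiliary fields with $V=0$, and the remaining fields are $\Psi^A_{(\lambda)[\nu]}(x)$. Setting $w$,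 $v$ and their derivatives to zero is a well-defined restriction. The reduced differential on $U$ is the parent differential $s^P$ on $V$ transformed by the change of coordinates $y=Y(x)$, under which the components $\Psi^A_{(\lambda)}$ are scalars, the $\Psi^A_{(\lambda)[\nu]}$ are skew tensors in $[\nu]$, and $\partial_\mu=\sum_a\frac{\partial Y^a}{\partial x^\mu}\partial_a$: there is an isomorphism of the algebras of local functions with these properties that intertwines both differentials. If moreover $U=V$ and $Y^a(x)=\delta^a_\mu x^\mu$, then the reduced differential is exactly $s^P=d^F-\sigma^F+\bar s$. -/

import Mathlib

open scoped TensorProduct ContDiff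

namespace ParentBRST

universe u v w

/-! ### Superdomains and smooth functions of the even coordinates -/

/-- A graded superdomain with global coordinates `zⁱ`, `i : ι` (possibly infinitely many): each has
a Grassmann parity and a ghost number, and the real values of the even ones range over an open set
`dom`. -/
structure SuperDomain (ι : Type u) where
  parity : ι → ZMod 2
  gh : ι → ℤ
  dom : Set ({i // parity i = 0} → ℝ)
  isOpen_dom : IsOpen dom

namespace SuperDomain

/-- The even coordinates. -/
abbrev Even {ι : Type u} (M : SuperDomain ι) : Type u := {i // M.parity i = 0}
/-- The odd coordinates. -/
abbrev Odd {ι : Type u} (M : SuperDomain ι) : Type u := {i // M.parity i ≠ 0}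

/-- `f` depends smoothly on finitely many of the even coordinates, and on no others. -/
def IsSmooth {ι : Type u} (M : SuperDomain ι) (f : M.dom → ℝ) : Prop :=
  ∃ (s : Finset M.Even) (g : (s → ℝ) → ℝ),
    ContDiffOn ℝ ∞ g (s.restrict '' M.dom) ∧ ∀ p : M.dom, f p = g (s.restrict p.1)

theorem IsSmooth.comp {ι : Type u} {M : SuperDomain ι} {κ : Type v} [Fintype κ]
    {f : κ → M.dom → ℝ} (hf : ∀ k, M.IsSmooth (f k)) {D : Set (κ → ℝ)} {G : (κ → ℝ) → ℝ}
    (hG : ContDiffOn ℝ ∞ G D) (hD : ∀ p, (fun k => f k p) ∈ D) :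
    M.IsSmooth (fun p => G (fun k => f k p)) := by
  classical
  choose s g hg hfg using hf
  have hsub : ∀ k, s k ⊆ Finset.univ.biUnion s := fun k =>
    Finset.subset_biUnion_of_mem s (Finset.mem_univ k)
  refine ⟨Finset.univ.biUnion s,
    fun q => G (fun k => g k (fun e => q ⟨e.1, hsub k e.2⟩)), ?_, ?_⟩
  · refine hG.comp (contDiffOn_pi.2 fun k => ?_) ?_
    · refine (hg k).comp (ContDiff.contDiffOn (by fun_prop)) ?_
      rintro _ ⟨p, hp, rfl⟩
      exact ⟨p, hp, rfl⟩
    · rintro _ ⟨p, hp, rfl⟩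
      have := hD ⟨p, hp⟩
      simp only [hfg] at this
      exact this
  · intro p
    simp only [hfg]
    rfl

theorem isSmooth_proj {ι : Type u} (M : SuperDomain ι) (e : M.Even) :
    M.IsSmooth (fun p => p.1 e) :=
  ⟨{e}, fun q => q ⟨e, Finset.mem_singleton_self e⟩,
    ContDiff.contDiffOn (by fun_prop), fun _ => rfl⟩

/-- The algebra of smooth functions of finitely many even coordinates. -/
def SmoothFn {ι : Type u} (M : SuperDomain ι) : Subalgebra ℝ (M.dom → ℝ) where
  carrier := {f | M.IsSmooth f}
  mul_mem' {a b} ha hb := by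
    have := IsSmooth.comp (M := M) (f := ![a, b]) (D := Set.univ) (G := fun q => q 0 * q 1)
      (by intro k; fin_cases k <;> assumption) (ContDiff.contDiffOn (by fun_prop)) (by simp)
    exact this
  add_mem' {a b} ha hb := by
    have := IsSmooth.comp (M := M) (f := ![a, b]) (D := Set.univ) (G := fun q => q 0 + q 1)
      (by intro k; fin_cases k <;> assumption) (ContDiff.contDiffOn (by fun_prop)) (by simp)
    exact this
  algebraMap_mem' r :=
    ⟨∅, fun _ => r, contDiffOn_const, fun _ => rfl⟩

open Classical in
/-- The partial derivative of `f` with respect to the even coordinate `e` at the point `p`. -/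
noncomputable def pdFun {ι : Type u} (M : SuperDomain ι) (e : M.Even) (f : M.dom → ℝ)
    (p : M.dom) : ℝ :=
  deriv (fun t => if h : Function.update p.1 e t ∈ M.dom then f ⟨_, h⟩ else 0) (p.1 e)

theorem isOpen_restrict {ι : Type u} (M : SuperDomain ι) (s : Finset M.Even) :
    IsOpen (s.restrict '' M.dom : Set (s → ℝ)) := by
  classical
  rw [isOpen_iff_mem_nhds]
  rintro _ ⟨p, hp, rfl⟩
  let j : (s → ℝ) → (M.Even → ℝ) := fun q e => if h : e ∈ s then q ⟨e, h⟩ else p e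
  have hj : Continuous j := by
    refine continuous_pi fun e => ?_
    by_cases h : e ∈ s
    · simpa [j, h] using continuous_apply _
    · simpa [j, h] using continuous_const
  have hjp : j (s.restrict p) = p := by
    funext e; by_cases h : e ∈ s <;> simp [j, h]
  have : j ⁻¹' M.dom ∈ nhds (s.restrict p) :=
    hj.continuousAt.preimage_mem_nhds (M.isOpen_dom.mem_nhds (by rw [hjp]; exact hp))
  filter_upwards [this] with q hq
  refine ⟨j q, hq, ?_⟩
  funext e
  simp [j]

theorem IsSmooth.exists_pd {ι : Type u} {M : SuperDomain ι} {f : M.dom → ℝ} (hf : M.IsSmooth f)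
    (e : M.Even) : ∃ f', M.IsSmooth f' ∧ ∀ p : M.dom,
      HasDerivAt (fun t => open Classical in
        if h : Function.update p.1 e t ∈ M.dom then f ⟨_, h⟩ else 0) (f' p) (p.1 e) := by
  classical
  obtain ⟨s, g, hg, hfg⟩ := hf
  let v : s → ℝ := fun i => if i.1 = e then 1 else 0
  refine ⟨fun p => fderiv ℝ g (s.restrict p.1) v, ⟨s, fun q => fderiv ℝ g q v, ?_, fun _ => rfl⟩,
    fun p => ?_⟩
  · exact (hg.fderiv_of_isOpen (M.isOpen_restrict s) (m := ∞) (by simp)).clm_apply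
      contDiffOn_const
  · have h1 : HasFDerivAt g (fderiv ℝ g (s.restrict p.1)) (s.restrict p.1) :=
      ((hg.contDiffAt ((M.isOpen_restrict s).mem_nhds ⟨p.1, p.2, rfl⟩)).differentiableAt
        (by simp)).hasFDerivAt
    have h2 : HasDerivAt (fun t => s.restrict (Function.update p.1 e t)) v (p.1 e) := by
      rw [hasDerivAt_pi]
      intro i
      by_cases hi : i.1 = e
      · simp only [Finset.restrict, hi, Function.update_self, v, if_true]
        exact hasDerivAt_id _
      · simp only [Finset.restrict, Function.update_of_ne hi, v, hi, if_false]
        exact hasDerivAt_const _ _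
    have h3 := HasFDerivAt.comp_hasDerivAt_of_eq (p.1 e) h1 h2 (by simp)
    refine h3.congr_of_eventuallyEq ?_
    have hc : Continuous (fun t => Function.update p.1 e t) := by fun_prop
    have : ∀ᶠ t in nhds (p.1 e), Function.update p.1 e t ∈ M.dom :=
      hc.continuousAt.preimage_mem_nhds (M.isOpen_dom.mem_nhds (by simp))
    filter_upwards [this] with t ht
    simp [ht, hfg]

/-- The partial derivative with respect to an even coordinate. -/
noncomputable def evenPd {ι : Type u} (M : SuperDomain ι) (e : M.Even) :
    M.SmoothFn →ₗ[ℝ] M.SmoothFn where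
  toFun f := ⟨M.pdFun e f.1, by
    obtain ⟨f', hf', h⟩ := IsSmooth.exists_pd f.2 e
    rwa [show M.pdFun e f.1 = f' from funext fun p => (h p).deriv]⟩
  map_add' f g := by
    obtain ⟨f', _, hf⟩ := IsSmooth.exists_pd f.2 e
    obtain ⟨g', _, hg⟩ := IsSmooth.exists_pd g.2 e
    ext p
    have := ((hf p).add (hg p)).deriv
    simp only [Subalgebra.coe_add, Pi.add_apply, pdFun]
    rw [(hf p).deriv, (hg p).deriv, ← this]
    congr 1
    funext t
    simp only [Pi.add_apply]
    split_ifs <;> simp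
  map_smul' r f := by
    obtain ⟨f', _, hf⟩ := IsSmooth.exists_pd f.2 e
    ext p
    have := ((hf p).const_mul r).deriv
    simp only [Subalgebra.coe_smul, Pi.smul_apply, pdFun, RingHom.id_apply, smul_eq_mul]
    rw [(hf p).deriv, ← this]
    congr 1
    funext t
    split_ifs <;> simp

end SuperDomain
/-! ### Superfunctions on a superdomain -/

namespace SuperDomain

/-- Functions on a superdomain: smooth functions of (finitely many of) the even coordinates with
values in the Grassmann algebra generated by the odd coordinates. -/
abbrev LocalFn {ι : Type u} (M : SuperDomain ι) : Type u :=
  M.SmoothFn ⊗[ℝ] ExteriorAlgebra ℝ (M.Odd →₀ ℝ)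

/-- A smooth function of the even coordinates, as a superfunction. -/
noncomputable def ofSmooth {ι : Type u} (M : SuperDomain ι) (f : M.SmoothFn) : M.LocalFn :=
  f ⊗ₜ[ℝ] 1

/-- An even coordinate, as a smooth function. -/
def proj {ι : Type u} (M : SuperDomain ι) (e : M.Even) : M.SmoothFn :=
  ⟨fun p => p.1 e, M.isSmooth_proj e⟩

open Classical in
/-- The coordinates, as superfunctions. -/
noncomputable def coord {ι : Type u} (M : SuperDomain ι) (i : ι) : M.LocalFn :=
  if h : M.parity i = 0 then M.ofSmooth (M.proj ⟨i, h⟩)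
  else 1 ⊗ₜ[ℝ] ExteriorAlgebra.ι ℝ (Finsupp.single ⟨i, h⟩ 1)

open Classical in
/-- The left partial derivative `∂/∂zⁱ`. -/
noncomputable def pd {ι : Type u} (M : SuperDomain ι) (i : ι) : M.LocalFn →ₗ[ℝ] M.LocalFn :=
  if h : M.parity i = 0 then
    LinearMap.rTensor (ExteriorAlgebra ℝ (M.Odd →₀ ℝ)) (M.evenPd ⟨i, h⟩)
  else
    LinearMap.lTensor M.SmoothFn
      (CliffordAlgebra.contractLeft (Q := (0 : QuadraticForm ℝ (M.Odd →₀ ℝ)))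
        (Finsupp.lapply (⟨i, h⟩ : M.Odd)))

/-- The vector field `∑ᵢ cⁱ ∂/∂zⁱ` acting from the left. A superfunction depends on finitely many
coordinates, so that only finitely many terms of the sum are nonzero. -/
noncomputable def vectorField {ι : Type u} (M : SuperDomain ι) (c : ι → M.LocalFn)
    (f : M.LocalFn) : M.LocalFn :=
  ∑ᶠ i, c i * M.pd i f

/-- The sign `(-1)^p`. -/
noncomputable def sgn (p : ZMod 2) : ℝ := (-1) ^ p.val

/-- `f` is homogeneous of Grassmann parity `p`. -/
def HasParity {ι : Type u} (M : SuperDomain ι) (f : M.LocalFn) (p : ZMod 2) : Prop :=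
  LinearMap.lTensor M.SmoothFn
    (CliffordAlgebra.involute (Q := (0 : QuadraticForm ℝ (M.Odd →₀ ℝ)))).toLinearMap f = sgn p • f

/-- `f` is homogeneous of ghost number `k`: it is an eigenvector of the ghost number vector field
`∑ᵢ gh(zⁱ) zⁱ ∂/∂zⁱ`. -/
def HasGhost {ι : Type u} (M : SuperDomain ι) (f : M.LocalFn) (k : ℤ) : Prop :=
  M.vectorField (fun i => (M.gh i : ℝ) • M.coord i) f = (k : ℝ) • f

end SuperDomain

/-- A map of superdomains `M → N` for which the odd coordinates of `N` become linear combinations,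
with constant coefficients, of the odd coordinates of `M`. -/
structure Morphism {ι : Type u} {κ : Type v} (M : SuperDomain ι) (N : SuperDomain κ) where
  even : N.Even → M.SmoothFn
  even_mem : ∀ p, (fun e => (even e).1 p) ∈ N.dom
  odd : N.Odd → (M.Odd →₀ ℝ)

namespace Morphism

/-- Composition of a smooth function with the underlying map of the domains. -/
def smoothPullback {ι : Type u} {κ : Type v} {M : SuperDomain ι} {N : SuperDomain κ}
    (φ : Morphism M N) : N.SmoothFn →ₐ[ℝ] M.SmoothFn where
  toFun f := ⟨fun p => f.1 ⟨fun e => (φ.even e).1 p, φ.even_mem p⟩, by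
    obtain ⟨s, g, hg, hfg⟩ := f.2
    have := SuperDomain.IsSmooth.comp (M := M) (f := fun e : s => (φ.even e.1).1)
      (fun e => (φ.even e.1).2) hg (fun p => ⟨_, φ.even_mem p, rfl⟩)
    simp only [hfg]
    exact this⟩
  map_one' := rfl
  map_mul' _ _ := rfl
  map_zero' := rfl
  map_add' _ _ := rfl
  commutes' _ := rfl

/-- Substitution of the expressions for the coordinates of `N` into a superfunction on `N`. -/
noncomputable def pullback {ι : Type u} {κ : Type v} {M : SuperDomain ι} {N : SuperDomain κ}
    (φ : Morphism M N) : N.LocalFn →ₐ[ℝ] M.LocalFn :=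
  Algebra.TensorProduct.map φ.smoothPullback
    (ExteriorAlgebra.map (Finsupp.linearCombination ℝ φ.odd))

/-- The map for which the coordinate `k` of `N` becomes the coordinate `j k` of `M`. -/
noncomputable def rename {ι : Type u} {κ : Type v} {M : SuperDomain ι} {N : SuperDomain κ}
    (j : κ → ι) (hj : ∀ k, M.parity (j k) = N.parity k)
    (hdom : ∀ p ∈ M.dom, (fun e : N.Even => p ⟨j e.1, (hj e.1).trans e.2⟩) ∈ N.dom) :
    Morphism M N where
  even e := M.proj ⟨j e.1, (hj e.1).trans e.2⟩
  even_mem p := hdom p.1 p.2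
  odd o := Finsupp.single ⟨j o.1, fun h => o.2 ((hj o.1).symm.trans h)⟩ 1

end Morphism

open SuperDomain

/-! ### Jet spaces -/

/-- Coordinates of the jet space with independent variables `x^μ` and dependent variables indexed
by `ι`: the `x^μ`, and the derivatives `z^α_{(μ)}` with `(μ)` a symmetric multi-index. -/
inductive JetCoord (n : ℕ) (ι : Type u) : Type u
  | base (μ : Fin n) : JetCoord n ι
  | field (α : ι) (m : Multiset (Fin n)) : JetCoord n ι

namespace JetCoord

def parity {n : ℕ} {ι : Type u} (F : SuperDomain ι) : JetCoord n ι → ZMod 2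
  | base _ => 0
  | field α _ => F.parity α

def gh {n : ℕ} {ι : Type u} (F : SuperDomain ι) : JetCoord n ι → ℤ
  | base _ => 0
  | field α _ => F.gh α

end JetCoord

/-- The jet space of fields on `U ⊆ ℝⁿ` with values in the superdomain `F`. -/
def jet {n : ℕ} (U : TopologicalSpace.Opens (Fin n → ℝ)) {ι : Type u} (F : SuperDomain ι) :
    SuperDomain (JetCoord n ι) where
  parity := JetCoord.parity F
  gh := JetCoord.gh F
  dom := {p | (fun μ => p ⟨.base μ, rfl⟩) ∈ U ∧
    (fun e : F.Even => p ⟨.field e.1 0, e.2⟩) ∈ F.dom}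
  isOpen_dom :=
    (U.isOpen.preimage (continuous_pi fun _ => continuous_apply _)).inter
      (F.isOpen_dom.preimage (continuous_pi fun _ => continuous_apply _))

/-- Iterated application of operators `D_μ` along a symmetric multi-index. -/
def iter {n : ℕ} {A : Type u} (D : Fin n → A → A) (m : Multiset (Fin n)) (f : A) : A :=
  (m.sort (· ≤ ·)).foldr D f

/-- Application of `D_{ν₁} ⋯ D_{νₖ}` for `N = {ν₁ < ⋯ < νₖ}`. -/
def iterSkew {n : ℕ} {A : Type u} (D : Fin n → A → A) (N : Finset (Fin n)) (f : A) : A :=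
  (N.sort (· ≤ ·)).foldr D f

/-- The total derivative `∂_μ` on a jet space. -/
noncomputable def totalD {n : ℕ} (U : TopologicalSpace.Opens (Fin n → ℝ)) {ι : Type u}
    (F : SuperDomain ι) (μ : Fin n) : (jet U F).LocalFn → (jet U F).LocalFn :=
  (jet U F).vectorField fun
    | .base ν => if ν = μ then 1 else 0
    | .field α m => (jet U F).coord (.field α (μ ::ₘ m))

/-! ### Gauge theories and their BRST differential -/

/-- The evolutionary vector field `s` with `s x^μ = 0`, `s z^α = S^α` and `[s, ∂_μ] = 0`. -/
noncomputable def evolutionary {n : ℕ} {U : TopologicalSpace.Opens (Fin n → ℝ)} {ι : Type u}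
    {F : SuperDomain ι} (S : ι → (jet U F).LocalFn) : (jet U F).LocalFn → (jet U F).LocalFn :=
  (jet U F).vectorField fun
    | .base _ => 0
    | .field α m => iter (totalD U F) m (S α)

/-- A gauge theory on `V ⊆ ℝⁿ`: graded fields `Ψ^A` and an odd nilpotent BRST differential of
ghost number one, `s Ψ^A = S^A`. -/
structure GaugeTheory (n : ℕ) (V : TopologicalSpace.Opens (Fin n → ℝ)) (ι : Type u) where
  fields : SuperDomain ι
  S : ι → (jet V fields).LocalFn
  parity_S : ∀ A, (jet V fields).HasParity (S A) (fields.parity A + 1)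
  gh_S : ∀ A, (jet V fields).HasGhost (S A) (fields.gh A + 1)
  nilpotent : ∀ f, evolutionary S (evolutionary S f) = 0

/-! ### Superfields -/

/-- The components `Ψ^t_{[ν]}` of superfields `Ψ^t(θ)` with `n` odd variables `θ^ν`. A skew
multi-index `[ν]` is given by the set of its values, listed in increasing order. -/
def superfield (n : ℕ) {ι : Type u} (F : SuperDomain ι) : SuperDomain (ι × Finset (Fin n)) where
  parity t := F.parity t.1 + (t.2.card : ZMod 2)
  gh t := F.gh t.1 - t.2.card
  dom := {p | (fun e : F.Even => p ⟨(e.1, ∅), by simpa using e.2⟩) ∈ F.dom}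
  isOpen_dom := F.isOpen_dom.preimage
    (f := fun (p : {t : ι × Finset (Fin n) // F.parity t.1 + (t.2.card : ZMod 2) = 0} → ℝ)
      (e : F.Even) => p ⟨(e.1, ∅), by simpa using e.2⟩)
    (continuous_pi fun _ => continuous_apply _)

/-- The sign of the permutation that moves `ν` to its place among the elements of `N`. -/
noncomputable def insSign {n : ℕ} (ν : Fin n) (N : Finset (Fin n)) : ℝ :=
  (-1) ^ (N.filter (· < ν)).card

/-- `∂^F/∂θ^ν`: the vector field with `Ψ^t_{(μ)|ν₁…νₖ} ↦ (-1)^{|t|} Ψ^t_{(μ)|νν₁…νₖ}`. -/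
noncomputable def thetaD {n : ℕ} (U : TopologicalSpace.Opens (Fin n → ℝ)) {ι : Type u}
    (F : SuperDomain ι) (ν : Fin n) :
    (jet U (superfield n F)).LocalFn → (jet U (superfield n F)).LocalFn :=
  (jet U (superfield n F)).vectorField fun
    | .base _ => 0
    | .field (t, N) m => if ν ∈ N then 0 else
        (sgn (F.parity t) * insSign ν N) •
          (jet U (superfield n F)).coord (.field (t, insert ν N) m)

/-- `d^F`: the vector field with
`Ψ^t_{(μ)|ν₁…νₚ} ↦ (-1)^{|t|} ∑ᵢ (-1)^{i-1} Ψ^t_{νᵢ(μ)|ν₁…ν̂ᵢ…νₚ}`. -/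
noncomputable def dF {n : ℕ} (U : TopologicalSpace.Opens (Fin n → ℝ)) {ι : Type u}
    (F : SuperDomain ι) :
    (jet U (superfield n F)).LocalFn → (jet U (superfield n F)).LocalFn :=
  (jet U (superfield n F)).vectorField fun
    | .base _ => 0
    | .field (t, N) m => ∑ ν ∈ N, (sgn (F.parity t) * insSign ν N) •
        (jet U (superfield n F)).coord (.field (t, N.erase ν) (ν ::ₘ m))

/-- Prolongation to the superfield jets of an odd vector field given on the components without
`[ν]` and `(μ)` indices by `Ψ^t ↦ Q^t`. It commutes with the `∂_μ` and with the `∂^F/∂θ^ν`; note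
that `Ψ^t_{(μ)|ν₁…νₖ} = (-1)^{k|t|} ∂^F/∂θ^{ν₁} ⋯ ∂^F/∂θ^{νₖ} ∂_{(μ)} Ψ^t`. -/
noncomputable def prolong {n : ℕ} (U : TopologicalSpace.Opens (Fin n → ℝ)) {ι : Type u}
    (F : SuperDomain ι) (Q : ι → (jet U (superfield n F)).LocalFn) :
    (jet U (superfield n F)).LocalFn → (jet U (superfield n F)).LocalFn :=
  (jet U (superfield n F)).vectorField fun
    | .base _ => 0
    | .field (t, N) m => sgn (N.card * (F.parity t + 1)) •
        iterSkew (thetaD U F) N (iter (totalD U (superfield n F)) m (Q t))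

/-! ### The parent formulation -/

/-- The fibre coordinates `Ψ^A_{(λ)}` of the jet space. -/
def jetFibre (n : ℕ) {ι : Type u} (F : SuperDomain ι) :
    SuperDomain (ι × Multiset (Fin n)) where
  parity t := F.parity t.1
  gh t := F.gh t.1
  dom := {p | (fun e : F.Even => p ⟨(e.1, 0), e.2⟩) ∈ F.dom}
  isOpen_dom := F.isOpen_dom.preimage (continuous_pi fun _ => continuous_apply _)

/-- The jet space with coordinates `x^μ, Ψ^A_{(μ)(λ)[ν]}` of the parent formulation: the entry
`.field ((A, l), N) m` is `Ψ^A_{(μ)(λ)[ν]}` with `(μ) = m`, `(λ) = l`, `[ν] = N`. -/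
abbrev parentJet {n : ℕ} (U : TopologicalSpace.Opens (Fin n → ℝ)) {ι : Type u}
    (F : SuperDomain ι) : SuperDomain (JetCoord n ((ι × Multiset (Fin n)) × Finset (Fin n))) :=
  jet U (superfield n (jetFibre n F))

/-- Replacement of the `x`-derivatives of the fields by the corresponding `y`-derivatives. -/
noncomputable def toParent {n : ℕ} (V : TopologicalSpace.Opens (Fin n → ℝ)) {ι : Type u}
    (F : SuperDomain ι) : (jet V F).LocalFn →ₐ[ℝ] (parentJet V F).LocalFn :=
  (Morphism.rename (M := parentJet V F) (N := jet V F)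
    (fun
      | .base μ => .base μ
      | .field A l => .field ((A, l), ∅) 0)
    (by rintro (_ | _) <;> simp [jet, JetCoord.parity, superfield, jetFibre])
    (fun _ hp => hp)).pullback

/-- `∂/∂x^λ + ∂^F/∂y^λ`, with `∂/∂x^λ` acting on the explicit `x` only. -/
noncomputable def yTotalD {n : ℕ} (V : TopologicalSpace.Opens (Fin n → ℝ)) {ι : Type u}
    (F : SuperDomain ι) (lam : Fin n) : (parentJet V F).LocalFn → (parentJet V F).LocalFn :=
  (parentJet V F).vectorField fun
    | .base ν => if ν = lam then 1 else 0
    | .field ((A, l), N) m => (parentJet V F).coord (.field ((A, lam ::ₘ l), N) m)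

/-- `σ^F`: the vector field with
`Ψ^A_{(μ)|(λ)|ν₁…νₚ} ↦ (-1)^{|A|} ∑ᵢ (-1)^{i-1} Ψ^A_{(μ)|νᵢ(λ)|ν₁…ν̂ᵢ…νₚ}`. -/
noncomputable def sigmaF {n : ℕ} (V : TopologicalSpace.Opens (Fin n → ℝ)) {ι : Type u}
    (F : SuperDomain ι) : (parentJet V F).LocalFn → (parentJet V F).LocalFn :=
  (parentJet V F).vectorField fun
    | .base _ => 0
    | .field ((A, l), N) m => ∑ ν ∈ N, (sgn (F.parity A) * insSign ν N) •
        (parentJet V F).coord (.field ((A, ν ::ₘ l), N.erase ν) m)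

namespace GaugeTheory

/-- `s̄`: the extension of `s̄ Ψ^A = S̄^A` that commutes with `∂_μ`, `∂^F/∂θ^ν` and
`∂/∂x^λ + ∂^F/∂y^λ`. -/
noncomputable def sBar {n : ℕ} {V : TopologicalSpace.Opens (Fin n → ℝ)} {ι : Type u}
    (T : GaugeTheory n V ι) : (parentJet V T.fields).LocalFn → (parentJet V T.fields).LocalFn :=
  prolong V (jetFibre n T.fields) fun t =>
    iter (yTotalD V T.fields) t.2 (toParent V T.fields (T.S t.1))

/-- The BRST differential `s^P = d^F - σ^F + s̄` of the parent formulation. -/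
noncomputable def parentDifferential {n : ℕ} {V : TopologicalSpace.Opens (Fin n → ℝ)}
    {ι : Type u} (T : GaugeTheory n V ι) (f : (parentJet V T.fields).LocalFn) :
    (parentJet V T.fields).LocalFn :=
  dF V (jetFibre n T.fields) f - sigmaF V T.fields f + T.sBar f

end GaugeTheory

/-! ### The parametrized parent formulation -/

/-- Substitution of the undifferentiated lowest components of the superfields into functions on
the target space. -/
noncomputable def fromTarget {n : ℕ} (U : TopologicalSpace.Opens (Fin n → ℝ)) {ι : Type u}
    (F : SuperDomain ι) : F.LocalFn →ₐ[ℝ] (jet U (superfield n F)).LocalFn :=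
  (Morphism.rename (M := jet U (superfield n F)) (N := F) (fun t => .field (t, ∅) 0)
    (by simp [jet, JetCoord.parity, superfield])
    (fun _ hp => hp.2)).pullback

/-- The differential `s^{AKSZ} Ψ^t(x,θ) = d Ψ^t(x,θ) + Q^t(Ψ(x,θ))` of the AKSZ-type sigma model
with source coordinates `x^μ, θ^μ`, `x ∈ U`, target `F` and target space vector field `Q`. -/
noncomputable def aksz {n : ℕ} (U : TopologicalSpace.Opens (Fin n → ℝ)) {ι : Type u}
    (F : SuperDomain ι) (Q : ι → F.LocalFn) (f : (jet U (superfield n F)).LocalFn) :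
    (jet U (superfield n F)).LocalFn :=
  dF U F f + prolong U F (fun t => fromTarget U F (Q t)) f

/-- Coordinates `y^a, ξ^a, Ψ^A_{(a)}` of the extended jet space. -/
inductive ExtCoord (n : ℕ) (ι : Type u) : Type u
  | y (a : Fin n) : ExtCoord n ι
  | xi (a : Fin n) : ExtCoord n ι
  | psi (A : ι) (l : Multiset (Fin n)) : ExtCoord n ι

namespace ExtCoord

def parity {n : ℕ} {ι : Type u} (F : SuperDomain ι) : ExtCoord n ι → ZMod 2
  | y _ => 0
  | xi _ => 1
  | psi A _ => F.parity A

def gh {n : ℕ} {ι : Type u} (F : SuperDomain ι) : ExtCoord n ι → ℤ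
  | y _ => 0
  | xi _ => 1
  | psi A _ => F.gh A

end ExtCoord

/-- The extended jet space: functions on it are the horizontal forms of the original theory, with
`ξ^a` standing for `dy^a`. -/
def extJet {n : ℕ} (V : TopologicalSpace.Opens (Fin n → ℝ)) {ι : Type u} (F : SuperDomain ι) :
    SuperDomain (ExtCoord n ι) where
  parity := ExtCoord.parity F
  gh := ExtCoord.gh F
  dom := {p | (fun a => p ⟨.y a, rfl⟩) ∈ V ∧
    (fun e : F.Even => p ⟨.psi e.1 0, e.2⟩) ∈ F.dom}
  isOpen_dom :=
    (V.isOpen.preimage (continuous_pi fun _ => continuous_apply _)).inter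
      (F.isOpen_dom.preimage (continuous_pi fun _ => continuous_apply _))

/-- Local functions of the original theory as functions on the extended jet space. -/
noncomputable def toExt {n : ℕ} (V : TopologicalSpace.Opens (Fin n → ℝ)) {ι : Type u}
    (F : SuperDomain ι) : (jet V F).LocalFn →ₐ[ℝ] (extJet V F).LocalFn :=
  (Morphism.rename (M := extJet V F) (N := jet V F)
    (fun
      | .base a => .y a
      | .field A l => .psi A l)
    (by rintro (_ | _) <;> rfl)
    (fun _ hp => hp)).pullback

/-- The jet space of the parametrized parent formulation. -/
abbrev paramJet {n : ℕ} (U V : TopologicalSpace.Opens (Fin n → ℝ)) {ι : Type u}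
    (F : SuperDomain ι) : SuperDomain (JetCoord n (ExtCoord n ι × Finset (Fin n))) :=
  jet U (superfield n (extJet V F))

namespace GaugeTheory

/-- The components of the total BRST differential `s̃ = s + ξ^a ∂_a`. -/
noncomputable def sTilde {n : ℕ} {V : TopologicalSpace.Opens (Fin n → ℝ)} {ι : Type u}
    (T : GaugeTheory n V ι) : ExtCoord n ι → (extJet V T.fields).LocalFn
  | .y a => (extJet V T.fields).coord (.xi a)
  | .xi _ => 0
  | .psi A l => toExt V T.fields (iter (totalD V T.fields) l (T.S A)) +
      ∑ a, (extJet V T.fields).coord (.xi a) * (extJet V T.fields).coord (.psi A (a ::ₘ l))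

/-- The differential of the parametrized parent formulation, with parameters `x ∈ U`. -/
noncomputable def parametrizedDifferential {n : ℕ} {V : TopologicalSpace.Opens (Fin n → ℝ)}
    {ι : Type u} (T : GaugeTheory n V ι) (U : TopologicalSpace.Opens (Fin n → ℝ)) :
    (paramJet U V T.fields).LocalFn → (paramJet U V T.fields).LocalFn :=
  aksz U (extJet V T.fields) T.sTilde

end GaugeTheory

/-! ### Generalized auxiliary fields -/

/-- The fields `w, v` are generalized auxiliary fields for the differential `s`, the remaining
fields being `φ`. First, `φ, w, v` and their derivatives arise from the original fields by an
invertible change of coordinates on the jet space. Second, the equations `s w|_{w=0} = 0` are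
equivalent to `v = Vsol[φ]`, as algebraic equations in the space of fields and their derivatives:
together with the `w` and their derivatives, both sets of equations generate the same ideal. -/
structure IsGeneralizedAuxiliary {n : ℕ} {U : TopologicalSpace.Opens (Fin n → ℝ)} {ι : Type u}
    {F : SuperDomain ι} (s : (jet U F).LocalFn → (jet U F).LocalFn)
    {α : Type v} {β γ : Type w} (φ : α → (jet U F).LocalFn) (w : β → (jet U F).LocalFn)
    (v : γ → (jet U F).LocalFn) (Vsol : γ → (jet U F).LocalFn) : Prop where
  exists_coordinates : ∃ (N : SuperDomain (JetCoord n (α ⊕ (β ⊕ γ))))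
    (Θ : N.LocalFn ≃ₐ[ℝ] (jet U F).LocalFn),
    (∀ μ, Θ (N.coord (.base μ)) = (jet U F).coord (.base μ)) ∧
    (∀ i m, Θ (N.coord (.field i m)) = iter (totalD U F) m (Sum.elim φ (Sum.elim w v) i)) ∧
    (∀ k, (jet U F).HasParity (Θ (N.coord k)) (N.parity k)) ∧
    (∀ k, (jet U F).HasGhost (Θ (N.coord k)) (N.gh k)) ∧
    (∀ c k m, N.pd (.field (.inr k) m) (Θ.symm (Vsol c)) = 0)
  equations :
    Ideal.span
      (Set.range (fun q : β × Multiset (Fin n) => iter (totalD U F) q.2 (w q.1)) ∪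
        Set.range (fun q : β × Multiset (Fin n) => iter (totalD U F) q.2 (s (w q.1)))) =
    Ideal.span
      (Set.range (fun q : β × Multiset (Fin n) => iter (totalD U F) q.2 (w q.1)) ∪
        Set.range (fun q : γ × Multiset (Fin n) => iter (totalD U F) q.2 (v q.1 - Vsol q.1)))

/-- `ρ` is the restriction to the surface `w = 0`, `v = Vsol[φ]` (and all its derivatives), on
which the `φ` and their derivatives are coordinates. -/
structure IsRestriction {n : ℕ} {U : TopologicalSpace.Opens (Fin n → ℝ)} {ι : Type u}
    {F : SuperDomain ι} {α : Type v} {β γ : Type w} {G : SuperDomain α}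
    (φ : α → (jet U F).LocalFn) (w : β → (jet U F).LocalFn)
    (v : γ → (jet U F).LocalFn) (Vsol : γ → (jet U F).LocalFn)
    (ρ : (jet U F).LocalFn →ₐ[ℝ] (jet U G).LocalFn) : Prop where
  base : ∀ μ, ρ ((jet U F).coord (.base μ)) = (jet U G).coord (.base μ)
  phi : ∀ i m, ρ (iter (totalD U F) m (φ i)) = (jet U G).coord (.field i m)
  w_eq : ∀ b m, ρ (iter (totalD U F) m (w b)) = 0
  v_eq : ∀ c m, ρ (iter (totalD U F) m (v c - Vsol c)) = 0

/-- The reduced differential: `s_R φ = (s φ)|_{w = 0, v = Vsol[φ]}` on the fields `φ` and their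
derivatives, where `ρ` is the restriction. -/
noncomputable def reducedDifferential {n : ℕ} {U : TopologicalSpace.Opens (Fin n → ℝ)}
    {ι : Type u} {F : SuperDomain ι} {α : Type v} {G : SuperDomain α}
    (s : (jet U F).LocalFn → (jet U F).LocalFn) (φ : α → (jet U F).LocalFn)
    (ρ : (jet U F).LocalFn →ₐ[ℝ] (jet U G).LocalFn) :
    (jet U G).LocalFn → (jet U G).LocalFn :=
  (jet U G).vectorField fun
    | .base _ => 0
    | .field i m => ρ (s (iter (totalD U F) m (φ i)))

/-! ### Changes of space-time coordinates and the fields to be eliminated -/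

/-- An invertible change of space-time coordinates `y = Y(x)`, `x ∈ U`, `y ∈ V`. -/
structure CoordChange {n : ℕ} (U V : TopologicalSpace.Opens (Fin n → ℝ)) where
  toFun : (Fin n → ℝ) → (Fin n → ℝ)
  invFun : (Fin n → ℝ) → (Fin n → ℝ)
  contDiffOn_toFun : ContDiffOn ℝ ∞ toFun U
  contDiffOn_invFun : ContDiffOn ℝ ∞ invFun V
  mapsTo : Set.MapsTo toFun U V
  mapsTo_inv : Set.MapsTo invFun V U
  left_inv : Set.LeftInvOn invFun toFun U
  right_inv : Set.RightInvOn invFun toFun V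

namespace CoordChange

/-- `Y^a(x) = δ^a_μ x^μ`. -/
def refl {n : ℕ} (V : TopologicalSpace.Opens (Fin n → ℝ)) : CoordChange V V where
  toFun := id
  invFun := id
  contDiffOn_toFun := contDiffOn_id
  contDiffOn_invFun := contDiffOn_id
  mapsTo := Set.mapsTo_id _
  mapsTo_inv := Set.mapsTo_id _
  left_inv _ _ := rfl
  right_inv _ _ := rfl

/-- `Y^a(x)` as a function on the jet space. -/
def fn {n : ℕ} {U V : TopologicalSpace.Opens (Fin n → ℝ)} (Y : CoordChange U V)
    {ι : Type u} (F : SuperDomain ι) (a : Fin n) : (jet U F).SmoothFn :=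
  ⟨fun p => Y.toFun (fun μ => p.1 ⟨.base μ, rfl⟩) a,
    IsSmooth.comp (M := jet U F) (f := fun (μ : Fin n) p => p.1 ⟨.base μ, rfl⟩)
      (D := (U : Set (Fin n → ℝ))) (G := fun x => Y.toFun x a)
      (fun μ => (jet U F).isSmooth_proj ⟨.base μ, rfl⟩)
      (contDiffOn_pi.1 Y.contDiffOn_toFun a) (fun p => p.2.1)⟩

/-- The partial derivatives `∂_{(μ)} Y^a(x)` as functions on the jet space. -/
noncomputable def deriv {n : ℕ} {U V : TopologicalSpace.Opens (Fin n → ℝ)} (Y : CoordChange U V)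
    {ι : Type u} (F : SuperDomain ι) (m : Multiset (Fin n)) (a : Fin n) : (jet U F).SmoothFn :=
  iter (fun μ f => (jet U F).evenPd ⟨.base μ, rfl⟩ f) m (Y.fn F a)

/-- The remaining fields `Ψ^A_{(λ)[ν]}`. -/
noncomputable def phi {n : ℕ} (U V : TopologicalSpace.Opens (Fin n → ℝ)) {ι : Type u}
    (F : SuperDomain ι) (t : (ι × Multiset (Fin n)) × Finset (Fin n)) :
    (paramJet U V F).LocalFn :=
  (paramJet U V F).coord (.field (.psi t.1.1 t.1.2, t.2) 0)

/-- The fields `y^a - Y^a(x)` and `y^a_{ν₁…νₖ}`, `k > 0`. -/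
noncomputable def w {n : ℕ} {U V : TopologicalSpace.Opens (Fin n → ℝ)} (Y : CoordChange U V)
    {ι : Type u} (F : SuperDomain ι) (q : Fin n × Finset (Fin n)) : (paramJet U V F).LocalFn :=
  (paramJet U V F).coord (.field (.y q.1, q.2) 0) -
    if q.2 = ∅ then (paramJet U V F).ofSmooth (Y.deriv _ 0 q.1) else 0

/-- The fields `ξ^a`, `ξ^a_ν + ∂Y^a/∂x^ν` and `ξ^a_{ν₁…νₖ}`, `k > 1`. -/
noncomputable def v {n : ℕ} {U V : TopologicalSpace.Opens (Fin n → ℝ)} (Y : CoordChange U V)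
    {ι : Type u} (F : SuperDomain ι) (q : Fin n × Finset (Fin n)) : (paramJet U V F).LocalFn :=
  (paramJet U V F).coord (.field (.xi q.1, q.2) 0) +
    ∑ ν, if q.2 = {ν} then (paramJet U V F).ofSmooth (Y.deriv _ {ν} q.1) else 0

/-- The surface on which the fields `w`, `v` and their derivatives vanish, parametrized by `x` and
the derivatives of the remaining fields. -/
noncomputable def surface {n : ℕ} {U V : TopologicalSpace.Opens (Fin n → ℝ)}
    (Y : CoordChange U V) {ι : Type u} (F : SuperDomain ι) :
    Morphism (parentJet U F) (paramJet U V F) where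
  even
    | ⟨.base μ, h⟩ => (parentJet U F).proj ⟨.base μ, h⟩
    | ⟨.field (.y a, N) m, _⟩ => if N = ∅ then Y.deriv _ m a else 0
    | ⟨.field (.xi a, N) m, _⟩ => -∑ ν, if N = {ν} then Y.deriv _ (ν ::ₘ m) a else 0
    | ⟨.field (.psi A l, N) m, h⟩ => (parentJet U F).proj ⟨.field ((A, l), N) m, h⟩
  even_mem p := by
    refine ⟨p.2.1, ?_, p.2.2⟩
    have := Y.mapsTo p.2.1
    simp only [deriv, iter, fn, Multiset.sort_zero, List.foldr_nil, if_true]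
    exact this
  odd
    | ⟨.base _, _⟩ => 0
    | ⟨.field (.y _, _) _, _⟩ => 0
    | ⟨.field (.xi _, _) _, _⟩ => 0
    | ⟨.field (.psi A l, N) m, h⟩ => Finsupp.single ⟨.field ((A, l), N) m, h⟩ 1

/-- The differential obtained from the parametrized parent formulation by the elimination of the
fields `w`, `v`. -/
noncomputable def reduced {n : ℕ} {U V : TopologicalSpace.Opens (Fin n → ℝ)}
    (Y : CoordChange U V) {ι : Type u} (T : GaugeTheory n V ι) :
    (parentJet U T.fields).LocalFn → (parentJet U T.fields).LocalFn :=
  reducedDifferential (G := superfield n (jetFibre n T.fields)) (T.parametrizedDifferential U)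
    (phi U V T.fields) (Y.surface T.fields).pullback

/-- `Θ` expresses the fields over `V` through the fields over `U` when `y = Y(x)`,
`θ'^a = ∂_ν Y^a θ^ν`: the superfields are scalars, `Ψ(x, θ) = Ψ'(Y(x), ∂Y θ)`, so that the components
`Ψ_{[ν]}` transform as tensors, and the total derivatives are related by the chain rule. -/
structure IsFieldTransformation {n : ℕ} {U V : TopologicalSpace.Opens (Fin n → ℝ)}
    (Y : CoordChange U V) {ι : Type u} {F : SuperDomain ι}
    (Θ : (jet V (superfield n F)).LocalFn ≃ₐ[ℝ] (jet U (superfield n F)).LocalFn) : Prop where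
  base : ∀ a, Θ ((jet V (superfield n F)).coord (.base a)) =
    (jet U (superfield n F)).ofSmooth (Y.deriv _ 0 a)
  scalar : ∀ t, Θ ((jet V (superfield n F)).coord (.field (t, ∅) 0)) =
    (jet U (superfield n F)).coord (.field (t, ∅) 0)
  tensor : ∀ ν t N, thetaD U F ν (Θ ((jet V (superfield n F)).coord (.field (t, N) 0))) =
    ∑ a, (jet U (superfield n F)).ofSmooth (Y.deriv _ {ν} a) *
      Θ (thetaD V F a ((jet V (superfield n F)).coord (.field (t, N) 0)))
  totalD : ∀ μ f, ParentBRST.totalD U (superfield n F) μ (Θ f) =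
    ∑ a, (jet U (superfield n F)).ofSmooth (Y.deriv _ {μ} a) *
      Θ (ParentBRST.totalD V (superfield n F) a f)

end CoordChange

end ParentBRST

/-! Elimination. In superfield language the differential acts on the target coordinates by `s y = d
y + ξ`. Component by component this says that `s w` equals `v` up to total derivatives of the `w`
(`differential_w`), because the inhomogeneous term `∂Y^a/∂x^ν` of `v` is exactly what remains when
`∂_ν y^a` is rewritten as `∂_ν (y^a - Y^a)` plus a function of `x`. Equality of the two ideals
follows at once. The fields `w`, `v` differ from the components of `y^a`, `ξ^a` only by functions of
`x`, so the change of jet coordinates is a translation, with the opposite translation as inverse.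

Origin of `σ^F`. On the surface `w = v = 0` the superfield `ξ^a` becomes `-dY^a`, so the term `ξ^a
∂_a` of `s̃` turns into `-dY^a ∂_a`, which is `-σ^F` seen from the coordinates `x`. Formally,
restriction to the surface fails to commute with `∂/∂θ^ν`, and the defect is the contraction `xiD`
(`surface_thetaD`). Applied to `ξ^a ∂_a Ψ` the defect gives `∑_a (∂Y^a/∂x^ν) ∂^F/∂y^a`, which is the
anticommutator of `σ^F` with `∂/∂θ` in the transformed frame (`sigmaF_thetaD`,
`fibreReduced_lower_thetaD`). The reduced and the parent differential agree on the `Ψ^A_{(λ)}` and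
obey the same commutation rules with the `θ`-derivatives (on undifferentiated fields) and the total
derivatives. Since these operators generate all other fields from the `Ψ^A_{(λ)}`, the two
differentials correspond to each other (`reduced_transform`).

Change of coordinates. Put `D_a = ∑_μ (∂x^μ/∂y^a) ∂_μ` and `E_a = ∑_μ (∂x^μ/∂y^a) ∂/∂θ^μ`. The
isomorphism sends the field with multi-indices `(m)`, `[N]` over `V` to `D_m E_N Ψ`, up to a sign.
The `D_a` commute and the `E_a` anticommute, but `[D_a, E_b]` contains the second derivatives of the
inverse change of coordinates. Hence the tensor law holds on undifferentiated fields only, and the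
invariance of `d^F` (`dF_transform`) is not formal: the Hessian terms have to cancel the explicit
`x`-derivative in the anticommutator of `d^F` with `∂/∂θ` (`drift_component`, `dF_component`).

Rigidity. All identities between vector fields are checked on coordinates. This is legitimate
because a graded derivation along a geometric homomorphism vanishes as soon as it kills the
coordinates (`IsDer.eq_zero`), which rests on Hadamard's lemma; geometric homomorphisms are likewise
determined by the coordinates (`IsGeo.ext`). -/

namespace ParentBRST
universe u v w x

/-! ### Graded commutativity of the exterior algebra -/

section Exterior

variable {E : Type u} [AddCommGroup E] [Module ℝ E]

/-- The parity involution of the exterior algebra. -/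
noncomputable abbrev extInv : ExteriorAlgebra ℝ E →ₐ[ℝ] ExteriorAlgebra ℝ E :=
  CliffordAlgebra.involute (Q := (0 : QuadraticForm ℝ E))

theorem extInv_ι (x : E) : extInv (ExteriorAlgebra.ι ℝ x) = -ExteriorAlgebra.ι ℝ x :=
  CliffordAlgebra.involute_ι (Q := (0 : QuadraticForm ℝ E)) x

theorem extInv_extInv (a : ExteriorAlgebra ℝ E) : extInv (extInv a) = a :=
  CliffordAlgebra.involute_involute (Q := (0 : QuadraticForm ℝ E)) a

theorem ι_mul_comm (x : E) (b : ExteriorAlgebra ℝ E) :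
    ExteriorAlgebra.ι ℝ x * b = extInv b * ExteriorAlgebra.ι ℝ x := by
  induction b using ExteriorAlgebra.induction with
  | algebraMap r => rw [AlgHom.commutes, Algebra.commutes]
  | ι y =>
    rw [extInv_ι, neg_mul, eq_neg_iff_add_eq_zero]
    exact ExteriorAlgebra.ι_add_mul_swap x y
  | mul a b ha hb => rw [← mul_assoc, ha, mul_assoc, hb, map_mul, mul_assoc]
  | add a b ha hb => rw [mul_add, ha, hb, map_add, add_mul]

/-- The even part of an element is central and the odd part commutes up to the involution. Stating
both for an arbitrary `a`, without homogeneity, lets the induction pass through products: twice the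
even or odd part of `a * c`, in this normalization, is a sum of products of the even and odd parts
of the factors. -/
theorem ext_graded_comm (a : ExteriorAlgebra ℝ E) : ∀ b : ExteriorAlgebra ℝ E,
    (a + extInv a) * b = b * (a + extInv a) ∧
      (a - extInv a) * b = extInv b * (a - extInv a) := by
  induction a using ExteriorAlgebra.induction with
  | algebraMap r =>
    intro b
    rw [AlgHom.commutes, sub_self, zero_mul, mul_zero, add_mul, mul_add, Algebra.commutes]
    exact ⟨rfl, rfl⟩
  | ι x =>
    intro b
    rw [extInv_ι, add_neg_cancel, zero_mul, mul_zero, sub_neg_eq_add, add_mul, mul_add,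
      ι_mul_comm]
    exact ⟨rfl, rfl⟩
  | mul a c ha hc =>
    intro b
    have e1 : (2 : ℝ) • (a * c + extInv (a * c)) =
        (a + extInv a) * (c + extInv c) + (a - extInv a) * (c - extInv c) := by
      rw [map_mul, two_smul]; noncomm_ring
    have e2 : (2 : ℝ) • (a * c - extInv (a * c)) =
        (a + extInv a) * (c - extInv c) + (a - extInv a) * (c + extInv c) := by
      rw [map_mul, two_smul]; noncomm_ring
    have h2 : (2 : ℝ) ≠ 0 := two_ne_zero
    constructor
    · apply smul_right_injective _ h2
      change (2 : ℝ) • _ = (2 : ℝ) • _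
      rw [← smul_mul_assoc, ← mul_smul_comm, e1, add_mul, mul_add b, mul_assoc, (hc b).1,
        ← mul_assoc, (ha b).1, mul_assoc, mul_assoc, (hc b).2, ← mul_assoc _ (extInv b),
        (ha (extInv b)).2, extInv_extInv, mul_assoc]
    · apply smul_right_injective _ h2
      change (2 : ℝ) • _ = (2 : ℝ) • _
      rw [← smul_mul_assoc, ← mul_smul_comm, e2, add_mul, mul_add (extInv b), mul_assoc, (hc b).2,
        ← mul_assoc, (ha _).1, mul_assoc, mul_assoc, (hc b).1, ← mul_assoc _ b,
        (ha b).2, mul_assoc]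
  | add a c ha hc =>
    intro b
    constructor
    · rw [map_add, add_add_add_comm, add_mul, mul_add, (ha b).1, (hc b).1]
    · rw [map_add, add_sub_add_comm, add_mul, mul_add, (ha b).2, (hc b).2]

theorem ext_contract_mul (d : Module.Dual ℝ E) (a b : ExteriorAlgebra ℝ E) :
    CliffordAlgebra.contractLeft (Q := (0 : QuadraticForm ℝ E)) d (a * b) =
      CliffordAlgebra.contractLeft (Q := (0 : QuadraticForm ℝ E)) d a * b +
        extInv a * CliffordAlgebra.contractLeft (Q := (0 : QuadraticForm ℝ E)) d b := by
  revert b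
  induction a using ExteriorAlgebra.induction with
  | algebraMap r =>
    intro b
    rw [AlgHom.commutes]
    erw [CliffordAlgebra.contractLeft_algebraMap_mul, CliffordAlgebra.contractLeft_algebraMap]
    rw [zero_mul, zero_add]
  | ι x =>
    intro b
    rw [extInv_ι]
    erw [CliffordAlgebra.contractLeft_ι_mul, CliffordAlgebra.contractLeft_ι]
    rw [neg_mul, ← sub_eq_add_neg, Algebra.smul_def]
  | mul a c ha hc =>
    intro b
    rw [mul_assoc, ha, hc, ha, map_mul]
    noncomm_ring
  | add a c ha hc =>
    intro b
    rw [add_mul, map_add, ha, hc, map_add, map_add]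
    noncomm_ring

theorem ext_contract_inv (d : Module.Dual ℝ E) (a : ExteriorAlgebra ℝ E) :
    CliffordAlgebra.contractLeft (Q := (0 : QuadraticForm ℝ E)) d (extInv a) =
      -extInv (CliffordAlgebra.contractLeft (Q := (0 : QuadraticForm ℝ E)) d a) := by
  induction a using ExteriorAlgebra.induction with
  | algebraMap r =>
    rw [AlgHom.commutes]
    erw [CliffordAlgebra.contractLeft_algebraMap]
    rw [map_zero, neg_zero]
  | ι x =>
    rw [extInv_ι, map_neg]
    erw [CliffordAlgebra.contractLeft_ι]
    rw [AlgHom.commutes]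
  | mul a c ha hc =>
    rw [map_mul, ext_contract_mul, ha, hc, ext_contract_mul, map_add, map_mul, map_mul]
    noncomm_ring
  | add a c ha hc => rw [map_add, map_add, ha, hc, map_add, map_add, neg_add]

end Exterior

/-! ### The algebra of superfunctions and its signs -/

namespace SuperDomain

section Instances

variable {ι : Type u} (M : SuperDomain ι)

noncomputable scoped instance instRingLocalFn : Ring M.LocalFn := Algebra.TensorProduct.instRing
noncomputable scoped instance instAlgebraLocalFn : Algebra ℝ M.LocalFn :=
  Algebra.TensorProduct.leftAlgebra
noncomputable scoped instance instSemiringLocalFn : Semiring M.LocalFn :=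
  Algebra.TensorProduct.instSemiring
noncomputable scoped instance instAddCommGroupLocalFn : AddCommGroup M.LocalFn :=
  (instRingLocalFn M).toAddCommGroup
noncomputable scoped instance instAddGroupLocalFn : AddGroup M.LocalFn :=
  (instAddCommGroupLocalFn M).toAddGroup
noncomputable scoped instance instSubNegMonoidLocalFn : SubNegMonoid M.LocalFn :=
  (instAddGroupLocalFn M).toSubNegMonoid
noncomputable scoped instance instAddCommMonoidLocalFn : AddCommMonoid M.LocalFn :=
  TensorProduct.addCommMonoid
noncomputable scoped instance instModuleLocalFn : Module ℝ M.LocalFn := TensorProduct.leftModule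

end Instances

variable {ι : Type u} {M : SuperDomain ι}

theorem sgn_zero : sgn 0 = 1 := by simp [sgn]
theorem sgn_one : sgn 1 = -1 := by simp [sgn, ZMod.val_one]

theorem zmod_cases (p : ZMod 2) : p = 0 ∨ p = 1 := by
  fin_cases p
  · exact Or.inl rfl
  · exact Or.inr rfl

theorem sgn_add (p q : ZMod 2) : sgn (p + q) = sgn p * sgn q := by
  rcases zmod_cases p with rfl | rfl <;> rcases zmod_cases q with rfl | rfl <;>
    simp [sgn_zero, sgn_one, show (1 : ZMod 2) + 1 = 0 from rfl]

theorem sgn_mul_self (p : ZMod 2) : sgn p * sgn p = 1 := by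
  rcases zmod_cases p with rfl | rfl <;> simp [sgn_zero, sgn_one]

/-! ### The parity involution on superfunctions -/

/-- The parity involution. -/
noncomputable def pInv (M : SuperDomain ι) : M.LocalFn →ₐ[ℝ] M.LocalFn :=
  Algebra.TensorProduct.map (AlgHom.id ℝ _) extInv

theorem pInv_tmul (f : M.SmoothFn) (a : ExteriorAlgebra ℝ (M.Odd →₀ ℝ)) :
    M.pInv (f ⊗ₜ a) = f ⊗ₜ extInv a := rfl

theorem hasParity_iff (f : M.LocalFn) (p : ZMod 2) : M.HasParity f p ↔ M.pInv f = sgn p • f :=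
  Iff.rfl

theorem pInv_pInv (f : M.LocalFn) : M.pInv (M.pInv f) = f := by
  induction f using TensorProduct.induction_on with
  | zero => simp
  | tmul f a => rw [pInv_tmul, pInv_tmul, extInv_extInv]
  | add a b ha hb => rw [map_add, map_add, ha, hb]

theorem graded_comm (c : M.LocalFn) : ∀ f : M.LocalFn,
    (c + M.pInv c) * f = f * (c + M.pInv c) ∧
      (c - M.pInv c) * f = M.pInv f * (c - M.pInv c) := by
  induction c using TensorProduct.induction_on with
  | zero => intro f; simp
  | add a c ha hc =>
    intro b
    constructor
    · rw [map_add, add_add_add_comm, add_mul, mul_add, (ha b).1, (hc b).1]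
    · rw [map_add, add_sub_add_comm, add_mul, mul_add, (ha b).2, (hc b).2]
  | tmul a x =>
    intro f
    induction f using TensorProduct.induction_on with
    | zero => simp
    | add f g hf hg =>
      constructor
      · rw [mul_add, hf.1, hg.1, add_mul]
      · rw [mul_add, hf.2, hg.2, map_add, add_mul]
    | tmul b y =>
      rw [pInv_tmul, pInv_tmul, ← TensorProduct.tmul_add, ← TensorProduct.tmul_sub]
      simp only [Algebra.TensorProduct.tmul_mul_tmul]
      rw [(ext_graded_comm x y).1, (ext_graded_comm x y).2, mul_comm a b]
      exact ⟨rfl, rfl⟩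

/-- The parity involution to the power `p`. -/
noncomputable def twist (M : SuperDomain ι) (p : ZMod 2) : M.LocalFn →ₐ[ℝ] M.LocalFn :=
  if p = 0 then AlgHom.id ℝ _ else M.pInv

theorem twist_zero : M.twist 0 = AlgHom.id ℝ _ := if_pos rfl
theorem twist_one : M.twist 1 = M.pInv := if_neg one_ne_zero

theorem twist_add (p q : ZMod 2) (f : M.LocalFn) :
    M.twist (p + q) f = M.twist p (M.twist q f) := by
  rcases zmod_cases p with rfl | rfl <;> rcases zmod_cases q with rfl | rfl <;>
    simp [twist_zero, twist_one, show (1 : ZMod 2) + 1 = 0 from rfl, pInv_pInv]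

theorem twist_of_hasParity {f : M.LocalFn} {q : ZMod 2} (hf : M.HasParity f q) (p : ZMod 2) :
    M.twist p f = sgn (p * q) • f := by
  rcases zmod_cases p with rfl | rfl
  · simp [twist_zero, sgn_zero]
  · rw [twist_one, one_mul]; exact hf

theorem HasParity.mul_comm {c : M.LocalFn} {q : ZMod 2} (hc : M.HasParity c q) (f : M.LocalFn) :
    c * f = M.twist q f * c := by
  have h2 : (2 : ℝ) ≠ 0 := two_ne_zero
  rw [hasParity_iff] at hc
  apply smul_right_injective _ h2
  change (2 : ℝ) • _ = (2 : ℝ) • _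
  rcases zmod_cases q with rfl | rfl
  · have := (graded_comm c f).1
    rw [hc, sgn_zero, one_smul, ← two_smul ℝ, smul_mul_assoc, mul_smul_comm] at this
    rw [this, twist_zero]; rfl
  · have := (graded_comm c f).2
    rw [hc, sgn_one, neg_one_smul ℝ, sub_neg_eq_add, ← two_smul ℝ, smul_mul_assoc,
      mul_smul_comm] at this
    rw [this, twist_one]

theorem HasParity.comm {c : M.LocalFn} (hc : M.HasParity c 0) (f : M.LocalFn) :
    c * f = f * c := by
  rw [hc.mul_comm f, twist_zero]; rfl

/-- Graded commutativity gives `c * c = -(c * c)`, and 2 is invertible over `ℝ`. This is the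
condition under which odd elements may be substituted for the generators of an exterior algebra. -/
theorem HasParity.sq_zero {c : M.LocalFn} (hc : M.HasParity c 1) : c * c = 0 := by
  have h := hc.mul_comm c
  rw [twist_one, (hasParity_iff _ _).1 hc, sgn_one, neg_one_smul ℝ, neg_mul] at h
  have h2 : (2 : ℝ) • (c * c) = 0 := by
    rw [two_smul]; nth_rewrite 1 [h]; exact neg_add_cancel _
  exact (smul_eq_zero.1 h2).resolve_left two_ne_zero

theorem HasParity.mul {c d : M.LocalFn} {p q : ZMod 2} (hc : M.HasParity c p)
    (hd : M.HasParity d q) : M.HasParity (c * d) (p + q) := by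
  rw [hasParity_iff] at *
  rw [map_mul, hc, hd, sgn_add, smul_mul_smul_comm]

theorem HasParity.add {c d : M.LocalFn} {p : ZMod 2} (hc : M.HasParity c p)
    (hd : M.HasParity d p) : M.HasParity (c + d) p := by
  rw [hasParity_iff] at *
  rw [map_add, hc, hd, smul_add]

theorem hasParity_zero (p : ZMod 2) : M.HasParity 0 p := by
  rw [hasParity_iff, map_zero, smul_zero]

theorem HasParity.smul {c : M.LocalFn} {p : ZMod 2} (hc : M.HasParity c p) (r : ℝ) :
    M.HasParity (r • c) p := by
  rw [hasParity_iff] at *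
  rw [map_smul, hc, smul_comm]

theorem HasParity.sum {α : Type v} {s : Finset α} {c : α → M.LocalFn} {p : ZMod 2}
    (hc : ∀ i ∈ s, M.HasParity (c i) p) : M.HasParity (∑ i ∈ s, c i) p := by
  rw [hasParity_iff, map_sum, Finset.smul_sum]
  exact Finset.sum_congr rfl hc

theorem hasParity_ofSmooth (f : M.SmoothFn) : M.HasParity (M.ofSmooth f) 0 := by
  rw [hasParity_iff, sgn_zero, one_smul, ofSmooth, pInv_tmul, map_one]

theorem hasParity_one : M.HasParity 1 0 := by
  rw [hasParity_iff, sgn_zero, one_smul, map_one]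

/-- An odd coordinate. -/
noncomputable def oddCoord (M : SuperDomain ι) (o : M.Odd) : M.LocalFn :=
  1 ⊗ₜ ExteriorAlgebra.ι ℝ (Finsupp.single o 1)

theorem coord_even {i : ι} (h : M.parity i = 0) : M.coord i = M.ofSmooth (M.proj ⟨i, h⟩) :=
  dif_pos h
theorem coord_odd {i : ι} (h : M.parity i ≠ 0) : M.coord i = M.oddCoord ⟨i, h⟩ :=
  dif_neg h

theorem hasParity_tmul_ι (f : M.SmoothFn) (x : M.Odd →₀ ℝ) :
    M.HasParity (f ⊗ₜ ExteriorAlgebra.ι ℝ x) 1 := by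
  rw [hasParity_iff, sgn_one, neg_one_smul ℝ, pInv_tmul, extInv_ι, TensorProduct.tmul_neg]

theorem hasParity_coord (i : ι) : M.HasParity (M.coord i) (M.parity i) := by
  by_cases h : M.parity i = 0
  · rw [coord_even h, h]; exact hasParity_ofSmooth _
  · rw [coord_odd h, (zmod_cases _).resolve_left h]; exact hasParity_tmul_ι _ _

/-- `ofSmooth` as a homomorphism of algebras. -/
noncomputable def ofSmoothHom (M : SuperDomain ι) : M.SmoothFn →ₐ[ℝ] M.LocalFn :=
  Algebra.TensorProduct.includeLeft

theorem ofSmoothHom_apply (f : M.SmoothFn) : M.ofSmoothHom f = M.ofSmooth f := rfl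

theorem tmul_eq (f : M.SmoothFn) (a : ExteriorAlgebra ℝ (M.Odd →₀ ℝ)) :
    f ⊗ₜ a = M.ofSmooth f * ((1 : M.SmoothFn) ⊗ₜ[ℝ] a) := by
  rw [ofSmooth, Algebra.TensorProduct.tmul_mul_tmul, mul_one, one_mul]

/-- A subset of the superfunctions that contains the smooth functions and the odd coordinates and
is closed under sums and products is everything. -/
theorem localFn_induction {P : M.LocalFn → Prop} (hs : ∀ f, P (M.ofSmooth f))
    (ho : ∀ o, P (M.oddCoord o)) (hadd : ∀ f g, P f → P g → P (f + g))
    (hmul : ∀ f g, P f → P g → P (f * g)) (f : M.LocalFn) : P f := by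
  have hz : P 0 := by
    have := hs 0
    rwa [ofSmooth, TensorProduct.zero_tmul] at this
  have hr : ∀ r : ℝ, P (algebraMap ℝ M.LocalFn r) := fun r => hs (algebraMap ℝ _ r)
  have hi : ∀ x : M.Odd →₀ ℝ, P (1 ⊗ₜ ExteriorAlgebra.ι ℝ x) := by
    intro x
    induction x using Finsupp.induction_linear with
    | zero => rw [map_zero, TensorProduct.tmul_zero]; exact hz
    | add f g hf hg => rw [map_add, TensorProduct.tmul_add]; exact hadd _ _ hf hg
    | single o r =>
      have : (1 : M.SmoothFn) ⊗ₜ[ℝ] ExteriorAlgebra.ι ℝ (Finsupp.single o r) =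
          algebraMap ℝ M.LocalFn r * M.oddCoord o := by
        rw [← Algebra.smul_def, oddCoord, ← TensorProduct.tmul_smul, ← map_smul,
          Finsupp.smul_single, smul_eq_mul, mul_one]
      rw [this]
      exact hmul _ _ (hr r) (ho o)
  have he : ∀ a : ExteriorAlgebra ℝ (M.Odd →₀ ℝ), P (1 ⊗ₜ a) := by
    intro a
    induction a using ExteriorAlgebra.induction with
    | algebraMap r =>
      have : (1 : M.SmoothFn) ⊗ₜ[ℝ] algebraMap ℝ (ExteriorAlgebra ℝ (M.Odd →₀ ℝ)) r =
          algebraMap ℝ M.LocalFn r := by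
        rw [Algebra.algebraMap_eq_smul_one, TensorProduct.tmul_smul,
          Algebra.algebraMap_eq_smul_one]
        rfl
      rw [this]; exact hr r
    | ι x => exact hi x
    | mul a b ha hb =>
      have := hmul _ _ ha hb
      rwa [Algebra.TensorProduct.tmul_mul_tmul, mul_one] at this
    | add a b ha hb => rw [TensorProduct.tmul_add]; exact hadd _ _ ha hb
  induction f using TensorProduct.induction_on with
  | zero => exact hz
  | tmul f a => rw [tmul_eq]; exact hmul _ _ (hs f) (he a)
  | add a b ha hb => exact hadd _ _ ha hb

/-! ### Partial derivatives -/

theorem evenPd_mul (e : M.Even) (f g : M.SmoothFn) :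
    M.evenPd e (f * g) = M.evenPd e f * g + f * M.evenPd e g := by
  obtain ⟨f', _, hf⟩ := IsSmooth.exists_pd f.2 e
  obtain ⟨g', _, hg⟩ := IsSmooth.exists_pd g.2 e
  ext p
  have hfg := ((hf p).mul (hg p)).deriv
  have h1 : ((M.evenPd e f : M.SmoothFn) : M.dom → ℝ) p = f' p := (hf p).deriv
  have h2 : ((M.evenPd e g : M.SmoothFn) : M.dom → ℝ) p = g' p := (hg p).deriv
  simp only [Subalgebra.coe_add, Subalgebra.coe_mul, Pi.add_apply, Pi.mul_apply, h1, h2]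
  simp only [Function.update_eq_self, Subtype.coe_prop, dite_true] at hfg
  rw [← hfg]
  change deriv _ _ = _
  congr 1
  funext t
  simp only [Pi.mul_apply]
  split_ifs <;> simp

theorem pd_even_tmul {i : ι} (h : M.parity i = 0) (f : M.SmoothFn)
    (a : ExteriorAlgebra ℝ (M.Odd →₀ ℝ)) : M.pd i (f ⊗ₜ a) = M.evenPd ⟨i, h⟩ f ⊗ₜ a := by
  rw [pd, dif_pos h]; rfl

theorem pd_odd_tmul {i : ι} (h : M.parity i ≠ 0) (f : M.SmoothFn)
    (a : ExteriorAlgebra ℝ (M.Odd →₀ ℝ)) : M.pd i (f ⊗ₜ a) =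
      f ⊗ₜ CliffordAlgebra.contractLeft (Q := (0 : QuadraticForm ℝ (M.Odd →₀ ℝ)))
        (Finsupp.lapply (⟨i, h⟩ : M.Odd)) a := by
  rw [pd, dif_neg h]; rfl

theorem pd_mul (i : ι) (f g : M.LocalFn) :
    M.pd i (f * g) = M.pd i f * g + M.twist (M.parity i) f * M.pd i g := by
  induction f using TensorProduct.induction_on with
  | zero => simp
  | add a b ha hb => rw [add_mul, map_add, ha, hb, map_add, map_add, add_mul, add_mul]; abel
  | tmul f a =>
    induction g using TensorProduct.induction_on with
    | zero => simp
    | add c d hc hd => rw [mul_add, map_add, hc, hd, map_add, mul_add, mul_add]; abel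
    | tmul g b =>
      by_cases h : M.parity i = 0
      · rw [h, twist_zero, AlgHom.id_apply]
        simp only [Algebra.TensorProduct.tmul_mul_tmul, pd_even_tmul h]
        rw [evenPd_mul, TensorProduct.add_tmul]
      · rw [(zmod_cases _).resolve_left h, twist_one]
        simp only [Algebra.TensorProduct.tmul_mul_tmul, pd_odd_tmul h, pInv_tmul]
        rw [ext_contract_mul, TensorProduct.tmul_add]

theorem pd_pInv (i : ι) (f : M.LocalFn) :
    M.pd i (M.pInv f) = sgn (M.parity i) • M.pInv (M.pd i f) := by
  induction f using TensorProduct.induction_on with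
  | zero => simp
  | add a b ha hb => rw [map_add, map_add, ha, hb, map_add, map_add, smul_add]
  | tmul f a =>
    by_cases h : M.parity i = 0
    · rw [h, sgn_zero, one_smul, pInv_tmul, pd_even_tmul h, pd_even_tmul h, pInv_tmul]
    · rw [(zmod_cases _).resolve_left h, sgn_one, neg_one_smul ℝ, pInv_tmul, pd_odd_tmul h,
        pd_odd_tmul h, pInv_tmul, ext_contract_inv, TensorProduct.tmul_neg]

open Classical in
theorem evenPd_proj (e e' : M.Even) :
    M.evenPd e (M.proj e') = if e = e' then 1 else 0 := by
  obtain ⟨f', _, hf⟩ := IsSmooth.exists_pd (M.proj e').2 e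
  ext p
  have hc : Continuous (fun t => Function.update p.1 e t) := by fun_prop
  have hmem : ∀ᶠ t in nhds (p.1 e), Function.update p.1 e t ∈ M.dom :=
    hc.continuousAt.preimage_mem_nhds (M.isOpen_dom.mem_nhds (by simp))
  change deriv _ _ = _
  have : HasDerivAt (fun t => open Classical in if h : Function.update p.1 e t ∈ M.dom then
      (M.proj e').1 ⟨_, h⟩ else 0) (if e = e' then 1 else 0) (p.1 e) := by
    by_cases he : e = e'
    · subst he
      rw [if_pos rfl]
      refine (hasDerivAt_id _).congr_of_eventuallyEq ?_
      filter_upwards [hmem] with t ht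
      simp only [ht, dite_true, proj, Function.update_self, id]
    · rw [if_neg he]
      refine (hasDerivAt_const _ (p.1 e')).congr_of_eventuallyEq ?_
      filter_upwards [hmem] with t ht
      simp only [ht, dite_true, proj, Function.update_of_ne (Ne.symm he)]
  rw [this.deriv]
  split_ifs <;> rfl

open Classical in
theorem pd_coord (i j : ι) : M.pd i (M.coord j) = if i = j then 1 else 0 := by
  by_cases hi : M.parity i = 0 <;> by_cases hj : M.parity j = 0
  · rw [coord_even hj, ofSmooth, pd_even_tmul hi, evenPd_proj]
    by_cases h : i = j
    · subst h; simp; rfl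
    · simp [h]
  · rw [coord_odd hj, oddCoord, pd_even_tmul hi, if_neg (by rintro rfl; exact hj hi)]
    have : M.evenPd ⟨i, hi⟩ 1 = 0 := by
      have := M.evenPd_mul ⟨i, hi⟩ 1 1
      simpa using this
    rw [this, TensorProduct.zero_tmul]
  · rw [coord_even hj, ofSmooth, pd_odd_tmul hi, if_neg (by rintro rfl; exact hi hj)]
    rw [CliffordAlgebra.contractLeft_one, TensorProduct.tmul_zero]
  · rw [coord_odd hj, oddCoord, pd_odd_tmul hi]
    erw [CliffordAlgebra.contractLeft_ι]
    by_cases h : i = j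
    · subst h; simp; rfl
    · simp [h]

open Classical in
theorem evenPd_eq_zero {s : Finset M.Even} {g : (s → ℝ) → ℝ} {f : M.SmoothFn}
    (hf : ∀ p : M.dom, f.1 p = g (s.restrict p.1)) {e : M.Even} (he : e ∉ s) :
    M.evenPd e f = 0 := by
  ext p
  change deriv _ _ = 0
  have hc : Continuous (fun t => Function.update p.1 e t) := by fun_prop
  have hmem : ∀ᶠ t in nhds (p.1 e), Function.update p.1 e t ∈ M.dom :=
    hc.continuousAt.preimage_mem_nhds (M.isOpen_dom.mem_nhds (by simp))
  have : HasDerivAt (fun t => open Classical in if h : Function.update p.1 e t ∈ M.dom then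
      f.1 ⟨_, h⟩ else 0) 0 (p.1 e) := by
    refine (hasDerivAt_const _ (g (s.restrict p.1))).congr_of_eventuallyEq ?_
    filter_upwards [hmem] with t ht
    rw [dif_pos ht, hf]
    congr 1
    funext i
    have : i.1 ≠ e := fun h => he (h ▸ i.2)
    simp [Finset.restrict, Function.update_of_ne this]
  exact this.deriv

/-- Superfunctions are generated by smooth functions of finitely many coordinates and by single odd
coordinates. The lemma turns the sum in `vectorField` into a finite one, without which additivity
and the Leibniz rule would be unavailable for `finsum`. -/
theorem exists_finset_pd (f : M.LocalFn) : ∃ s : Finset ι, ∀ i ∉ s, M.pd i f = 0 := by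
  classical
  induction f using localFn_induction with
  | hs f =>
    obtain ⟨s, g, _, hf⟩ := f.2
    refine ⟨s.image Subtype.val, fun i hi => ?_⟩
    by_cases h : M.parity i = 0
    · rw [ofSmooth, pd_even_tmul h, evenPd_eq_zero hf, TensorProduct.zero_tmul]
      exact fun h' => hi (Finset.mem_image_of_mem _ h')
    · rw [ofSmooth, pd_odd_tmul h, CliffordAlgebra.contractLeft_one, TensorProduct.tmul_zero]
  | ho o =>
    refine ⟨{o.1}, fun i hi => ?_⟩
    rw [show M.oddCoord o = M.coord o.1 from (coord_odd o.2).symm, pd_coord, if_neg]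
    simpa using hi
  | hadd f g hf hg =>
    obtain ⟨s, hs⟩ := hf
    obtain ⟨t, ht⟩ := hg
    refine ⟨s ∪ t, fun i hi => ?_⟩
    rw [Finset.notMem_union] at hi
    rw [map_add, hs i hi.1, ht i hi.2, add_zero]
  | hmul f g hf hg =>
    obtain ⟨s, hs⟩ := hf
    obtain ⟨t, ht⟩ := hg
    refine ⟨s ∪ t, fun i hi => ?_⟩
    rw [Finset.notMem_union] at hi
    rw [pd_mul, hs i hi.1, ht i hi.2, zero_mul, mul_zero, add_zero]

/-! ### Vector fields -/

theorem vectorField_eq_sum (c : ι → M.LocalFn) {f : M.LocalFn} {s : Finset ι}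
    (hs : ∀ i ∉ s, M.pd i f = 0) : M.vectorField c f = ∑ i ∈ s, c i * M.pd i f := by
  refine finsum_eq_sum_of_support_subset _ fun i hi => ?_
  by_contra h
  exact hi (by simp [hs i h])

theorem vectorField_coord (c : ι → M.LocalFn) (i : ι) : M.vectorField c (M.coord i) = c i := by
  classical
  rw [vectorField_eq_sum c (s := {i}) (fun j hj => by
    rw [pd_coord, if_neg]; simpa using hj), Finset.sum_singleton, pd_coord, if_pos rfl, mul_one]

end SuperDomain

/-! ### Hadamard's lemma -/

section Hadamard

variable {E : Type u} [NormedAddCommGroup E] [NormedSpace ℝ E] [FiniteDimensional ℝ E]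

/-- Differentiation under the integral sign, iterated. The target `F` varies in the induction
because the derivative of the integral is the integral of a function with values in `E →L[ℝ] F`. The
dominating constant is a bound on the compact set formed by a closed ball and the unit interval. -/
theorem contDiff_integral_param (n : ℕ) : ∀ {F : Type u} [NormedAddCommGroup F]
    [NormedSpace ℝ F] [CompleteSpace F] {h : E × ℝ → F}, ContDiff ℝ n h →
      ContDiff ℝ n (fun x => ∫ t in (0 : ℝ)..1, h (x, t)) := by
  induction n with
  | zero =>
    intro F _ _ _ h hh
    rw [Nat.cast_zero, contDiff_zero] at *
    exact intervalIntegral.continuous_parametric_intervalIntegral_of_continuous'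
      (f := fun x t => h (x, t)) hh 0 1
  | succ n ih =>
    intro F _ _ _ h hh
    have : ProperSpace E := FiniteDimensional.proper ℝ E
    let h' : E × ℝ → E →L[ℝ] F := fun z => (fderiv ℝ h z).comp (ContinuousLinearMap.inl ℝ E ℝ)
    have hh' : ContDiff ℝ n h' :=
      (hh.fderiv_right (m := n) (by norm_cast)).clm_comp contDiff_const
    rw [Nat.cast_add, Nat.cast_one, contDiff_succ_iff_hasFDerivAt]
    refine ⟨fun x => ∫ t in (0 : ℝ)..1, h' (x, t), ih hh', fun x₀ => ?_⟩
    have hK : IsCompact (Metric.closedBall x₀ 1 ×ˢ Set.Icc (0 : ℝ) 1) :=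
      (isCompact_closedBall x₀ 1).prod isCompact_Icc
    obtain ⟨C, hC⟩ := hK.exists_bound_of_continuousOn hh'.continuous.continuousOn
    have hcont : ∀ x, Continuous fun t => h (x, t) := fun x =>
      hh.continuous.comp (by fun_prop)
    refine intervalIntegral.hasFDerivAt_integral_of_dominated_of_fderiv_le
      (F := fun x t => h (x, t)) (F' := fun x t => h' (x, t)) (bound := fun _ => C)
      (Metric.ball_mem_nhds x₀ one_pos)
      (Filter.Eventually.of_forall fun x => (hcont x).aestronglyMeasurable)
      ((hcont x₀).intervalIntegrable _ _)
      (hh'.continuous.comp (by fun_prop : Continuous fun t : ℝ => (x₀, t))).aestronglyMeasurable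
      (Filter.Eventually.of_forall fun t ht x hx => ?_) intervalIntegrable_const
      (Filter.Eventually.of_forall fun t _ x _ => ?_)
    · refine hC (x, t) ⟨Metric.ball_subset_closedBall hx, ?_⟩
      rw [Set.uIoc_of_le zero_le_one] at ht
      exact ⟨ht.1.le, ht.2⟩
    · have h1 : HasFDerivAt h (fderiv ℝ h (x, t)) (x, t) :=
        (hh.differentiable (by norm_cast)).differentiableAt.hasFDerivAt
      exact h1.comp x (hasFDerivAt_prodMk_left x t)

/-- Fundamental theorem of calculus along the segment from `q` to `x`: `H x` is the integral of the
derivative of `g` over that segment. -/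
theorem hadamard_global {g : E → ℝ} (hg : ContDiff ℝ ∞ g) (q : E) :
    ∃ H : E → E →L[ℝ] ℝ, ContDiff ℝ ∞ H ∧ ∀ x, g x = g q + H x (x - q) := by
  let h : E × ℝ → E →L[ℝ] ℝ := fun z => fderiv ℝ g (q + z.2 • (z.1 - q))
  have hh : ContDiff ℝ ∞ h :=
    (hg.fderiv_right (m := ∞) (by simp)).comp (by fun_prop)
  refine ⟨fun x => ∫ t in (0 : ℝ)..1, h (x, t), ?_, fun x => ?_⟩
  · rw [contDiff_infty]
    exact fun n => contDiff_integral_param n (contDiff_infty.1 hh n)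
  · have hcont : Continuous fun t => h (x, t) := hh.continuous.comp (by fun_prop)
    have h1 := (ContinuousLinearMap.apply ℝ ℝ (x - q)).intervalIntegral_comp_comm
      (hcont.intervalIntegrable (μ := MeasureTheory.volume) 0 1)
    have h2 : ∀ t ∈ Set.uIcc (0 : ℝ) 1, HasDerivAt (fun t : ℝ => g (q + t • (x - q)))
        (h (x, t) (x - q)) t := by
      intro t _
      have e : HasDerivAt (fun t : ℝ => q + t • (x - q)) (x - q) t := by
        simpa using ((hasDerivAt_id t).smul_const (x - q)).const_add q
      exact ((hg.differentiable (by simp)).differentiableAt.hasFDerivAt).comp_hasDerivAt t e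
    have h3 := intervalIntegral.integral_eq_sub_of_hasDerivAt h2
      ((hcont.clm_apply continuous_const).intervalIntegrable 0 1)
    simp only [ContinuousLinearMap.apply_apply] at h1
    rw [← h1, h3]
    simp

/-- `W` need not be star-shaped about `q`, so a bump function `χ` equal to 1 near `q` splits `g`.
The part `χ g` extends smoothly by zero and falls under `hadamard_global`. The part `(1 - χ) g`
vanishes near `q`, so it can be divided by the squared distance `N`, and `∑ (x i - q i)² / N = 1`
away from `q`. -/
theorem hadamard {s : Type u} [Fintype s] {W : Set (s → ℝ)} (hW : IsOpen W) {g : (s → ℝ) → ℝ}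
    (hg : ContDiffOn ℝ ∞ g W) {q : s → ℝ} (hq : q ∈ W) :
    ∃ G : s → (s → ℝ) → ℝ, (∀ i, ContDiffOn ℝ ∞ (G i) W) ∧
      ∀ x ∈ W, g x = g q + ∑ i, (x i - q i) * G i x := by
  classical
  obtain ⟨r, hr, hrW⟩ := Metric.nhds_basis_closedBall.mem_iff.1 (hW.mem_nhds hq)
  let χ : ContDiffBump q := ⟨r / 2, r, half_pos hr, half_lt_self hr⟩
  have hχ : ContDiff ℝ ∞ χ := χ.contDiff
  have hsupp : tsupport χ ⊆ W := by rw [χ.tsupport_eq]; exact hrW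
  have hg1 : ContDiff ℝ ∞ fun x => χ x * g x := by
    rw [contDiff_iff_contDiffAt]
    intro x
    by_cases hx : x ∈ W
    · exact hχ.contDiffAt.mul (hg.contDiffAt (hW.mem_nhds hx))
    · have : ∀ᶠ z in nhds x, χ z * g z = 0 := by
        filter_upwards [(isClosed_tsupport χ).isOpen_compl.mem_nhds fun h => hx (hsupp h)]
          with z hz
        rw [image_eq_zero_of_notMem_tsupport hz, zero_mul]
      exact (contDiffAt_const (c := (0 : ℝ))).congr_of_eventuallyEq this
  obtain ⟨H, hH, hgH⟩ := hadamard_global hg1 q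
  let N : (s → ℝ) → ℝ := fun x => ∑ j, (x j - q j) ^ 2
  have hN : ∀ x, x ≠ q → N x ≠ 0 := by
    intro x hx h0
    apply hx
    funext j
    have := (Finset.sum_eq_zero_iff_of_nonneg (fun j _ => sq_nonneg (x j - q j))).1 h0 j
      (Finset.mem_univ j)
    exact sub_eq_zero.1 (pow_eq_zero_iff two_ne_zero |>.1 this)
  have hq1 : χ q = 1 := χ.one_of_mem_closedBall (Metric.mem_closedBall_self χ.rIn_pos.le)
  refine ⟨fun i x => H x (Pi.single i 1) + (1 - χ x) * g x * (x i - q i) / N x, fun i => ?_,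
    fun x hx => ?_⟩
  · refine (hH.clm_apply contDiff_const).contDiffOn.add ?_
    intro x hx
    refine ContDiffAt.contDiffWithinAt ?_
    -- At the centre the quotient is formally 0/0, but `1 - χ` vanishes on a whole neighbourhood, so
    -- the function is locally constant there.
    by_cases hxq : x = q
    · subst hxq
      have : ∀ᶠ z in nhds x, (1 - χ z) * g z * (z i - x i) / N z = 0 := by
        filter_upwards [Metric.closedBall_mem_nhds x χ.rIn_pos] with z hz
        rw [χ.one_of_mem_closedBall hz]; simp
      exact (contDiffAt_const (c := (0 : ℝ))).congr_of_eventuallyEq this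
    · refine ContDiffAt.div (((contDiffAt_const.sub hχ.contDiffAt).mul
        (hg.contDiffAt (hW.mem_nhds hx))).mul ?_) ?_ (hN x hxq)
      · exact ContDiff.contDiffAt (by fun_prop)
      · exact ContDiff.contDiffAt (by fun_prop)
  · have e1 := hgH x
    rw [hq1, one_mul] at e1
    have e2 : H x (x - q) = ∑ i, (x i - q i) * H x (Pi.single i 1) := by
      conv_lhs => rw [pi_eq_sum_univ' (x - q), map_sum]
      simp
    have e3 : ∑ i, (x i - q i) * ((1 - χ x) * g x * (x i - q i) / N x) = (1 - χ x) * g x := by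
      by_cases hxq : x = q
      · subst hxq; simp [hq1]
      · have : ∑ i, (x i - q i) * ((1 - χ x) * g x * (x i - q i) / N x) =
            (1 - χ x) * g x / N x * N x := by
          rw [Finset.mul_sum]
          exact Finset.sum_congr rfl fun i _ => by ring
        rw [this, div_mul_cancel₀ _ (hN x hxq)]
    simp only [mul_add, Finset.sum_add_distrib, e3]
    rw [← e2, ← add_assoc, ← e1]
    ring

end Hadamard

/-! ### Values at points and point derivations -/

namespace SuperDomain

variable {ι : Type u} {M : SuperDomain ι}

/-- The values of smooth functions at a point. -/
def evalSmooth (M : SuperDomain ι) (p : M.dom) : M.SmoothFn →ₐ[ℝ] ℝ :=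
  (Pi.evalAlgHom ℝ (fun _ : M.dom => ℝ) p).comp M.SmoothFn.val

/-- The values of superfunctions at a point. -/
noncomputable def evalAt (M : SuperDomain ι) (p : M.dom) :
    M.LocalFn →ₐ[ℝ] ExteriorAlgebra ℝ (M.Odd →₀ ℝ) :=
  (Algebra.TensorProduct.lid ℝ _).toAlgHom.comp
    (Algebra.TensorProduct.map (M.evalSmooth p) (AlgHom.id ℝ _))

theorem evalAt_tmul (p : M.dom) (f : M.SmoothFn) (a : ExteriorAlgebra ℝ (M.Odd →₀ ℝ)) :
    M.evalAt p (f ⊗ₜ a) = f.1 p • a := rfl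

theorem evalAt_ofSmooth (p : M.dom) (f : M.SmoothFn) :
    M.evalAt p (M.ofSmooth f) = algebraMap ℝ _ (f.1 p) := by
  rw [ofSmooth, evalAt_tmul, Algebra.algebraMap_eq_smul_one]

/-- In a real basis of the exterior algebra a superfunction has coefficients that are honest real
functions, and these vanish if all their values do. -/
theorem eq_zero_of_evalAt {f : M.LocalFn} (h : ∀ p, M.evalAt p f = 0) : f = 0 := by
  let b := Module.Basis.ofVectorSpace ℝ (ExteriorAlgebra ℝ (M.Odd →₀ ℝ))
  let B := Algebra.TensorProduct.basis M.SmoothFn b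
  have key : ∀ (f : M.LocalFn) (p : M.dom) i, (B.repr f i).1 p = b.repr (M.evalAt p f) i := by
    intro f p i
    induction f using TensorProduct.induction_on with
    | zero => simp
    | add x y hx hy => simp only [map_add, Finsupp.add_apply, ← hx, ← hy]; rfl
    | tmul g a =>
      rw [evalAt_tmul, map_smul, Finsupp.smul_apply, smul_eq_mul,
        Algebra.TensorProduct.basis_repr_tmul]
      simp only [Finsupp.smul_apply, Finsupp.mapRange_apply, smul_eq_mul]
      rfl
  apply B.repr.injective
  rw [map_zero]
  ext i p
  rw [key, h, map_zero]
  rfl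

/-- A derivation of smooth functions at the point `q` that kills the coordinates is zero. -/
theorem pointDerivation_eq_zero {A : Type v} [AddCommGroup A] [Module ℝ A] (q : M.dom)
    (d : M.SmoothFn → A) (hadd : ∀ f g, d (f + g) = d f + d g)
    (hmul : ∀ f g, d (f * g) = g.1 q • d f + f.1 q • d g)
    (hcoord : ∀ e, d (M.proj e) = 0) (hconst : ∀ r : ℝ, d (algebraMap ℝ _ r) = 0)
    (f : M.SmoothFn) : d f = 0 := by
  classical
  obtain ⟨s, g, hg, hf⟩ := f.2
  obtain ⟨G, hG, hgG⟩ := hadamard (M.isOpen_restrict s) hg (q := s.restrict q.1) ⟨q.1, q.2, rfl⟩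
  let Gs : s → M.SmoothFn := fun i =>
    ⟨fun p => G i (s.restrict p.1), s, G i, hG i, fun _ => rfl⟩
  -- Hadamard's decomposition about `q`. In each product the first factor vanishes at `q` and is
  -- killed by `d`, so the Leibniz rule annihilates the product.
  have e : f = algebraMap ℝ _ (f.1 q) +
      ∑ i : s, (M.proj i.1 + algebraMap ℝ _ (-q.1 i.1)) * Gs i := by
    ext p
    have h1 := hgG (s.restrict p.1) ⟨p.1, p.2, rfl⟩
    rw [← hf, ← hf] at h1
    rw [h1]
    simp only [Subalgebra.coe_add, Subalgebra.coe_mul, Pi.add_apply,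
      AddSubmonoidClass.coe_finsetSum, Finset.sum_apply, Pi.mul_apply]
    rfl
  let d' : M.SmoothFn →+ A := AddMonoidHom.mk' d hadd
  have hd' : ∀ f, d f = d' f := fun _ => rfl
  rw [e, hadd, hconst, zero_add, hd', map_sum]
  refine Finset.sum_eq_zero fun i _ => ?_
  rw [← hd', hmul, hadd, hcoord, hconst, add_zero, smul_zero, zero_add]
  have : (M.proj i.1 + algebraMap ℝ M.SmoothFn (-q.1 i.1)).1 q = 0 := by
    change q.1 i.1 + -q.1 i.1 = 0
    simp
  rw [this, zero_smul]

end SuperDomain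

open SuperDomain

variable {ι : Type u} {κ : Type v} {ν : Type w} {M : SuperDomain ι} {N : SuperDomain κ}
  {K : SuperDomain ν}

/-! ### Geometric homomorphisms -/

/-- Homomorphisms of superfunctions that preserve the parity and act on the smooth functions of the
even coordinates by composition with a map of the domains. -/
def IsGeo (Φ : N.LocalFn →ₐ[ℝ] M.LocalFn) : Prop :=
  (∃ φ : M.dom → N.dom, ∀ f : N.SmoothFn, ∃ g : M.SmoothFn,
    Φ (N.ofSmooth f) = M.ofSmooth g ∧ ∀ p, g.1 p = f.1 (φ p)) ∧
  ∀ f, Φ (N.pInv f) = M.pInv (Φ f)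

theorem isGeo_id : IsGeo (AlgHom.id ℝ M.LocalFn) :=
  ⟨⟨id, fun f => ⟨f, rfl, fun _ => rfl⟩⟩, fun _ => rfl⟩

theorem IsGeo.comp {Ψ : N.LocalFn →ₐ[ℝ] M.LocalFn} {Φ : K.LocalFn →ₐ[ℝ] N.LocalFn}
    (hΨ : IsGeo Ψ) (hΦ : IsGeo Φ) : IsGeo (Ψ.comp Φ) := by
  obtain ⟨⟨ψ, h1⟩, h2⟩ := hΨ
  obtain ⟨⟨φ, h3⟩, h4⟩ := hΦ
  refine ⟨⟨φ ∘ ψ, fun f => ?_⟩, fun f => by simp [h2, h4]⟩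
  obtain ⟨g, hg, hg'⟩ := h3 f
  obtain ⟨k, hk, hk'⟩ := h1 g
  exact ⟨k, by simp [hg, hk], fun p => by rw [hk', hg']; rfl⟩

theorem IsGeo.twist {Φ : N.LocalFn →ₐ[ℝ] M.LocalFn} (hΦ : IsGeo Φ) (p : ZMod 2) (f : N.LocalFn) :
    Φ (N.twist p f) = M.twist p (Φ f) := by
  rcases zmod_cases p with rfl | rfl
  · simp [twist_zero]
  · simp [twist_one, hΦ.2]

theorem IsGeo.hasParity {Φ : N.LocalFn →ₐ[ℝ] M.LocalFn} (hΦ : IsGeo Φ) {f : N.LocalFn}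
    {q : ZMod 2} (hf : N.HasParity f q) : M.HasParity (Φ f) q := by
  rw [hasParity_iff] at *
  rw [← hΦ.2, hf, map_smul]

/-- The coordinates do not generate the smooth functions algebraically. The even coordinates do
determine the underlying map of domains, as evaluation at points shows, and that map determines the
homomorphism on all smooth functions; the odd coordinates supply the rest. -/
theorem IsGeo.ext {Φ Φ' : N.LocalFn →ₐ[ℝ] M.LocalFn} (h : IsGeo Φ) (h' : IsGeo Φ')
    (hc : ∀ i, Φ (N.coord i) = Φ' (N.coord i)) : Φ = Φ' := by
  obtain ⟨⟨φ, h1⟩, -⟩ := h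
  obtain ⟨⟨φ', h2⟩, -⟩ := h'
  have hφ : φ = φ' := by
    funext p
    ext e
    have := congrArg (M.evalAt p) (hc e.1)
    rw [coord_even e.2] at this
    obtain ⟨g, hg, hg'⟩ := h1 (N.proj e)
    obtain ⟨k, hk, hk'⟩ := h2 (N.proj e)
    erw [hg, hk] at this
    rw [evalAt_ofSmooth, evalAt_ofSmooth, ExteriorAlgebra.algebraMap_inj, hg', hk'] at this
    exact this
  subst hφ
  refine AlgHom.ext fun f => ?_
  induction f using localFn_induction with
  | hs f =>
    obtain ⟨g, hg, hg'⟩ := h1 f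
    obtain ⟨k, hk, hk'⟩ := h2 f
    rw [hg, hk]
    congr 1
    ext p
    rw [hg', hk']
  | ho o =>
    have := hc o.1
    rwa [coord_odd o.2] at this
  | hadd f g hf hg => rw [map_add, map_add, hf, hg]
  | hmul f g hf hg => rw [map_mul, map_mul, hf, hg]

/-- Compatibility with the involution is automatic on smooth functions, so only the odd coordinates
have to be tested. -/
theorem isGeo_of_odd {Φ : N.LocalFn →ₐ[ℝ] M.LocalFn} (φ : M.dom → N.dom)
    (h : ∀ f : N.SmoothFn, ∃ g : M.SmoothFn,
      Φ (N.ofSmooth f) = M.ofSmooth g ∧ ∀ p, g.1 p = f.1 (φ p))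
    (ho : ∀ o, M.HasParity (Φ (N.oddCoord o)) 1) : IsGeo Φ := by
  refine ⟨⟨φ, h⟩, fun f => ?_⟩
  induction f using localFn_induction with
  | hs f =>
    obtain ⟨g, hg, -⟩ := h f
    have h1 := (hasParity_iff _ _).1 (hasParity_ofSmooth f)
    have h2 := (hasParity_iff _ _).1 (hasParity_ofSmooth g)
    rw [h1, map_smul, hg, h2]
  | ho o =>
    have h1 := (hasParity_iff _ _).1 (ho o)
    have h2 : N.pInv (N.oddCoord o) = sgn 1 • N.oddCoord o :=
      (hasParity_iff _ _).1 (hasParity_tmul_ι _ _)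
    rw [h1, h2, map_smul]
  | hadd f g hf hg => rw [map_add, map_add, map_add, map_add, hf, hg]
  | hmul f g hf hg => rw [map_mul, map_mul, map_mul, map_mul, hf, hg]

namespace Morphism

theorem pullback_ofSmooth (φ : Morphism M N) (f : N.SmoothFn) :
    φ.pullback (N.ofSmooth f) = M.ofSmooth (φ.smoothPullback f) := by
  rw [ofSmooth, pullback, Algebra.TensorProduct.map_tmul, map_one]; rfl

theorem pullback_oddCoord (φ : Morphism M N) (o : N.Odd) :
    φ.pullback (N.oddCoord o) = 1 ⊗ₜ ExteriorAlgebra.ι ℝ (φ.odd o) := by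
  rw [oddCoord, pullback, Algebra.TensorProduct.map_tmul, map_one, ExteriorAlgebra.map_apply_ι,
    Finsupp.linearCombination_single, one_smul]

theorem pullback_coord_even (φ : Morphism M N) {i : κ} (h : N.parity i = 0) :
    φ.pullback (N.coord i) = M.ofSmooth (φ.even ⟨i, h⟩) := by
  rw [coord_even h, pullback_ofSmooth]; rfl

theorem pullback_coord_odd (φ : Morphism M N) {i : κ} (h : N.parity i ≠ 0) :
    φ.pullback (N.coord i) = 1 ⊗ₜ ExteriorAlgebra.ι ℝ (φ.odd ⟨i, h⟩) := by
  rw [coord_odd h, pullback_oddCoord]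

theorem isGeo_pullback (φ : Morphism M N) : IsGeo φ.pullback :=
  isGeo_of_odd (fun p => ⟨fun e => (φ.even e).1 p, φ.even_mem p⟩)
    (fun f => ⟨φ.smoothPullback f, φ.pullback_ofSmooth f, fun _ => rfl⟩)
    (fun o => by rw [pullback_oddCoord]; exact hasParity_tmul_ι _ _)

theorem rename_coord {j : κ → ι} {hj : ∀ k, M.parity (j k) = N.parity k}
    {hdom : ∀ p ∈ M.dom, (fun e : N.Even => p ⟨j e.1, (hj e.1).trans e.2⟩) ∈ N.dom} (k : κ) :
    (rename j hj hdom).pullback (N.coord k) = M.coord (j k) := by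
  by_cases h : N.parity k = 0
  · rw [pullback_coord_even _ h, coord_even ((hj k).trans h)]; rfl
  · rw [pullback_coord_odd _ h, coord_odd (fun h' => h ((hj k).symm.trans h'))]; rfl

end Morphism

/-- The part of a superfunction without odd coordinates. -/
noncomputable def body (M : SuperDomain ι) : M.LocalFn →ₐ[ℝ] M.SmoothFn :=
  Algebra.TensorProduct.lift (AlgHom.id ℝ _)
    ((Algebra.ofId ℝ M.SmoothFn).comp ExteriorAlgebra.algebraMapInv) fun _ _ => Commute.all _ _

theorem body_ofSmooth (f : M.SmoothFn) : body M (M.ofSmooth f) = f := by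
  simp [body, ofSmooth]

theorem body_coord_odd {i : ι} (h : M.parity i ≠ 0) : body M (M.coord i) = 0 := by
  rw [coord_odd h, oddCoord, body]
  simp [ExteriorAlgebra.algebraMapInv]

/-- Superfunctions of odd parity can be substituted for the odd coordinates, and smooth functions
for the even ones. -/
theorem exists_hom (val : κ → M.LocalFn)
    (hev : ∀ i, N.parity i = 0 → M.ofSmooth (body M (val i)) = val i)
    (hodd : ∀ i, N.parity i ≠ 0 → M.HasParity (val i) 1)
    (hdom : ∀ p : M.dom, (fun e : N.Even => (body M (val e.1)).1 p) ∈ N.dom) :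
    ∃ Φ : N.LocalFn →ₐ[ℝ] M.LocalFn, IsGeo Φ ∧ ∀ i, Φ (N.coord i) = val i := by
  -- Only the underlying map of domains is used, so the odd part is set to 0. The odd coordinates
  -- are treated by the universal property of the exterior algebra, since a `Morphism` would allow
  -- only constant linear combinations for them.
  let φ : Morphism M N := ⟨fun e => body M (val e.1), hdom, 0⟩
  let l : (N.Odd →₀ ℝ) →ₗ[ℝ] M.LocalFn := Finsupp.linearCombination ℝ fun o => val o.1
  have hl : ∀ x, M.HasParity (l x) 1 := by
    intro x
    simp only [l, Finsupp.linearCombination_apply, Finsupp.sum]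
    exact HasParity.sum fun i _ => (hodd _ i.2).smul _
  let Φ : N.LocalFn →ₐ[ℝ] M.LocalFn := Algebra.TensorProduct.lift
    (M.ofSmoothHom.comp φ.smoothPullback)
    (ExteriorAlgebra.lift ℝ ⟨l, fun x => (hl x).sq_zero⟩)
    (fun f _ => (hasParity_ofSmooth (φ.smoothPullback f)).comm _)
  have h1 : ∀ f, Φ (N.ofSmooth f) = M.ofSmooth (φ.smoothPullback f) := by
    intro f
    rw [ofSmooth]
    erw [Algebra.TensorProduct.lift_tmul]
    rw [map_one, mul_one]
    rfl
  have h2 : ∀ o, Φ (N.oddCoord o) = val o.1 := by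
    intro o
    rw [oddCoord]
    erw [Algebra.TensorProduct.lift_tmul]
    rw [map_one, one_mul, ExteriorAlgebra.lift_ι_apply]
    simp [l]
  refine ⟨Φ, isGeo_of_odd (fun p => ⟨fun e => (φ.even e).1 p, φ.even_mem p⟩)
    (fun f => ⟨_, h1 f, fun _ => rfl⟩) (fun o => by rw [h2]; exact hodd _ o.2), fun i => ?_⟩
  by_cases h : N.parity i = 0
  · rw [coord_even h, h1, ← hev i h]; rfl
  · rw [coord_odd h, h2]

/-! ### Graded derivations -/

/-- `X` is a derivation of Grassmann parity `p` along the homomorphism `Φ`. -/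
structure IsDer (Φ : N.LocalFn →ₐ[ℝ] M.LocalFn) (p : ZMod 2) (X : N.LocalFn → M.LocalFn) :
    Prop where
  geo : IsGeo Φ
  add : ∀ f g, X (f + g) = X f + X g
  smul : ∀ (r : ℝ) f, X (r • f) = r • X f
  leibniz : ∀ f g, X (f * g) = X f * Φ g + Φ (N.twist p f) * X g
  pInv : ∀ f, X (N.pInv f) = sgn p • M.pInv (X f)

namespace IsDer

variable {Φ : N.LocalFn →ₐ[ℝ] M.LocalFn} {p q : ZMod 2} {X Y : N.LocalFn → M.LocalFn}

theorem zero (hX : IsDer Φ p X) : X 0 = 0 := by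
  have := hX.smul 0 0
  rwa [zero_smul, zero_smul] at this

theorem neg (hX : IsDer Φ p X) (f : N.LocalFn) : X (-f) = -X f := by
  rw [← neg_one_smul ℝ f, hX.smul, neg_one_smul]

theorem sub (hX : IsDer Φ p X) (f g : N.LocalFn) : X (f - g) = X f - X g := by
  rw [sub_eq_add_neg, hX.add, hX.neg, sub_eq_add_neg]

theorem sum (hX : IsDer Φ p X) {α : Type x} (s : Finset α) (f : α → N.LocalFn) :
    X (∑ i ∈ s, f i) = ∑ i ∈ s, X (f i) :=
  map_sum (AddMonoidHom.mk' X hX.add) f s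

theorem one (hX : IsDer Φ p X) : X 1 = 0 := by
  have := hX.leibniz 1 1
  rw [map_one, map_one, map_one, mul_one, one_mul] at this
  simpa using this

theorem twist (hX : IsDer Φ p X) (q : ZMod 2) (f : N.LocalFn) :
    X (N.twist q f) = sgn (p * q) • M.twist q (X f) := by
  rcases zmod_cases q with rfl | rfl
  · simp [twist_zero, sgn_zero]
  · rw [twist_one, twist_one, mul_one, hX.pInv]

theorem hasParity (hX : IsDer Φ p X) {f : N.LocalFn} (hf : N.HasParity f q) :
    M.HasParity (X f) (p + q) := by
  have h := hX.pInv f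
  rw [(hasParity_iff _ _).1 hf, hX.smul] at h
  rw [hasParity_iff, sgn_add, mul_smul, h, smul_smul, sgn_mul_self, one_smul]

theorem congr_hom (hX : IsDer Φ p X) {Φ' : N.LocalFn →ₐ[ℝ] M.LocalFn} (h : Φ = Φ') :
    IsDer Φ' p X := h ▸ hX

theorem even_leibniz (hX : IsDer Φ 0 X) (f g : N.LocalFn) :
    X (f * g) = X f * Φ g + Φ f * X g := by
  rw [hX.leibniz, twist_zero]; rfl

/-- Multiplication by an even function that is annihilated by `X`. -/
theorem mul_even (hX : IsDer Φ p X) {f : N.LocalFn} (hf : N.HasParity f 0) (h0 : X f = 0)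
    (g : N.LocalFn) : X (f * g) = Φ f * X g := by
  rw [hX.leibniz, h0, zero_mul, zero_add, twist_of_hasParity hf, mul_zero, sgn_zero, one_smul]

/-- Rigidity of derivations. Restricted to smooth functions and followed by evaluation at a point,
`X` is a point derivation killing the coordinates, hence zero by Hadamard's lemma. Odd coordinates,
sums and products follow from the hypotheses and the Leibniz rule. -/
theorem eq_zero (hX : IsDer Φ p X) (hc : ∀ i, X (N.coord i) = 0) (f : N.LocalFn) : X f = 0 := by
  obtain ⟨⟨φ, hφ⟩, -⟩ := id hX.geo
  induction f using localFn_induction with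
  | hs f =>
    apply eq_zero_of_evalAt
    intro m
    have hev : ∀ f, M.evalAt m (Φ (N.ofSmooth f)) = algebraMap ℝ _ (f.1 (φ m)) := by
      intro f
      obtain ⟨g, hg, hg'⟩ := hφ f
      rw [hg, evalAt_ofSmooth, hg']
    refine pointDerivation_eq_zero (φ m) (fun f => M.evalAt m (X (N.ofSmooth f)))
      (fun f g => ?_) (fun f g => ?_) (fun e => ?_) (fun r => ?_) f
    · rw [← ofSmoothHom_apply, map_add, hX.add, map_add]; rfl
    · rw [← ofSmoothHom_apply, map_mul, hX.leibniz, map_add, map_mul, map_mul,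
        ofSmoothHom_apply, ofSmoothHom_apply, twist_of_hasParity (hasParity_ofSmooth f), mul_zero,
        sgn_zero, one_smul, hev, hev, ← Algebra.commutes, ← Algebra.smul_def, ← Algebra.smul_def]
    · have := hc e.1
      rw [coord_even e.2] at this
      rw [show N.ofSmooth (N.proj e) = N.ofSmooth (N.proj ⟨e.1, e.2⟩) from rfl, this, map_zero]
    · rw [← ofSmoothHom_apply, AlgHom.commutes, Algebra.algebraMap_eq_smul_one, hX.smul, hX.one,
        smul_zero, map_zero]
  | ho o =>
    have := hc o.1
    rwa [coord_odd o.2] at this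
  | hadd f g hf hg => rw [hX.add, hf, hg, add_zero]
  | hmul f g hf hg => rw [hX.leibniz, hf, hg, zero_mul, mul_zero, add_zero]

theorem fun_sub (hX : IsDer Φ p X) (hY : IsDer Φ p Y) : IsDer Φ p fun f => X f - Y f where
  geo := hX.geo
  add f g := by rw [hX.add, hY.add, add_sub_add_comm]
  smul r f := by rw [hX.smul, hY.smul, smul_sub]
  leibniz f g := by rw [hX.leibniz, hY.leibniz, sub_mul, mul_sub, add_sub_add_comm]
  pInv f := by rw [hX.pInv, hY.pInv, map_sub, smul_sub]

theorem fun_add (hX : IsDer Φ p X) (hY : IsDer Φ p Y) : IsDer Φ p fun f => X f + Y f where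
  geo := hX.geo
  add f g := by rw [hX.add, hY.add, add_add_add_comm]
  smul r f := by rw [hX.smul, hY.smul, smul_add]
  leibniz f g := by rw [hX.leibniz, hY.leibniz, add_mul, mul_add, add_add_add_comm]
  pInv f := by rw [hX.pInv, hY.pInv, map_add, smul_add]

theorem fun_zero (h : IsGeo Φ) (p : ZMod 2) : IsDer Φ p fun _ => 0 where
  geo := h
  add f g := by rw [add_zero]
  smul r f := by rw [smul_zero]
  leibniz f g := by rw [zero_mul, mul_zero, add_zero]
  pInv f := by rw [map_zero, smul_zero]

theorem fun_mul (hX : IsDer Φ p X) {c : M.LocalFn} (hc : M.HasParity c 0) :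
    IsDer Φ p fun f => c * X f where
  geo := hX.geo
  add f g := by rw [hX.add, mul_add]
  smul r f := by rw [hX.smul, mul_smul_comm]
  leibniz f g := by
    rw [hX.leibniz, mul_add, ← mul_assoc c (X f), ← mul_assoc c (Φ _), hc.comm (Φ _),
      mul_assoc (Φ _)]
  pInv f := by
    rw [hX.pInv, map_mul, (hasParity_iff _ _).1 hc, sgn_zero, one_smul, mul_smul_comm]

theorem fun_sum {α : Type x} (s : Finset α) {Z : α → N.LocalFn → M.LocalFn} (hΦ : IsGeo Φ)
    (hZ : ∀ a ∈ s, IsDer Φ p (Z a)) : IsDer Φ p fun f => ∑ a ∈ s, Z a f := by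
  classical
  induction s using Finset.induction_on with
  | empty => simpa using fun_zero hΦ p
  | insert a s ha ih =>
    simp only [Finset.sum_insert ha]
    exact (hZ a (Finset.mem_insert_self _ _)).fun_add
      (ih fun b hb => hZ b (Finset.mem_insert_of_mem hb))

theorem comp_left {Ψ : M.LocalFn →ₐ[ℝ] K.LocalFn} (hΨ : IsGeo Ψ) (hX : IsDer Φ p X) :
    IsDer (Ψ.comp Φ) p fun f => Ψ (X f) where
  geo := hΨ.comp hX.geo
  add f g := by rw [hX.add, map_add]
  smul r f := by rw [hX.smul, map_smul]
  leibniz f g := by rw [hX.leibniz, map_add, map_mul, map_mul]; rfl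
  pInv f := by rw [hX.pInv, map_smul, hΨ.2]

theorem comp_right (hX : IsDer Φ p X) {Ψ : K.LocalFn →ₐ[ℝ] N.LocalFn} (hΨ : IsGeo Ψ) :
    IsDer (Φ.comp Ψ) p fun f => X (Ψ f) where
  geo := hX.geo.comp hΨ
  add f g := by rw [map_add, hX.add]
  smul r f := by rw [map_smul, hX.smul]
  leibniz f g := by rw [map_mul, hX.leibniz, ← hΨ.twist]; rfl
  pInv f := by rw [hΨ.2, hX.pInv]

/-- Derivations are determined by their values on the coordinates. -/
theorem ext (hX : IsDer Φ p X) (hY : IsDer Φ p Y)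
    (hc : ∀ i, X (N.coord i) = Y (N.coord i)) (f : N.LocalFn) : X f = Y f :=
  sub_eq_zero.1 ((hX.fun_sub hY).eq_zero (fun i => sub_eq_zero.2 (hc i)) f)

/-- The graded commutator of a derivation along `Φ` with derivations related by `Φ`. -/
theorem comm (hX : IsDer Φ p X) {Y : N.LocalFn → N.LocalFn} {Z : M.LocalFn → M.LocalFn}
    (hY : IsDer (AlgHom.id ℝ _) q Y) (hZ : IsDer (AlgHom.id ℝ _) q Z)
    (h : ∀ f, Φ (Y f) = Z (Φ f)) :
    IsDer Φ (p + q) fun f => X (Y f) - sgn (p * q) • Z (X f) where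
  geo := hX.geo
  add f g := by
    rw [hX.add, hY.add, hX.add, hZ.add, smul_add, add_sub_add_comm]
  smul r f := by rw [hX.smul, hY.smul, hX.smul, hZ.smul, smul_sub, smul_comm r]
  leibniz f g := by
    have e1 : Φ (N.twist p (Y f)) = sgn (p * q) • Z (Φ (N.twist p f)) := by
      rw [← h, hY.twist, map_smul, smul_smul, mul_comm q p, sgn_mul_self, one_smul]
    have e2 := hX.twist q f
    rw [hY.leibniz, hX.add, hX.leibniz, hX.leibniz, hX.leibniz, hZ.add, hZ.leibniz, hZ.leibniz,
      e1, twist_add]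
    simp only [AlgHom.id_apply, e2, h, ← hX.geo.twist, smul_add, smul_mul_assoc, mul_sub, sub_mul,
      mul_smul_comm]
    rw [← twist_add, ← twist_add, add_comm q p]
    abel
  pInv f := by
    rw [hY.pInv, hX.smul, hX.pInv, hX.pInv, hZ.smul, hZ.pInv, map_sub, map_smul, sgn_add,
      smul_sub]
    simp only [smul_smul]
    congr 2 <;> ring

/-- The commutator with an even derivation. -/
theorem comm_even (hX : IsDer Φ p X) {Y : N.LocalFn → N.LocalFn} {Z : M.LocalFn → M.LocalFn}
    (hY : IsDer (AlgHom.id ℝ _) 0 Y) (hZ : IsDer (AlgHom.id ℝ _) 0 Z)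
    (h : ∀ f, Φ (Y f) = Z (Φ f)) : IsDer Φ p fun f => X (Y f) - Z (X f) := by
  simpa [sgn_zero] using hX.comm hY hZ h

/-- The anticommutator of odd derivations. -/
theorem comm_odd (hX : IsDer Φ 1 X) {Y : N.LocalFn → N.LocalFn} {Z : M.LocalFn → M.LocalFn}
    (hY : IsDer (AlgHom.id ℝ _) 1 Y) (hZ : IsDer (AlgHom.id ℝ _) 1 Z)
    (h : ∀ f, Φ (Y f) = Z (Φ f)) : IsDer Φ 0 fun f => X (Y f) + Z (X f) := by
  have := hX.comm hY hZ h
  simpa only [mul_one, sgn_one, neg_one_smul, sub_neg_eq_add,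
    show (1 : ZMod 2) + 1 = 0 from rfl] using this

end IsDer

/-- The partial derivative twists `f` by the parity of the coordinate, and moving the coefficient
past `f` twists by that parity plus `p`. The coordinate parity occurs twice and drops out modulo 2,
leaving the twist by `p`. -/
theorem isDer_vectorField {c : ι → M.LocalFn} {p : ZMod 2}
    (hc : ∀ i, M.HasParity (c i) (M.parity i + p)) :
    IsDer (AlgHom.id ℝ _) p (M.vectorField c) where
  geo := isGeo_id
  add f g := by
    classical
    obtain ⟨s, hs⟩ := exists_finset_pd f
    obtain ⟨t, ht⟩ := exists_finset_pd g
    have h1 : ∀ i ∉ s ∪ t, M.pd i f = 0 := fun i hi => hs i fun h => hi (Finset.mem_union_left _ h)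
    have h2 : ∀ i ∉ s ∪ t, M.pd i g = 0 := fun i hi => ht i fun h => hi (Finset.mem_union_right _ h)
    rw [vectorField_eq_sum c h1, vectorField_eq_sum c h2, vectorField_eq_sum c (s := s ∪ t),
      ← Finset.sum_add_distrib]
    · exact Finset.sum_congr rfl fun i _ => by rw [map_add, mul_add]
    · intro i hi; rw [map_add, h1 i hi, h2 i hi, add_zero]
  smul r f := by
    obtain ⟨s, hs⟩ := exists_finset_pd f
    rw [vectorField_eq_sum c hs, vectorField_eq_sum c (s := s), Finset.smul_sum]
    · exact Finset.sum_congr rfl fun i _ => by rw [map_smul, mul_smul_comm]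
    · intro i hi; rw [map_smul, hs i hi, smul_zero]
  leibniz f g := by
    classical
    obtain ⟨s, hs⟩ := exists_finset_pd f
    obtain ⟨t, ht⟩ := exists_finset_pd g
    have h1 : ∀ i ∉ s ∪ t, M.pd i f = 0 := fun i hi => hs i fun h => hi (Finset.mem_union_left _ h)
    have h2 : ∀ i ∉ s ∪ t, M.pd i g = 0 := fun i hi => ht i fun h => hi (Finset.mem_union_right _ h)
    rw [vectorField_eq_sum c h1, vectorField_eq_sum c h2, vectorField_eq_sum c (s := s ∪ t),
      Finset.sum_mul, Finset.mul_sum, ← Finset.sum_add_distrib]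
    · refine Finset.sum_congr rfl fun i _ => ?_
      rw [pd_mul, mul_add, ← mul_assoc, ← mul_assoc, (hc i).mul_comm (M.twist _ f), ← twist_add,
        AlgHom.id_apply, AlgHom.id_apply, ← mul_assoc]
      congr 4
      rw [add_right_comm, CharTwo.add_self_eq_zero, zero_add]
    · intro i hi; rw [pd_mul, h1 i hi, h2 i hi, zero_mul, mul_zero, add_zero]
  pInv f := by
    obtain ⟨s, hs⟩ := exists_finset_pd f
    rw [vectorField_eq_sum c hs, vectorField_eq_sum c (s := s), map_sum, Finset.smul_sum]
    · refine Finset.sum_congr rfl fun i _ => ?_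
      rw [pd_pInv, map_mul, (hasParity_iff _ _).1 (hc i), sgn_add, smul_mul_assoc, mul_smul_comm,
        smul_smul, mul_left_comm, sgn_mul_self, mul_one]
    · intro i hi; rw [pd_pInv, hs i hi, map_zero, smul_zero]

open Classical in
/-- A vector field with constant coefficients. -/
theorem vectorField_single (i : ι) (f : M.LocalFn) :
    M.vectorField (fun j => if j = i then 1 else 0) f = M.pd i f := by
  obtain ⟨s, hs⟩ := exists_finset_pd f
  rw [vectorField_eq_sum _ (s := insert i s) (fun j hj => hs j fun h => hj (by simp [h])),
    Finset.sum_eq_single i]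
  · simp
  · intro j _ hj; simp [hj]
  · intro h; simp at h

/-! ### Derivations and intertwining homomorphisms -/

section Der

variable {ι : Type u} {κ : Type v} {M : SuperDomain ι} {N : SuperDomain κ}

theorem IsDer.left {p : ZMod 2} {X : N.LocalFn → N.LocalFn} (hX : IsDer (AlgHom.id ℝ _) p X)
    {Ψ : N.LocalFn →ₐ[ℝ] M.LocalFn} (hΨ : IsGeo Ψ) : IsDer Ψ p fun f => Ψ (X f) :=
  (hX.comp_left hΨ).congr_hom (AlgHom.comp_id Ψ)

theorem IsDer.right {p : ZMod 2} {X : M.LocalFn → M.LocalFn} (hX : IsDer (AlgHom.id ℝ _) p X)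
    {Ψ : N.LocalFn →ₐ[ℝ] M.LocalFn} (hΨ : IsGeo Ψ) : IsDer Ψ p fun f => X (Ψ f) :=
  (hX.comp_right hΨ).congr_hom (AlgHom.id_comp Ψ)

/-- Both composites are derivations along `Ψ`, so comparing them on the coordinates suffices. The
next two lemmas apply the same principle to the commutator and the anticommutator, which are again
derivations. -/
theorem IsDer.intertwine {p : ZMod 2} {X : N.LocalFn → N.LocalFn} {Y : M.LocalFn → M.LocalFn}
    (hX : IsDer (AlgHom.id ℝ _) p X) (hY : IsDer (AlgHom.id ℝ _) p Y)
    {Ψ : N.LocalFn →ₐ[ℝ] M.LocalFn} (hΨ : IsGeo Ψ)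
    (h : ∀ i, Ψ (X (N.coord i)) = Y (Ψ (N.coord i))) (f : N.LocalFn) : Ψ (X f) = Y (Ψ f) :=
  (hX.left hΨ).ext (hY.right hΨ) h f

theorem IsDer.commute {p : ZMod 2} {X Y : M.LocalFn → M.LocalFn} (hX : IsDer (AlgHom.id ℝ _) p X)
    (hY : IsDer (AlgHom.id ℝ _) 0 Y) (h : ∀ i, X (Y (M.coord i)) = Y (X (M.coord i)))
    (f : M.LocalFn) : X (Y f) = Y (X f) :=
  sub_eq_zero.1 ((hX.comm_even hY hY fun _ => rfl).eq_zero (fun i => sub_eq_zero.2 (h i)) f)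

theorem IsDer.anticommute {X Y : M.LocalFn → M.LocalFn} (hX : IsDer (AlgHom.id ℝ _) 1 X)
    (hY : IsDer (AlgHom.id ℝ _) 1 Y) (h : ∀ i, X (Y (M.coord i)) + Y (X (M.coord i)) = 0)
    (f : M.LocalFn) : X (Y f) = -Y (X f) :=
  eq_neg_of_add_eq_zero_left ((hX.comm_odd hY hY fun _ => rfl).eq_zero h f)

theorem isGeo_pInv : IsGeo M.pInv :=
  ⟨⟨id, fun f => ⟨f, by rw [(hasParity_iff _ _).1 (hasParity_ofSmooth f), sgn_zero, one_smul],
    fun _ => rfl⟩⟩, fun _ => rfl⟩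

/-- The partial derivative with respect to an even coordinate is a derivation. -/
theorem isDer_pd {i : ι} (hi : M.parity i = 0) : IsDer (AlgHom.id ℝ _) 0 (M.pd i) := by
  classical
  have : (M.pd i : M.LocalFn → M.LocalFn) = M.vectorField fun j => if j = i then 1 else 0 :=
    funext fun f => (vectorField_single i f).symm
  rw [this]
  refine isDer_vectorField fun j => ?_
  split_ifs with h
  · subst h; rw [hi]; exact hasParity_one
  · exact hasParity_zero _

end Der

/-! ### Iterated operators -/

section Iter

variable {n : ℕ} {A : Type u} {B : Type v}

theorem iter_zero (D : Fin n → A → A) (f : A) : iter D 0 f = f := by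
  simp [iter]

/-- Commuting operators may be applied in any order, so the sorting built into `iter` has no effect.
-/
theorem iter_cons {D : Fin n → A → A} (hD : ∀ a b f, D a (D b f) = D b (D a f)) (a : Fin n)
    (m : Multiset (Fin n)) (f : A) : iter D (a ::ₘ m) f = D a (iter D m f) := by
  have : LeftCommutative D := ⟨hD⟩
  have h : ((a ::ₘ m).sort (· ≤ ·)).Perm (a :: m.sort (· ≤ ·)) := by
    rw [← Multiset.coe_eq_coe, Multiset.sort_eq, ← Multiset.cons_coe, Multiset.sort_eq]
  exact h.foldr_eq f

theorem iter_map {D : Fin n → A → A} {D' : Fin n → B → B} {X : A → B} {P : A → Prop}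
    (hP : ∀ a f, P f → P (D a f))
    (h : ∀ a f, P f → X (D a f) = D' a (X f)) (m : Multiset (Fin n)) {f : A} (hf : P f) :
    X (iter D m f) = iter D' m (X f) := by
  have : ∀ l : List (Fin n), P (l.foldr D f) ∧ X (l.foldr D f) = l.foldr D' (X f) := by
    intro l
    induction l with
    | nil => exact ⟨hf, rfl⟩
    | cons a l ih => exact ⟨hP a _ ih.1, by rw [List.foldr_cons, h a _ ih.1, ih.2]; rfl⟩
  exact (this _).2

theorem iter_intertwine {D : Fin n → A → A} {D' : Fin n → B → B} {X : A → B}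
    (h : ∀ a f, X (D a f) = D' a (X f)) (m : Multiset (Fin n)) (f : A) :
    X (iter D m f) = iter D' m (X f) :=
  iter_map (P := fun _ => True) (fun _ _ _ => trivial) (fun a f _ => h a f) m trivial

theorem iter_induction {D : Fin n → A → A} {P : A → Prop} (hP : ∀ a f, P f → P (D a f))
    (m : Multiset (Fin n)) {f : A} (hf : P f) : P (iter D m f) := by
  have : ∀ l : List (Fin n), P (l.foldr D f) := by
    intro l
    induction l with
    | nil => exact hf
    | cons a l ih => exact hP a _ ih
  exact this _

theorem iterSkew_empty (D : Fin n → A → A) (f : A) : iterSkew D ∅ f = f := by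
  simp [iterSkew]

theorem iterSkew_insert_min (D : Fin n → A → A) {a : Fin n} {N : Finset (Fin n)}
    (h : ∀ b ∈ N, a < b) (f : A) : iterSkew D (insert a N) f = D a (iterSkew D N f) := by
  rw [iterSkew, Finset.sort_insert _ (fun b hb => (h b hb).le) fun ha => lt_irrefl _ (h a ha)]
  rfl

theorem iterSkew_induction {D : Fin n → A → A} {P : Finset (Fin n) → A → Prop} {f : A}
    (hf : P ∅ f) (hP : ∀ a N, (∀ b ∈ N, a < b) → P N (iterSkew D N f) →
      P (insert a N) (D a (iterSkew D N f))) (N : Finset (Fin n)) : P N (iterSkew D N f) := by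
  induction N using Finset.induction_on_min with
  | empty => rwa [iterSkew_empty]
  | insert a N ha ih => rw [iterSkew_insert_min D ha]; exact hP a N ha ih

/-- The predicate `P` admits intertwining relations that hold only on a subset stable under `D`; in
the application these are the functions of undifferentiated fields. -/
theorem iterSkew_map {D : Fin n → A → A} {D' : Fin n → B → B} {X : A → B} {P : A → Prop}
    (hP : ∀ a f, P f → P (D a f))
    (h : ∀ a f, P f → X (D a f) = D' a (X f)) (N : Finset (Fin n)) {f : A} (hf : P f) :
    X (iterSkew D N f) = iterSkew D' N (X f) := by
  refine (iterSkew_induction (D := D) (f := f)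
    (P := fun N g => P g ∧ X g = iterSkew D' N (X f)) ⟨hf, by rw [iterSkew_empty]⟩ ?_ N).2
  rintro a N ha ⟨h1, h2⟩
  exact ⟨hP a _ h1, by rw [h a _ h1, h2, iterSkew_insert_min D' ha]⟩

theorem iterSkew_intertwine {D : Fin n → A → A} {D' : Fin n → B → B} {X : A → B}
    (h : ∀ a f, X (D a f) = D' a (X f)) (N : Finset (Fin n)) (f : A) :
    X (iterSkew D N f) = iterSkew D' N (X f) :=
  iterSkew_map (P := fun _ => True) (fun _ _ _ => trivial) (fun a f _ => h a f) N trivial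

theorem insSign_mul_self (ν : Fin n) (N : Finset (Fin n)) : insSign ν N * insSign ν N = 1 := by
  rw [insSign, ← pow_add, ← two_mul, pow_mul]; simp

theorem insSign_insert {ν ρ : Fin n} {N : Finset (Fin n)} (h : ρ ∉ N) :
    insSign ν (insert ρ N) = (if ρ < ν then -1 else 1) * insSign ν N := by
  rw [insSign, Finset.filter_insert]
  split_ifs with hρ
  · rw [Finset.card_insert_of_notMem (fun h' => h (Finset.mem_of_mem_filter _ h')), pow_succ',
      insSign]
  · rw [one_mul, insSign]

theorem insSign_erase_self (ν : Fin n) (N : Finset (Fin n)) :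
    insSign ν (N.erase ν) = insSign ν N := by
  by_cases h : ν ∈ N
  · conv_rhs => rw [← Finset.insert_erase h]
    rw [insSign_insert (Finset.notMem_erase ν N), if_neg (lt_irrefl ν), one_mul]
  · rw [Finset.erase_eq_of_notMem h]

theorem insSign_min {ν : Fin n} {N : Finset (Fin n)} (h : ∀ b ∈ N, ν < b) : insSign ν N = 1 := by
  rw [insSign, Finset.filter_false_of_mem, Finset.card_empty, pow_zero]
  exact fun b hb => (h b hb).not_gt

/-- Exactly one of two distinct indices is the larger, and only its insertion passes the other one.
This is the sign behind the anticommutation of the `θ`-derivatives. -/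
theorem insSign_swap {ν ρ : Fin n} {N : Finset (Fin n)} (hν : ν ∉ N) (hρ : ρ ∉ N) (h : ν ≠ ρ) :
    insSign ρ N * insSign ν (insert ρ N) = -(insSign ν N * insSign ρ (insert ν N)) := by
  rw [insSign_insert hν, insSign_insert hρ]
  rcases lt_or_gt_of_ne h with h' | h'
  · rw [if_pos h', if_neg h'.not_gt]; ring
  · rw [if_pos h', if_neg h'.not_gt]; ring

variable [AddCommGroup A] [Module ℝ A]

/-- `D a` is moved past the smaller indices, each giving a sign, until it reaches its place. If `a`
already occurs, a square `D a (D a f)` appears, and this is zero because anticommutation with itself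
makes it its own negative. -/
theorem iterSkew_step {D : Fin n → A → A} (hs : ∀ a (r : ℝ) f, D a (r • f) = r • D a f)
    (ha : ∀ a b f, D a (D b f) = -D b (D a f)) (a : Fin n) (N : Finset (Fin n)) (f : A) :
    D a (iterSkew D N f) =
      if a ∈ N then 0 else insSign a N • iterSkew D (insert a N) f := by
  have h0 : ∀ a, D a 0 = 0 := fun a => by have := hs a 0 0; rwa [zero_smul, zero_smul] at this
  have hn : ∀ a f, D a (-f) = -D a f := fun a f => by
    rw [← neg_one_smul ℝ, hs, neg_one_smul]
  have hsq : ∀ a f, D a (D a f) = 0 := fun a f => by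
    have h2 : (2 : ℝ) • D a (D a f) = 0 := by
      rw [two_smul]; nth_rewrite 1 [ha a a f]; exact neg_add_cancel _
    exact (smul_eq_zero.1 h2).resolve_left two_ne_zero
  induction N using Finset.induction_on_min with
  | empty =>
    rw [iterSkew_empty, if_neg (Finset.notMem_empty a), insSign_min (by simp), one_smul,
      iterSkew_insert_min D (by simp), iterSkew_empty]
  | insert b N hb ih =>
    have hbN : b ∉ N := fun h => lt_irrefl _ (hb b h)
    rw [iterSkew_insert_min D hb]
    rcases lt_trichotomy a b with h | rfl | h
    · have haN : ∀ c ∈ insert b N, a < c := by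
        intro c hc
        rcases Finset.mem_insert.1 hc with rfl | hc
        · exact h
        · exact h.trans (hb c hc)
      rw [if_neg fun h' => lt_irrefl _ (haN a h'), insSign_min haN, one_smul,
        iterSkew_insert_min D haN, iterSkew_insert_min D hb]
    · rw [if_pos (Finset.mem_insert_self _ _), hsq]
    · rw [ha, ih]
      by_cases haN : a ∈ N
      · rw [if_pos haN, if_pos (Finset.mem_insert_of_mem haN), h0, neg_zero]
      · have hab : a ∉ insert b N := by simp [haN, h.ne']
        have hba : ∀ c ∈ insert a N, b < c := by
          intro c hc
          rcases Finset.mem_insert.1 hc with rfl | hc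
          · exact h
          · exact hb c hc
        rw [if_neg haN, if_neg hab, hs, insSign_insert hbN, if_pos h, Finset.insert_comm,
          iterSkew_insert_min D hba, neg_one_mul, neg_smul]

end Iter

/-! ### Functions of the space-time coordinates -/

section Base

variable {n : ℕ} (U : TopologicalSpace.Opens (Fin n → ℝ))

/-- The open set `U` as a superdomain. -/
def baseDom : SuperDomain (Fin n) where
  parity _ := 0
  gh _ := 0
  dom := {p | (fun μ => p ⟨μ, rfl⟩) ∈ U}
  isOpen_dom := U.isOpen.preimage (continuous_pi fun _ => continuous_apply _)

variable {U}

theorem hasParity_base (f : (baseDom U).LocalFn) : (baseDom U).HasParity f 0 := by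
  have : (baseDom U).pInv = AlgHom.id ℝ _ := isGeo_pInv.ext isGeo_id fun i => by
    rw [(hasParity_iff _ _).1 (hasParity_coord i), show (baseDom U).parity i = 0 from rfl,
      sgn_zero, one_smul]; rfl
  rw [hasParity_iff, this, sgn_zero, one_smul]; rfl

variable {ι : Type u} {F : SuperDomain ι}

/-- Functions of the space-time coordinates as functions on the jet space. -/
noncomputable def bas (U : TopologicalSpace.Opens (Fin n → ℝ)) (F : SuperDomain ι) :
    (baseDom U).LocalFn →ₐ[ℝ] (jet U F).LocalFn :=
  (Morphism.rename (M := jet U F) (N := baseDom U) (fun μ => .base μ) (fun _ => rfl)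
    (fun _ hp => hp.1)).pullback

theorem isGeo_bas : IsGeo (bas U F) := Morphism.isGeo_pullback _

theorem bas_coord (μ : Fin n) : bas U F ((baseDom U).coord μ) = (jet U F).coord (.base μ) :=
  Morphism.rename_coord μ

theorem hasParity_bas (f : (baseDom U).LocalFn) : (jet U F).HasParity (bas U F f) 0 :=
  isGeo_bas.hasParity (hasParity_base f)

theorem isDer_pd_base (μ : Fin n) : IsDer (AlgHom.id ℝ _) 0 ((baseDom U).pd μ) :=
  isDer_pd rfl

theorem pd_base_comm (μ ν : Fin n) (f : (baseDom U).LocalFn) :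
    (baseDom U).pd μ ((baseDom U).pd ν f) = (baseDom U).pd ν ((baseDom U).pd μ f) := by
  classical
  refine (isDer_pd_base μ).commute (isDer_pd_base ν) (fun i => ?_) f
  rw [pd_coord, pd_coord]
  split_ifs <;> simp [(isDer_pd_base _).one]

/-- Rigidity again: a derivation that kills the `x^μ` kills every smooth function of them. -/
theorem eq_zero_bas {p : ZMod 2} {Y : (jet U F).LocalFn → (jet U F).LocalFn}
    (hY : IsDer (AlgHom.id ℝ _) p Y) (h : ∀ μ, Y ((jet U F).coord (.base μ)) = 0)
    (f : (baseDom U).LocalFn) : Y (bas U F f) = 0 :=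
  (hY.right isGeo_bas).eq_zero (fun μ => by rw [bas_coord, h]) f

/-- The derivative with respect to the explicit space-time coordinates. -/
noncomputable abbrev xD (U : TopologicalSpace.Opens (Fin n → ℝ)) (F : SuperDomain ι) (μ : Fin n) :
    (jet U F).LocalFn →ₗ[ℝ] (jet U F).LocalFn := (jet U F).pd (.base μ)

theorem isDer_xD (μ : Fin n) : IsDer (AlgHom.id ℝ _) 0 (xD U F μ) := isDer_pd rfl

theorem xD_base (μ ν : Fin n) : xD U F μ ((jet U F).coord (.base ν)) = if ν = μ then 1 else 0 := by
  classical
  rw [pd_coord]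
  simp [eq_comm]

theorem xD_field (μ : Fin n) (t : ι) (m : Multiset (Fin n)) :
    xD U F μ ((jet U F).coord (.field t m)) = 0 := by
  classical
  rw [pd_coord, if_neg (by simp)]

theorem xD_bas (μ : Fin n) (f : (baseDom U).LocalFn) :
    xD U F μ (bas U F f) = bas U F ((baseDom U).pd μ f) := by
  classical
  refine (((isDer_pd_base μ).intertwine (isDer_xD μ) isGeo_bas (fun i => ?_)) f).symm
  rw [bas_coord, xD_base, pd_coord]
  by_cases h : i = μ
  · simp [h]
  · simp [h, Ne.symm h]

theorem isDer_totalD (μ : Fin n) : IsDer (AlgHom.id ℝ _) 0 (totalD U F μ) := by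
  refine isDer_vectorField fun i => ?_
  rw [add_zero]
  match i with
  | .base ν =>
    change HasParity _ (if ν = μ then 1 else 0) 0
    split_ifs
    · exact hasParity_one
    · exact hasParity_zero _
  | .field α m => exact hasParity_coord _

theorem totalD_base (μ ν : Fin n) :
    totalD U F μ ((jet U F).coord (.base ν)) = if ν = μ then 1 else 0 :=
  vectorField_coord _ _

theorem totalD_field (μ : Fin n) (t : ι) (m : Multiset (Fin n)) :
    totalD U F μ ((jet U F).coord (.field t m)) = (jet U F).coord (.field t (μ ::ₘ m)) :=
  vectorField_coord _ _

theorem totalD_bas (μ : Fin n) (f : (baseDom U).LocalFn) :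
    totalD U F μ (bas U F f) = bas U F ((baseDom U).pd μ f) := by
  classical
  refine (((isDer_pd_base μ).intertwine (isDer_totalD μ) isGeo_bas (fun i => ?_)) f).symm
  rw [bas_coord, totalD_base, pd_coord]
  by_cases h : i = μ
  · simp [h]
  · simp [h, Ne.symm h]

theorem totalD_comm (μ ν : Fin n) (f : (jet U F).LocalFn) :
    totalD U F μ (totalD U F ν f) = totalD U F ν (totalD U F μ f) := by
  refine (isDer_totalD μ).commute (isDer_totalD ν) (fun i => ?_) f
  match i with
  | .base ρ =>
    rw [totalD_base, totalD_base]
    split_ifs <;> simp [(isDer_totalD _).one, (isDer_totalD _).zero]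
  | .field t m => simp only [totalD_field, Multiset.cons_swap]

theorem iter_totalD_coord (t : ι) (m : Multiset (Fin n)) :
    iter (totalD U F) m ((jet U F).coord (.field t 0)) = (jet U F).coord (.field t m) := by
  induction m using Multiset.induction_on with
  | empty => exact iter_zero _ _
  | cons a m ih => rw [iter_cons totalD_comm, ih, totalD_field]

theorem iter_totalD_bas (m : Multiset (Fin n)) (f : (baseDom U).LocalFn) :
    iter (totalD U F) m (bas U F f) = bas U F (iter (fun μ => (baseDom U).pd μ) m f) :=
  (iter_intertwine (fun a f => (totalD_bas a f).symm) m f).symm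

theorem hasParity_iter {D : Fin n → (jet U F).LocalFn → (jet U F).LocalFn}
    (hD : ∀ μ, IsDer (AlgHom.id ℝ _) 0 (D μ)) (m : Multiset (Fin n)) {f : (jet U F).LocalFn}
    {p : ZMod 2} (hf : (jet U F).HasParity f p) : (jet U F).HasParity (iter D m f) p :=
  iter_induction (P := fun f => (jet U F).HasParity f p)
    (fun a f hf => by simpa using (hD a).hasParity hf) m hf

theorem iter_add {D : Fin n → (jet U F).LocalFn → (jet U F).LocalFn}
    (hD : ∀ μ, IsDer (AlgHom.id ℝ _) 0 (D μ)) (m : Multiset (Fin n)) (f g : (jet U F).LocalFn) :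
    iter D m (f + g) = iter D m f + iter D m g := by
  have : ∀ l : List (Fin n), l.foldr D (f + g) = l.foldr D f + l.foldr D g := by
    intro l
    induction l with
    | nil => rfl
    | cons a l ih => rw [List.foldr_cons, ih, (hD a).add]; rfl
  exact this _

theorem iter_smul {D : Fin n → (jet U F).LocalFn → (jet U F).LocalFn}
    (hD : ∀ μ, IsDer (AlgHom.id ℝ _) 0 (D μ)) (m : Multiset (Fin n)) (r : ℝ)
    (f : (jet U F).LocalFn) : iter D m (r • f) = r • iter D m f :=
  (iter_intertwine (X := fun f => r • f) (fun a f => ((hD a).smul r f).symm) m f).symm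

/-- The projection that sets the derivatives of the fields to zero. -/
noncomputable def undiff (U : TopologicalSpace.Opens (Fin n → ℝ)) (F : SuperDomain ι) :
    Morphism (jet U F) (jet U F) where
  even
    | ⟨.base μ, h⟩ => (jet U F).proj ⟨.base μ, h⟩
    | ⟨.field α m, h⟩ => if m = 0 then (jet U F).proj ⟨.field α m, h⟩ else 0
  even_mem p := ⟨p.2.1, by simp only [if_true]; exact p.2.2⟩
  odd
    | ⟨.base _, _⟩ => 0
    | ⟨.field α m, h⟩ => if m = 0 then Finsupp.single ⟨.field α m, h⟩ 1 else 0

theorem undiff_base (μ : Fin n) :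
    (undiff U F).pullback ((jet U F).coord (.base μ)) = (jet U F).coord (.base μ) := by
  have h : (jet U F).parity (.base μ) = 0 := rfl
  rw [Morphism.pullback_coord_even _ h, coord_even h]; rfl

theorem undiff_field (α : ι) (m : Multiset (Fin n)) :
    (undiff U F).pullback ((jet U F).coord (.field α m)) =
      if m = 0 then (jet U F).coord (.field α m) else 0 := by
  by_cases h : (jet U F).parity (.field α m) = 0
  · rw [Morphism.pullback_coord_even _ h, coord_even h]
    simp only [undiff]
    split_ifs
    · rfl
    · rw [ofSmooth, TensorProduct.zero_tmul]
  · rw [Morphism.pullback_coord_odd _ h, coord_odd h]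
    simp only [undiff]
    split_ifs
    · rfl
    · rw [map_zero, TensorProduct.tmul_zero]

theorem undiff_bas (f : (baseDom U).LocalFn) : (undiff U F).pullback (bas U F f) = bas U F f :=
  DFunLike.congr_fun (((Morphism.isGeo_pullback _).comp isGeo_bas).ext isGeo_bas fun i => by
    rw [AlgHom.comp_apply, bas_coord, undiff_base]) f

/-- Derivations that agree on undifferentiated fields agree on functions of them. -/
theorem IsDer.ext_undiff {κ : Type v} {M : SuperDomain κ} {Φ : (jet U F).LocalFn →ₐ[ℝ] M.LocalFn}
    {p : ZMod 2} {X Y : (jet U F).LocalFn → M.LocalFn} (hX : IsDer Φ p X) (hY : IsDer Φ p Y)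
    (hb : ∀ μ, X ((jet U F).coord (.base μ)) = Y ((jet U F).coord (.base μ)))
    (hf : ∀ α, X ((jet U F).coord (.field α 0)) = Y ((jet U F).coord (.field α 0)))
    {f : (jet U F).LocalFn} (h : (undiff U F).pullback f = f) : X f = Y f := by
  rw [← h]
  refine (hX.comp_right (Morphism.isGeo_pullback (undiff U F))).ext
    (hY.comp_right (Morphism.isGeo_pullback (undiff U F))) (fun i => ?_) f
  match i with
  | .base μ => rw [undiff_base, hb]
  | .field α m =>
    rw [undiff_field]
    split_ifs with hm
    · rw [hm, hf]
    · rw [hX.zero, hY.zero]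

end Base

/-! ### Derivations of the superfield jets -/

section Superfield

variable {n : ℕ} {U : TopologicalSpace.Opens (Fin n → ℝ)} {ι : Type u} {F : SuperDomain ι}

theorem parity_superfield (t : ι) (N : Finset (Fin n)) (m : Multiset (Fin n)) :
    (jet U (superfield n F)).parity (.field (t, N) m) = F.parity t + N.card := rfl

theorem parity_erase {ν : Fin n} {N : Finset (Fin n)} (h : ν ∈ N) (p : ZMod 2) :
    p + ((N.erase ν).card : ZMod 2) = p + N.card + 1 := by
  have e : N.card = (N.erase ν).card + 1 := (Finset.card_erase_add_one h).symm
  rw [e]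
  push_cast
  rw [add_assoc, add_assoc, CharTwo.add_self_eq_zero, add_zero]

theorem hasParity_erase {t t' : ι} (ht : F.parity t' = F.parity t) {ν : Fin n}
    {N : Finset (Fin n)} (h : ν ∈ N) (m m' : Multiset (Fin n)) :
    (jet U (superfield n F)).HasParity ((jet U (superfield n F)).coord (.field (t', N.erase ν) m'))
      ((jet U (superfield n F)).parity (.field (t, N) m) + 1) := by
  rw [parity_superfield, ← parity_erase h, ← ht]
  exact hasParity_coord _

theorem isDer_thetaD (ν : Fin n) : IsDer (AlgHom.id ℝ _) 1 (thetaD U F ν) := by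
  refine isDer_vectorField fun i => ?_
  match i with
  | .base ν => exact hasParity_zero _
  | .field (t, N) m =>
    change HasParity _ (if ν ∈ N then 0 else _) _
    split_ifs with h
    · exact hasParity_zero _
    · refine HasParity.smul ?_ _
      have := hasParity_coord (M := jet U (superfield n F)) (.field (t, insert ν N) m)
      rw [parity_superfield, Finset.card_insert_of_notMem h] at this
      push_cast at this
      rwa [parity_superfield, add_assoc]

theorem thetaD_base (ν μ : Fin n) : thetaD U F ν ((jet U (superfield n F)).coord (.base μ)) = 0 :=
  vectorField_coord _ _

theorem thetaD_field (ν : Fin n) (t : ι) (N : Finset (Fin n)) (m : Multiset (Fin n)) :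
    thetaD U F ν ((jet U (superfield n F)).coord (.field (t, N) m)) =
      if ν ∈ N then 0 else (sgn (F.parity t) * insSign ν N) •
        (jet U (superfield n F)).coord (.field (t, insert ν N) m) :=
  vectorField_coord _ _

theorem thetaD_bas (ν : Fin n) (f : (baseDom U).LocalFn) :
    thetaD U F ν (bas U (superfield n F) f) = 0 :=
  eq_zero_bas (isDer_thetaD ν) (thetaD_base ν) f

theorem thetaD_totalD (ν μ : Fin n) (f : (jet U (superfield n F)).LocalFn) :
    thetaD U F ν (totalD U (superfield n F) μ f) = totalD U (superfield n F) μ (thetaD U F ν f) := by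
  refine (isDer_thetaD ν).commute (isDer_totalD μ) (fun i => ?_) f
  match i with
  | .base ρ =>
    rw [totalD_base, thetaD_base, (isDer_totalD _).zero]
    split_ifs <;> simp [(isDer_thetaD _).one, (isDer_thetaD _).zero]
  | .field (t, N) m =>
    rw [totalD_field, thetaD_field, thetaD_field]
    split_ifs
    · rw [(isDer_totalD _).zero]
    · rw [(isDer_totalD _).smul, totalD_field]

theorem thetaD_xD (ν μ : Fin n) (f : (jet U (superfield n F)).LocalFn) :
    thetaD U F ν (xD U (superfield n F) μ f) = xD U (superfield n F) μ (thetaD U F ν f) := by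
  refine (isDer_thetaD ν).commute (isDer_xD μ) (fun i => ?_) f
  match i with
  | .base ρ =>
    rw [xD_base, thetaD_base, map_zero]
    split_ifs <;> simp [(isDer_thetaD _).one, (isDer_thetaD _).zero]
  | .field (t, N) m =>
    rw [xD_field, thetaD_field, (isDer_thetaD _).zero]
    split_ifs
    · rw [map_zero]
    · rw [map_smul, xD_field, smul_zero]

theorem thetaD_anticomm (ν ρ : Fin n) (f : (jet U (superfield n F)).LocalFn) :
    thetaD U F ν (thetaD U F ρ f) = -thetaD U F ρ (thetaD U F ν f) := by
  refine (isDer_thetaD ν).anticommute (isDer_thetaD ρ) (fun i => ?_) f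
  match i with
  | .base ρ => rw [thetaD_base, thetaD_base, (isDer_thetaD _).zero, (isDer_thetaD _).zero, add_zero]
  | .field (t, N) m =>
    rw [thetaD_field, thetaD_field]
    by_cases hν : ν ∈ N <;> by_cases hρ : ρ ∈ N
    · rw [if_pos hν, if_pos hρ, (isDer_thetaD _).zero, (isDer_thetaD _).zero, add_zero]
    · rw [if_pos hν, if_neg hρ, (isDer_thetaD _).zero, (isDer_thetaD _).smul, thetaD_field,
        if_pos (Finset.mem_insert_of_mem hν), smul_zero, add_zero]
    · rw [if_neg hν, if_pos hρ, (isDer_thetaD _).zero, (isDer_thetaD _).smul, thetaD_field,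
        if_pos (Finset.mem_insert_of_mem hρ), smul_zero, add_zero]
    · rw [if_neg hν, if_neg hρ, (isDer_thetaD _).smul, (isDer_thetaD _).smul, thetaD_field,
        thetaD_field]
      by_cases h : ν = ρ
      · subst h
        rw [if_pos (Finset.mem_insert_self _ _), smul_zero, add_zero]
      · rw [if_neg (by simp [h, hν]), if_neg (by simp [Ne.symm h, hρ]), smul_smul, smul_smul,
          Finset.insert_comm, ← add_smul]
        have e : sgn (F.parity t) * insSign ρ N * (sgn (F.parity t) * insSign ν (insert ρ N)) +
            sgn (F.parity t) * insSign ν N * (sgn (F.parity t) * insSign ρ (insert ν N)) = 0 := by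
          linear_combination sgn (F.parity t) ^ 2 * insSign_swap hν hρ h
        rw [e, zero_smul]

theorem iterSkew_thetaD_coord (t : ι) (N : Finset (Fin n)) (m : Multiset (Fin n)) :
    iterSkew (thetaD U F) N ((jet U (superfield n F)).coord (.field (t, ∅) m)) =
      sgn (N.card * F.parity t) • (jet U (superfield n F)).coord (.field (t, N) m) := by
  refine iterSkew_induction (P := fun N f => f = sgn (N.card * F.parity t) •
    (jet U (superfield n F)).coord (.field (t, N) m)) (by simp [sgn_zero]) ?_ N
  intro a N ha ih
  have haN : a ∉ N := fun h => lt_irrefl _ (ha a h)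
  rw [ih, (isDer_thetaD _).smul, thetaD_field, if_neg haN, insSign_min ha, mul_one, smul_smul,
    ← sgn_add, Finset.card_insert_of_notMem haN]
  congr 2
  push_cast; ring

theorem coord_eq_iterSkew (t : ι) (N : Finset (Fin n)) (m : Multiset (Fin n)) :
    (jet U (superfield n F)).coord (.field (t, N) m) = sgn (N.card * F.parity t) •
      iterSkew (thetaD U F) N ((jet U (superfield n F)).coord (.field (t, ∅) m)) := by
  rw [iterSkew_thetaD_coord, smul_smul, sgn_mul_self, one_smul]

theorem thetaD_iterSkew (ν : Fin n) (N : Finset (Fin n)) (f : (jet U (superfield n F)).LocalFn) :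
    thetaD U F ν (iterSkew (thetaD U F) N f) = if ν ∈ N then 0 else
      insSign ν N • iterSkew (thetaD U F) (insert ν N) f :=
  iterSkew_step (fun a => (isDer_thetaD a).smul) thetaD_anticomm ν N f

theorem hasParity_iterSkew {D : Fin n → (jet U F).LocalFn → (jet U F).LocalFn}
    (hD : ∀ μ, IsDer (AlgHom.id ℝ _) 1 (D μ)) (N : Finset (Fin n)) {f : (jet U F).LocalFn}
    {p : ZMod 2} (hf : (jet U F).HasParity f p) :
    (jet U F).HasParity (iterSkew D N f) (N.card + p) := by
  refine iterSkew_induction (P := fun N f => (jet U F).HasParity f (N.card + p))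
    (by simpa using hf) ?_ N
  intro a N ha ih
  have haN : a ∉ N := fun h => lt_irrefl _ (ha a h)
  have := (hD a).hasParity ih
  rw [Finset.card_insert_of_notMem haN]
  push_cast
  rwa [add_comm (N.card : ZMod 2) 1, add_assoc]

theorem undiff_thetaD (ν : Fin n) (f : (jet U (superfield n F)).LocalFn) :
    (undiff U (superfield n F)).pullback (thetaD U F ν f) =
      thetaD U F ν ((undiff U (superfield n F)).pullback f) := by
  refine (isDer_thetaD ν).intertwine (isDer_thetaD ν) (Morphism.isGeo_pullback _) (fun i => ?_) f
  match i with
  | .base ρ => rw [thetaD_base, map_zero, undiff_base, thetaD_base]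
  | .field (t, N) m =>
    rw [thetaD_field, undiff_field]
    by_cases hm : m = 0
    · rw [if_pos hm, thetaD_field]
      split_ifs
      · rw [map_zero]
      · rw [map_smul, undiff_field, if_pos hm]
    · rw [if_neg hm, (isDer_thetaD _).zero]
      split_ifs
      · rw [map_zero]
      · rw [map_smul, undiff_field, if_neg hm, smul_zero]

/-! #### Contractions -/

/-- The anticommutator of `∂/∂θ^ν` with a contraction of the skew indices. -/
theorem contraction_thetaD {X : (jet U (superfield n F)).LocalFn → (jet U (superfield n F)).LocalFn}
    (hX : IsDer (AlgHom.id ℝ _) 1 X) {t : ι} {m : Multiset (Fin n)}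
    {g : Fin n → Finset (Fin n) → (jet U (superfield n F)).LocalFn}
    (hg : ∀ ρ ν N, thetaD U F ν (g ρ N) =
      if ν ∈ N then 0 else (sgn (F.parity t) * insSign ν N) • g ρ (insert ν N))
    (h : ∀ N, X ((jet U (superfield n F)).coord (.field (t, N) m)) =
      ∑ ρ ∈ N, (sgn (F.parity t) * insSign ρ N) • g ρ (N.erase ρ))
    (ν : Fin n) (N : Finset (Fin n)) :
    X (thetaD U F ν ((jet U (superfield n F)).coord (.field (t, N) m))) +
      thetaD U F ν (X ((jet U (superfield n F)).coord (.field (t, N) m))) = g ν N := by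
  have hs : ∀ r : ℝ, sgn (F.parity t) * r * (sgn (F.parity t) * r) = r * r := fun r => by
    rw [mul_mul_mul_comm, sgn_mul_self, one_mul]
  have hs' : ∀ r s : ℝ, sgn (F.parity t) * r * (sgn (F.parity t) * s) = r * s := fun r s => by
    rw [mul_mul_mul_comm, sgn_mul_self, one_mul]
  rw [thetaD_field, h, (isDer_thetaD ν).sum]
  simp only [(isDer_thetaD ν).smul, hg]
  -- If `ν ∈ N`, the first term vanishes and in the second only `ρ = ν` survives. If `ν ∉ N`,
  -- contracting the newly inserted index yields `g ν N`, and the remaining terms of the two sums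
  -- cancel pairwise by the sign rule for exchanging two insertions.
  by_cases hν : ν ∈ N
  · rw [if_pos hν, hX.zero, zero_add, Finset.sum_eq_single_of_mem ν hν]
    · rw [if_neg (Finset.notMem_erase _ _), insSign_erase_self, smul_smul, hs, insSign_mul_self,
        one_smul, Finset.insert_erase hν]
    · intro ρ _ hρ
      rw [if_pos (Finset.mem_erase.2 ⟨hρ.symm, hν⟩), smul_zero]
  · rw [if_neg hν, hX.smul, h, Finset.sum_insert hν, Finset.erase_insert hν, smul_add, smul_smul,
      insSign_insert hν, if_neg (lt_irrefl ν), one_mul, hs, insSign_mul_self, one_smul, add_assoc,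
      Finset.smul_sum, ← Finset.sum_add_distrib, Finset.sum_eq_zero, add_zero]
    intro ρ hρ
    have hne : ν ≠ ρ := fun h => hν (h ▸ hρ)
    have hν' : ν ∉ N.erase ρ := fun h => hν (Finset.mem_of_mem_erase h)
    rw [if_neg hν', smul_smul, smul_smul, hs', hs', Finset.erase_insert_of_ne hne, ← add_smul]
    have := insSign_swap hν' (Finset.notMem_erase ρ N) hne
    rw [Finset.insert_erase hρ, insSign_erase_self] at this
    have h2 : insSign ρ (insert ν N) = insSign ρ (insert ν (N.erase ρ)) := by
      rw [← insSign_erase_self, Finset.erase_insert_of_ne hne]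
    rw [h2, mul_comm (insSign ρ N)]
    have h3 : insSign ν N * insSign ρ (insert ν (N.erase ρ)) +
        insSign ν (N.erase ρ) * insSign ρ N = 0 := by
      have e1 := insSign_insert (ν := ρ) hν'
      have e2 := insSign_insert (ν := ν) (Finset.notMem_erase ρ N)
      rw [Finset.insert_erase hρ] at e2
      rw [e1, e2, insSign_erase_self]
      rcases lt_or_gt_of_ne hne with h' | h'
      · rw [if_pos h', if_neg h'.not_gt]; ring
      · rw [if_pos h', if_neg h'.not_gt]; ring
    rw [h3, zero_smul]

theorem isDer_dF : IsDer (AlgHom.id ℝ _) 1 (dF U F) := by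
  refine isDer_vectorField fun i => ?_
  match i with
  | .base ν => exact hasParity_zero _
  | .field (t, N) m => exact HasParity.sum fun ν hν => (hasParity_erase rfl hν _ _).smul _

theorem dF_base (μ : Fin n) : dF U F ((jet U (superfield n F)).coord (.base μ)) = 0 :=
  vectorField_coord _ _

theorem dF_field (t : ι) (N : Finset (Fin n)) (m : Multiset (Fin n)) :
    dF U F ((jet U (superfield n F)).coord (.field (t, N) m)) =
      ∑ ν ∈ N, (sgn (F.parity t) * insSign ν N) •
        (jet U (superfield n F)).coord (.field (t, N.erase ν) (ν ::ₘ m)) :=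
  vectorField_coord _ _

theorem dF_totalD (μ : Fin n) (f : (jet U (superfield n F)).LocalFn) :
    dF U F (totalD U (superfield n F) μ f) = totalD U (superfield n F) μ (dF U F f) := by
  refine isDer_dF.commute (isDer_totalD μ) (fun i => ?_) f
  match i with
  | .base ρ =>
    rw [totalD_base, dF_base, (isDer_totalD _).zero]
    split_ifs <;> simp [isDer_dF.one, isDer_dF.zero]
  | .field (t, N) m =>
    rw [totalD_field, dF_field, dF_field, (isDer_totalD _).sum]
    simp only [(isDer_totalD _).smul, totalD_field, Multiset.cons_swap]

/-- Both operators kill the explicit `x^μ`, so the anticommutator cannot be the full total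
derivative: the explicit part `xD` has to be removed. On fields it is the contraction identity with
the contracted index added to `(μ)`. -/
theorem dF_thetaD (ν : Fin n) (f : (jet U (superfield n F)).LocalFn) :
    dF U F (thetaD U F ν f) = totalD U (superfield n F) ν f - xD U (superfield n F) ν f -
      thetaD U F ν (dF U F f) := by
  rw [eq_sub_iff_add_eq]
  refine (isDer_dF.comm_odd (isDer_thetaD ν) (isDer_thetaD ν) fun _ => rfl).ext
    ((isDer_totalD ν).fun_sub (isDer_xD ν)) (fun i => ?_) f
  match i with
  | .base ρ =>
    rw [thetaD_base, dF_base, totalD_base, xD_base, (isDer_thetaD _).zero, isDer_dF.zero, add_zero,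
      sub_self]
  | .field (t, N) m =>
    rw [totalD_field, xD_field, sub_zero]
    exact contraction_thetaD isDer_dF
      (g := fun ρ N => (jet U (superfield n F)).coord (.field (t, N) (ρ ::ₘ m)))
      (fun ρ ν N => thetaD_field ν t N _) (fun N => dF_field t N m) ν N

/-- The contraction with `∂/∂θ^a`: the derivation with
`Ψ^t_{(μ)|ν₁…νₚ} ↦ (-1)^{|t|} ∑ᵢ (-1)^{i-1} δ^a_{νᵢ} Ψ^t_{(μ)|ν₁…ν̂ᵢ…νₚ}`. -/
noncomputable def contr (U : TopologicalSpace.Opens (Fin n → ℝ)) (F : SuperDomain ι)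
    (a : Fin n) : (jet U (superfield n F)).LocalFn → (jet U (superfield n F)).LocalFn :=
  (jet U (superfield n F)).vectorField fun
    | .base _ => 0
    | .field (t, N) m => ∑ ν ∈ N, (sgn (F.parity t) * insSign ν N) •
        if ν = a then (jet U (superfield n F)).coord (.field (t, N.erase ν) m) else 0

theorem isDer_contr (a : Fin n) : IsDer (AlgHom.id ℝ _) 1 (contr U F a) := by
  refine isDer_vectorField fun i => ?_
  match i with
  | .base ν => exact hasParity_zero _
  | .field (t, N) m =>
    refine HasParity.sum fun ν hν => HasParity.smul ?_ _
    split_ifs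
    · exact hasParity_erase rfl hν _ _
    · exact hasParity_zero _

theorem contr_base (a μ : Fin n) : contr U F a ((jet U (superfield n F)).coord (.base μ)) = 0 :=
  vectorField_coord _ _

theorem contr_field (a : Fin n) (t : ι) (N : Finset (Fin n)) (m : Multiset (Fin n)) :
    contr U F a ((jet U (superfield n F)).coord (.field (t, N) m)) =
      ∑ ν ∈ N, (sgn (F.parity t) * insSign ν N) •
        if ν = a then (jet U (superfield n F)).coord (.field (t, N.erase ν) m) else 0 :=
  vectorField_coord _ _

/-- Presents `d^F` on coordinates as `∑_a ∂_a i_a`. In this form a change of frame transforms the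
two factors contragrediently. -/
theorem dF_eq_sum_contr (t : ι) (N : Finset (Fin n)) (m : Multiset (Fin n)) :
    dF U F ((jet U (superfield n F)).coord (.field (t, N) m)) =
      ∑ a, totalD U (superfield n F) a
        (contr U F a ((jet U (superfield n F)).coord (.field (t, N) m))) := by
  simp only [dF_field, contr_field, (isDer_totalD _).sum, (isDer_totalD _).smul]
  rw [Finset.sum_comm]
  refine Finset.sum_congr rfl fun ν _ => ?_
  rw [Finset.sum_eq_single ν]
  · rw [if_pos rfl, totalD_field]
  · intro b _ hb; rw [if_neg hb.symm, (isDer_totalD _).zero, smul_zero]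
  · intro h; exact absurd (Finset.mem_univ _) h

/-- The Euler vector field, which counts the fields. -/
noncomputable def euler (U : TopologicalSpace.Opens (Fin n → ℝ)) (F : SuperDomain ι) :
    (jet U F).LocalFn → (jet U F).LocalFn :=
  (jet U F).vectorField fun
    | .base _ => 0
    | .field t m => (jet U F).coord (.field t m)

theorem isDer_euler : IsDer (AlgHom.id ℝ _) 0 (euler U F) := by
  refine isDer_vectorField fun i => ?_
  match i with
  | .base ν => exact hasParity_zero _
  | .field t m => rw [add_zero]; exact hasParity_coord _

theorem euler_base (μ : Fin n) : euler U F ((jet U F).coord (.base μ)) = 0 :=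
  vectorField_coord _ _

theorem euler_field (t : ι) (m : Multiset (Fin n)) :
    euler U F ((jet U F).coord (.field t m)) = (jet U F).coord (.field t m) :=
  vectorField_coord _ _

theorem euler_thetaD (ν : Fin n) (f : (jet U (superfield n F)).LocalFn) :
    euler U (superfield n F) (thetaD U F ν f) = thetaD U F ν (euler U (superfield n F) f) := by
  refine ((isDer_thetaD ν).commute isDer_euler (fun i => ?_) f).symm
  match i with
  | .base ρ => rw [thetaD_base, euler_base, (isDer_thetaD _).zero, isDer_euler.zero]
  | .field (t, N) m =>
    rw [euler_field, thetaD_field]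
    split_ifs
    · rw [isDer_euler.zero]
    · rw [isDer_euler.smul, euler_field]

/-- The usual relation between contraction and its dual operator. Since an anticommutator is a
derivation, the Euler field, which is the identity on field coordinates, takes the place of the
identity. -/
theorem contr_thetaD (a ν : Fin n) (f : (jet U (superfield n F)).LocalFn) :
    contr U F a (thetaD U F ν f) = (if ν = a then euler U (superfield n F) f else 0) -
      thetaD U F ν (contr U F a f) := by
  rw [eq_sub_iff_add_eq]
  have hE : IsDer (AlgHom.id ℝ _) 0 fun f => if ν = a then euler U (superfield n F) f else 0 := by
    by_cases h : ν = a
    · simpa only [if_pos h] using isDer_euler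
    · simpa only [if_neg h] using IsDer.fun_zero isGeo_id 0
  refine ((isDer_contr a).comm_odd (isDer_thetaD ν) (isDer_thetaD ν) fun _ => rfl).ext
    hE (fun i => ?_) f
  match i with
  | .base ρ =>
    rw [thetaD_base, contr_base, euler_base, (isDer_thetaD _).zero, (isDer_contr _).zero, add_zero]
    simp
  | .field (t, N) m =>
    rw [euler_field]
    refine contraction_thetaD (isDer_contr a)
      (g := fun ρ N => if ρ = a then (jet U (superfield n F)).coord (.field (t, N) m) else 0)
      (fun ρ ν N => ?_) (fun N => contr_field a t N m) ν N
    by_cases h : ρ = a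
    · simp only [if_pos h, thetaD_field]
    · simp only [if_neg h, (isDer_thetaD _).zero, smul_zero, ite_self]

/-! #### Prolongations -/

section Prolong

variable {Q : ι → (jet U (superfield n F)).LocalFn}

theorem isDer_prolong (hQ : ∀ t, (jet U (superfield n F)).HasParity (Q t) (F.parity t + 1)) :
    IsDer (AlgHom.id ℝ _) 1 (prolong U F Q) := by
  refine isDer_vectorField fun i => ?_
  match i with
  | .base ν => exact hasParity_zero _
  | .field (t, N) m =>
    refine HasParity.smul ?_ _
    rw [parity_superfield, add_comm (F.parity t), add_assoc]
    exact hasParity_iterSkew isDer_thetaD N (hasParity_iter isDer_totalD m (hQ t))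

theorem prolong_base (μ : Fin n) :
    prolong U F Q ((jet U (superfield n F)).coord (.base μ)) = 0 :=
  vectorField_coord _ _

theorem prolong_field (t : ι) (N : Finset (Fin n)) (m : Multiset (Fin n)) :
    prolong U F Q ((jet U (superfield n F)).coord (.field (t, N) m)) =
      sgn (N.card * (F.parity t + 1)) •
        iterSkew (thetaD U F) N (iter (totalD U (superfield n F)) m (Q t)) :=
  vectorField_coord _ _

theorem prolong_totalD (hQ : ∀ t, (jet U (superfield n F)).HasParity (Q t) (F.parity t + 1))
    (μ : Fin n) (f : (jet U (superfield n F)).LocalFn) :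
    prolong U F Q (totalD U (superfield n F) μ f) =
      totalD U (superfield n F) μ (prolong U F Q f) := by
  refine (isDer_prolong hQ).commute (isDer_totalD μ) (fun i => ?_) f
  match i with
  | .base ρ =>
    rw [totalD_base, prolong_base, (isDer_totalD _).zero]
    split_ifs
    · exact (isDer_prolong hQ).one
    · exact (isDer_prolong hQ).zero
  | .field (t, N) m =>
    rw [totalD_field, prolong_field, prolong_field, (isDer_totalD _).smul, iter_cons totalD_comm,
      iterSkew_intertwine (D := thetaD U F) (fun a f => (thetaD_totalD a μ f).symm)]

/-- Enlarging `N` by one index changes the sign in `prolong` by `(-1)^(|t|+1)`, while `∂/∂θ` carries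
`(-1)^|t|`; the product is the minus sign of anticommutation. -/
theorem prolong_thetaD (hQ : ∀ t, (jet U (superfield n F)).HasParity (Q t) (F.parity t + 1))
    (ν : Fin n) (f : (jet U (superfield n F)).LocalFn) :
    prolong U F Q (thetaD U F ν f) = -thetaD U F ν (prolong U F Q f) := by
  refine (isDer_prolong hQ).anticommute (isDer_thetaD ν) (fun i => ?_) f
  match i with
  | .base ρ =>
    rw [thetaD_base, prolong_base, (isDer_thetaD _).zero, (isDer_prolong hQ).zero, add_zero]
  | .field (t, N) m =>
    rw [thetaD_field, prolong_field, (isDer_thetaD _).smul, thetaD_iterSkew]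
    by_cases h : ν ∈ N
    · rw [if_pos h, if_pos h, (isDer_prolong hQ).zero, smul_zero, add_zero]
    · rw [if_neg h, if_neg h, (isDer_prolong hQ).smul, prolong_field, smul_smul, smul_smul,
        ← add_smul, Finset.card_insert_of_notMem h]
      have : sgn (F.parity t) * insSign ν N * sgn (↑(N.card + 1) * (F.parity t + 1)) +
          sgn (N.card * (F.parity t + 1)) * insSign ν N = 0 := by
        push_cast
        rw [add_mul, one_mul, sgn_add, sgn_add (F.parity t), sgn_one]
        linear_combination (-insSign ν N * sgn (N.card * (F.parity t + 1))) *
          sgn_mul_self (F.parity t)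
      rw [this, zero_smul]

end Prolong

end Superfield

/-- A derivation killing `x` is linear over functions of `x`, so it passes through the Jacobi
matrices below. -/
theorem IsDer.bas_mul {n : ℕ} {U : TopologicalSpace.Opens (Fin n → ℝ)} {ι : Type u}
    {F : SuperDomain ι} {p : ZMod 2} {X : (jet U F).LocalFn → (jet U F).LocalFn}
    (hX : IsDer (AlgHom.id ℝ _) p X) (h : ∀ μ, X ((jet U F).coord (.base μ)) = 0)
    (c : (baseDom U).LocalFn) (f : (jet U F).LocalFn) :
    X (bas U F c * f) = bas U F c * X f :=
  hX.mul_even (hasParity_bas c) (eq_zero_bas hX h c) f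

section LinForms

variable {n : ℕ} {U : TopologicalSpace.Opens (Fin n → ℝ)} {ι : Type u} {F : SuperDomain ι}

/-! ### Linear forms in the fields -/

/-- Linear combinations of the fields with coefficients depending on `x`. -/
noncomputable def linForms (U : TopologicalSpace.Opens (Fin n → ℝ))
    (F : SuperDomain ι) : Submodule ℝ (jet U F).LocalFn :=
  Submodule.span ℝ {x | ∃ c t m, x = bas U F c * (jet U F).coord (.field t m)}

theorem bas_mul_mem_linForms (c : (baseDom U).LocalFn) {f : (jet U F).LocalFn}
    (hf : f ∈ linForms U F) : bas U F c * f ∈ linForms U F := by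
  induction hf using Submodule.span_induction with
  | mem f hf =>
    obtain ⟨d, t, m, rfl⟩ := hf
    rw [← mul_assoc, ← map_mul]
    exact Submodule.subset_span ⟨_, _, _, rfl⟩
  | zero => rw [mul_zero]; exact Submodule.zero_mem _
  | add f g _ _ hf hg => rw [mul_add]; exact Submodule.add_mem _ hf hg
  | smul r f _ hf => rw [mul_smul_comm]; exact Submodule.smul_mem _ r hf

theorem coord_mem_linForms (t : ι) (m : Multiset (Fin n)) :
    (jet U F).coord (.field t m) ∈ linForms U F :=
  Submodule.subset_span ⟨1, t, m, by rw [map_one, one_mul]⟩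

theorem IsDer.mem_linForms {X : (jet U F).LocalFn → (jet U F).LocalFn}
    {p : ZMod 2} (hX : IsDer (AlgHom.id ℝ _) p X)
    (hb : ∀ c : (baseDom U).LocalFn, ∃ d, X (bas U F c) = bas U F d)
    (hf : ∀ t m, X ((jet U F).coord (.field t m)) ∈ linForms U F) {f : (jet U F).LocalFn}
    (h : f ∈ linForms U F) : X f ∈ linForms U F := by
  induction h using Submodule.span_induction with
  | mem f hf' =>
    obtain ⟨c, t, m, rfl⟩ := hf'
    obtain ⟨d, hd⟩ := hb c
    rw [hX.leibniz, hd, AlgHom.id_apply, AlgHom.id_apply, twist_of_hasParity (hasParity_bas c),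
      mul_zero, sgn_zero, one_smul]
    exact Submodule.add_mem _ (bas_mul_mem_linForms _ (coord_mem_linForms t m))
      (bas_mul_mem_linForms _ (hf t m))
  | zero => rw [hX.zero]; exact Submodule.zero_mem _
  | add f g _ _ hf hg => rw [hX.add]; exact Submodule.add_mem _ hf hg
  | smul r f _ hf => rw [hX.smul]; exact Submodule.smul_mem _ r hf

theorem ofSmooth_body_pullback {κ : Type v} {M : SuperDomain κ} (φ : Morphism M (baseDom U))
    (c : (baseDom U).LocalFn) : M.ofSmooth (body _ (φ.pullback c)) = φ.pullback c := by
  have h : ∀ f : (baseDom U).LocalFn, (baseDom U).ofSmooth (body _ f) = f := by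
    intro f
    induction f using localFn_induction with
    | hs f => rw [body_ofSmooth]
    | ho o => exact absurd rfl o.2
    | hadd f g hf hg => rw [map_add, ← ofSmoothHom_apply, map_add]; exact congrArg₂ _ hf hg
    | hmul f g hf hg => rw [map_mul, ← ofSmoothHom_apply, map_mul]; exact congrArg₂ _ hf hg
  rw [← h c, Morphism.pullback_ofSmooth, body_ofSmooth]

theorem ofSmooth_body_bas (c : (baseDom U).LocalFn) :
    (jet U F).ofSmooth (body _ (bas U F c)) = bas U F c := ofSmooth_body_pullback _ c

/-- In an even linear form the terms with odd fields drop out under averaging with the involution.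
The averaged identity `f + pInv f = 2 body f` needs no homogeneity, so it can be proved by induction
over the span; the parity of `f` enters only at the end. The lemma makes such forms admissible
values for even coordinates in `exists_hom`. -/
theorem ofSmooth_body_of_mem_linForms {f : (jet U F).LocalFn}
    (hf : f ∈ linForms U F) (hp : (jet U F).HasParity f 0) :
    (jet U F).ofSmooth (body _ f) = f := by
  have h : f + (jet U F).pInv f = (2 : ℝ) • (jet U F).ofSmooth (body _ f) := by
    clear hp
    induction hf using Submodule.span_induction with
    | mem f hf' =>
      obtain ⟨c, t, m, rfl⟩ := hf'
      rw [map_mul, map_mul, ← ofSmoothHom_apply, map_mul, ofSmoothHom_apply, ofSmooth_body_bas,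
        (hasParity_iff _ _).1 (hasParity_bas c), sgn_zero, one_smul,
        (hasParity_iff _ _).1 (hasParity_coord _), ofSmoothHom_apply]
      by_cases h : (jet U F).parity (.field t m) = 0
      · rw [h, sgn_zero, one_smul, coord_even h, body_ofSmooth, two_smul]
      · rw [body_coord_odd h, (zmod_cases _).resolve_left h, sgn_one, neg_one_smul, mul_neg,
          add_neg_cancel, ofSmooth, TensorProduct.zero_tmul, mul_zero, smul_zero]
    | zero => simp [ofSmooth]
    | add f g _ _ hf hg =>
      rw [map_add, add_add_add_comm, hf, hg, map_add, ← ofSmoothHom_apply, ← ofSmoothHom_apply,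
        ← ofSmoothHom_apply, map_add, smul_add]
    | smul r f _ hf =>
      rw [map_smul, ← smul_add, hf, map_smul, ← ofSmoothHom_apply, ← ofSmoothHom_apply, map_smul,
        smul_comm]
  rw [(hasParity_iff _ _).1 hp, sgn_zero, one_smul, ← two_smul ℝ] at h
  exact (smul_right_injective _ (two_ne_zero (α := ℝ)) h).symm

end LinForms

namespace CoordChange

variable {n : ℕ} {U V : TopologicalSpace.Opens (Fin n → ℝ)} (Y : CoordChange U V)

/-- The inverse change of coordinates. -/
def symm : CoordChange V U where
  toFun := Y.invFun
  invFun := Y.toFun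
  contDiffOn_toFun := Y.contDiffOn_invFun
  contDiffOn_invFun := Y.contDiffOn_toFun
  mapsTo := Y.mapsTo_inv
  mapsTo_inv := Y.mapsTo
  left_inv := Y.right_inv
  right_inv := Y.left_inv

/-- The change of coordinates as a map of superdomains. -/
def baseMorphism : Morphism (baseDom U) (baseDom V) where
  even a := ⟨fun p => Y.toFun (fun μ => p.1 ⟨μ, rfl⟩) a.1,
    IsSmooth.comp (M := baseDom U) (f := fun (μ : Fin n) p => p.1 ⟨μ, rfl⟩)
      (D := (U : Set (Fin n → ℝ))) (G := fun x => Y.toFun x a.1)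
      (fun μ => (baseDom U).isSmooth_proj ⟨μ, rfl⟩)
      (contDiffOn_pi.1 Y.contDiffOn_toFun a.1) (fun p => p.2)⟩
  even_mem p := Y.mapsTo p.2
  odd _ := 0

/-- Substitution of `y = Y(x)` into functions on `V`. -/
noncomputable def subst : (baseDom V).LocalFn →ₐ[ℝ] (baseDom U).LocalFn :=
  Y.baseMorphism.pullback

theorem isGeo_subst : IsGeo Y.subst := Morphism.isGeo_pullback _

theorem subst_symm (f : (baseDom U).LocalFn) : Y.subst (Y.symm.subst f) = f := by
  refine DFunLike.congr_fun ((Y.isGeo_subst.comp Y.symm.isGeo_subst).ext isGeo_id fun i => ?_) f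
  have h : (baseDom U).parity i = 0 := rfl
  rw [AlgHom.comp_apply, subst, subst, Morphism.pullback_coord_even _ h,
    Morphism.pullback_ofSmooth, AlgHom.id_apply, coord_even h]
  congr 1
  ext p
  exact congrFun (Y.left_inv p.2) i

/-- The Jacobi matrix `∂Y^a/∂x^μ`. -/
noncomputable def jac (μ a : Fin n) : (baseDom U).LocalFn :=
  (baseDom U).pd μ (Y.subst ((baseDom V).coord a))

/-- The inverse Jacobi matrix `∂x^μ/∂y^a`, as a function of `x`. -/
noncomputable def jacInv (a μ : Fin n) : (baseDom U).LocalFn :=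
  Y.subst ((baseDom V).pd a (Y.symm.subst ((baseDom U).coord μ)))

/-- The second derivatives `∂²x^μ/∂y^a∂y^b`, as functions of `x`. -/
noncomputable def hessInv (a b μ : Fin n) : (baseDom U).LocalFn :=
  Y.subst ((baseDom V).pd a ((baseDom V).pd b (Y.symm.subst ((baseDom U).coord μ))))

theorem hessInv_comm (a b μ : Fin n) : Y.hessInv a b μ = Y.hessInv b a μ := by
  rw [hessInv, pd_base_comm, hessInv]

theorem subst_jac_symm (a μ : Fin n) : Y.subst (Y.symm.jac a μ) = Y.jacInv a μ := rfl

theorem subst_jacInv_symm (μ a : Fin n) : Y.subst (Y.symm.jacInv μ a) = Y.jac μ a :=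
  Y.subst_symm _

/-- The chain rule without analysis: both sides are derivations along the substitution, and they
agree on the coordinates. -/
theorem pd_subst (μ : Fin n) (f : (baseDom V).LocalFn) :
    (baseDom U).pd μ (Y.subst f) = ∑ a, Y.jac μ a * Y.subst ((baseDom V).pd a f) := by
  classical
  refine ((isDer_pd_base μ).right Y.isGeo_subst).ext (IsDer.fun_sum Finset.univ Y.isGeo_subst
    fun a _ => ((isDer_pd_base a).left Y.isGeo_subst).fun_mul (hasParity_base _)) (fun i => ?_) f
  rw [Finset.sum_eq_single i]
  · rw [pd_coord, if_pos rfl, map_one, mul_one]; rfl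
  · intro b _ hb; rw [pd_coord, if_neg hb, map_zero, mul_zero]
  · intro h; exact absurd (Finset.mem_univ _) h

/-- The chain rule applied to the identity `x^ν(Y(x)) = x^ν`. -/
theorem jac_jacInv (μ ν : Fin n) :
    ∑ a, Y.jac μ a * Y.jacInv a ν = if μ = ν then 1 else 0 := by
  classical
  have := Y.pd_subst μ (Y.symm.subst ((baseDom U).coord ν))
  rw [subst_symm, pd_coord] at this
  simp only [jacInv, ← this]
  congr

/-- The preceding identity for the inverse change of coordinates, pulled back to `U`. -/
theorem jacInv_jac (a b : Fin n) :
    ∑ μ, Y.jacInv a μ * Y.jac μ b = if a = b then 1 else 0 := by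
  have := congrArg Y.subst (Y.symm.jac_jacInv a b)
  rw [map_sum] at this
  simp only [map_mul, subst_jac_symm, subst_jacInv_symm] at this
  rw [this]
  split_ifs
  · exact map_one _
  · exact map_zero _

variable {ι : Type u} {F : SuperDomain ι}

theorem bas_subst_coord (a : Fin n) :
    bas U F (Y.subst ((baseDom V).coord a)) = (jet U F).ofSmooth (Y.fn F a) := by
  have h : (baseDom V).parity a = 0 := rfl
  rw [subst, Morphism.pullback_coord_even _ h, bas, Morphism.pullback_ofSmooth]
  rfl

/-- Translates the derivatives of `Y` on the jet space into derivatives on `U` itself, where the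
chain rule is available. -/
theorem ofSmooth_deriv (m : Multiset (Fin n)) (a : Fin n) :
    (jet U F).ofSmooth (Y.deriv F m a) =
      bas U F (iter (fun μ => (baseDom U).pd μ) m (Y.subst ((baseDom V).coord a))) := by
  rw [iter_intertwine (X := bas U F) (D' := fun μ => xD U F μ) (fun μ f => (xD_bas μ f).symm),
    bas_subst_coord, deriv]
  refine iter_intertwine (X := (jet U F).ofSmooth) (fun μ f => ?_) _ _
  exact (pd_even_tmul (M := jet U F) (i := .base μ) rfl f 1).symm

theorem ofSmooth_deriv_zero (a : Fin n) :
    (jet U F).ofSmooth (Y.deriv F 0 a) = bas U F (Y.subst ((baseDom V).coord a)) := by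
  rw [ofSmooth_deriv, iter_zero]

theorem ofSmooth_deriv_single (μ a : Fin n) :
    (jet U F).ofSmooth (Y.deriv F {μ} a) = bas U F (Y.jac μ a) := by
  rw [ofSmooth_deriv, ← Multiset.cons_zero, iter_cons pd_base_comm, iter_zero]; rfl

/-! ### Transformed derivations -/

/-- The operators `∑_μ (∂x^μ/∂y^a) X_μ`. -/
noncomputable def lower (F : SuperDomain ι) (X : Fin n → (jet U F).LocalFn → (jet U F).LocalFn)
    (a : Fin n) (f : (jet U F).LocalFn) : (jet U F).LocalFn :=
  ∑ μ, bas U F (Y.jacInv a μ) * X μ f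

/-- The operators `∑_μ (∂Y^a/∂x^μ) X^μ`. -/
noncomputable def raise (F : SuperDomain ι) (X : Fin n → (jet U F).LocalFn → (jet U F).LocalFn)
    (a : Fin n) (f : (jet U F).LocalFn) : (jet U F).LocalFn :=
  ∑ μ, bas U F (Y.jac μ a) * X μ f

section Lower

variable {X : Fin n → (jet U F).LocalFn → (jet U F).LocalFn} {p : ZMod 2}

theorem isDer_lower (hX : ∀ μ, IsDer (AlgHom.id ℝ _) p (X μ)) (a : Fin n) :
    IsDer (AlgHom.id ℝ _) p (Y.lower F X a) :=
  IsDer.fun_sum _ isGeo_id fun μ _ => (hX μ).fun_mul (hasParity_bas _)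

theorem isDer_raise (hX : ∀ μ, IsDer (AlgHom.id ℝ _) p (X μ)) (a : Fin n) :
    IsDer (AlgHom.id ℝ _) p (Y.raise F X a) :=
  IsDer.fun_sum _ isGeo_id fun μ _ => (hX μ).fun_mul (hasParity_bas _)

theorem sum_jac_lower (μ : Fin n) (f : (jet U F).LocalFn) :
    ∑ a, bas U F (Y.jac μ a) * Y.lower F X a f = X μ f := by
  simp only [lower, Finset.mul_sum, ← mul_assoc, ← map_mul]
  rw [Finset.sum_comm]
  simp only [← Finset.sum_mul, ← map_sum, jac_jacInv]
  rw [Finset.sum_eq_single μ]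
  · rw [if_pos rfl, map_one, one_mul]
  · intro b _ hb; rw [if_neg hb.symm, map_zero, zero_mul]
  · intro h; exact absurd (Finset.mem_univ _) h

theorem lower_base_zero (hX : ∀ μ ν, X μ ((jet U F).coord (.base ν)) = 0) (a ν : Fin n) :
    Y.lower F X a ((jet U F).coord (.base ν)) = 0 := by
  simp only [lower, hX, mul_zero, Finset.sum_const_zero]

end Lower

/-- On functions of space-time alone, the lowered derivative is `∂/∂y^a`: the chain rule produces a
Jacobi matrix, which the inverse matrix cancels. -/
theorem lower_bas_subst {X : Fin n → (jet U F).LocalFn → (jet U F).LocalFn}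
    (hX : ∀ μ f, X μ (bas U F f) = bas U F ((baseDom U).pd μ f)) (a : Fin n)
    (f : (baseDom V).LocalFn) :
    Y.lower F X a (bas U F (Y.subst f)) = bas U F (Y.subst ((baseDom V).pd a f)) := by
  simp only [lower, hX, pd_subst, map_sum, Finset.mul_sum, ← mul_assoc, ← map_mul]
  rw [Finset.sum_comm]
  simp only [← Finset.sum_mul, ← map_sum, jacInv_jac]
  rw [Finset.sum_eq_single a]
  · rw [if_pos rfl, one_mul]
  · intro b _ hb; rw [if_neg hb.symm, zero_mul]
  · intro h; exact absurd (Finset.mem_univ _) h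

theorem lower_bas_jacInv {X : Fin n → (jet U F).LocalFn → (jet U F).LocalFn}
    (hX : ∀ μ f, X μ (bas U F f) = bas U F ((baseDom U).pd μ f)) (a b μ : Fin n) :
    Y.lower F X a (bas U F (Y.jacInv b μ)) = bas U F (Y.hessInv a b μ) :=
  Y.lower_bas_subst hX a _

/-- The derivatives along the coordinates `y` of operators with a lower index. -/
theorem lower_lower {X Z : Fin n → (jet U F).LocalFn → (jet U F).LocalFn}
    (hX : ∀ μ, IsDer (AlgHom.id ℝ _) 0 (X μ))
    (hXb : ∀ μ f, X μ (bas U F f) = bas U F ((baseDom U).pd μ f))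
    (a b : Fin n) (f : (jet U F).LocalFn) :
    Y.lower F X a (Y.lower F Z b f) = ∑ ν, bas U F (Y.hessInv a b ν) * Z ν f +
      ∑ ν, ∑ μ, bas U F (Y.jacInv b ν) * (bas U F (Y.jacInv a μ) * X μ (Z ν f)) := by
  conv_lhs => rw [lower.eq_1 Y F Z, (Y.isDer_lower hX a).sum]
  rw [← Finset.sum_add_distrib]
  refine Finset.sum_congr rfl fun ν _ => ?_
  rw [(Y.isDer_lower hX a).even_leibniz, lower_bas_jacInv Y hXb, AlgHom.id_apply, AlgHom.id_apply,
    lower, Finset.mul_sum]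

/-- Differentiating the inverse Jacobi matrix gives second derivatives of `x(y)`, which are
symmetric; the remaining terms are symmetric because total derivatives commute. -/
theorem lower_totalD_comm (a b : Fin n) (f : (jet U F).LocalFn) :
    Y.lower F (totalD U F) a (Y.lower F (totalD U F) b f) =
      Y.lower F (totalD U F) b (Y.lower F (totalD U F) a f) := by
  rw [lower_lower Y isDer_totalD totalD_bas, lower_lower Y isDer_totalD totalD_bas,
    Finset.sum_comm]
  congr 1
  · simp only [Y.hessInv_comm a b]
  · refine Finset.sum_congr rfl fun μ _ => Finset.sum_congr rfl fun ν _ => ?_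
    rw [← mul_assoc, ← mul_assoc, (hasParity_bas (Y.jacInv b ν)).comm, totalD_comm]

theorem lower_thetaD_base (a ν : Fin n) : Y.lower (superfield n F) (thetaD U F) a
    ((jet U (superfield n F)).coord (.base ν)) = 0 :=
  Y.lower_base_zero thetaD_base a ν

/-- Operators `X_μ` that are derivatives along `x^μ` and commute with `∂/∂θ^ν`. -/
theorem lower_lower_thetaD
    {X : Fin n → (jet U (superfield n F)).LocalFn → (jet U (superfield n F)).LocalFn}
    (hX : ∀ μ, IsDer (AlgHom.id ℝ _) 0 (X μ))
    (hXb : ∀ μ f, X μ (bas U _ f) = bas U _ ((baseDom U).pd μ f))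
    (hXt : ∀ ν μ f, thetaD U F ν (X μ f) = X μ (thetaD U F ν f))
    (a b : Fin n) (f : (jet U (superfield n F)).LocalFn) :
    Y.lower _ X a (Y.lower _ (thetaD U F) b f) =
      ∑ ν, bas U _ (Y.hessInv a b ν) * thetaD U F ν f +
        Y.lower _ (thetaD U F) b (Y.lower _ X a f) := by
  rw [lower_lower Y hX hXb]
  congr 1
  conv_rhs => rw [lower]
  refine Finset.sum_congr rfl fun ν _ => ?_
  rw [lower, (isDer_thetaD ν).sum, Finset.mul_sum]
  refine Finset.sum_congr rfl fun μ _ => ?_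
  rw [(isDer_thetaD ν).bas_mul (thetaD_base ν), hXt]

theorem thetaD_lower_thetaD (ν b : Fin n) (f : (jet U (superfield n F)).LocalFn) :
    thetaD U F ν (Y.lower _ (thetaD U F) b f) = -Y.lower _ (thetaD U F) b (thetaD U F ν f) := by
  simp only [lower, (isDer_thetaD ν).sum, (isDer_thetaD ν).bas_mul (thetaD_base ν),
    thetaD_anticomm ν, mul_neg, Finset.sum_neg_distrib]

/-- No Hessian appears here, as `∂/∂θ` annihilates the coefficients. -/
theorem lower_thetaD_anticomm (a b : Fin n) (f : (jet U (superfield n F)).LocalFn) :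
    Y.lower _ (thetaD U F) a (Y.lower _ (thetaD U F) b f) =
      -Y.lower _ (thetaD U F) b (Y.lower _ (thetaD U F) a f) := by
  conv_lhs => rw [lower]
  simp only [thetaD_lower_thetaD]
  conv_rhs => rw [lower.eq_1 Y _ _ a]
  rw [(Y.isDer_lower isDer_thetaD b).sum, ← Finset.sum_neg_distrib]
  refine Finset.sum_congr rfl fun μ _ => ?_
  rw [(Y.isDer_lower isDer_thetaD b).bas_mul (Y.lower_thetaD_base b), mul_neg]

theorem lower_totalD_mem_linForms (a : Fin n) {f : (jet U F).LocalFn} (hf : f ∈ linForms U F) :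
    Y.lower F (totalD U F) a f ∈ linForms U F :=
  Submodule.sum_mem _ fun μ _ => bas_mul_mem_linForms _ <|
    (isDer_totalD μ).mem_linForms (fun c => ⟨_, totalD_bas μ c⟩)
      (fun t m => by rw [totalD_field]; exact coord_mem_linForms _ _) hf

theorem lower_thetaD_mem_linForms (a : Fin n) {f : (jet U (superfield n F)).LocalFn}
    (hf : f ∈ linForms U (superfield n F)) :
    Y.lower _ (thetaD U F) a f ∈ linForms U (superfield n F) :=
  Submodule.sum_mem _ fun μ _ => bas_mul_mem_linForms _ <|
    (isDer_thetaD μ).mem_linForms (fun c => ⟨0, by rw [thetaD_bas, map_zero]⟩)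
      (fun t m => by
        rw [thetaD_field]
        split_ifs
        · exact Submodule.zero_mem _
        · exact Submodule.smul_mem _ _ (coord_mem_linForms _ _)) hf

end CoordChange

namespace CoordChange

variable {n : ℕ} {U V : TopologicalSpace.Opens (Fin n → ℝ)} (Y : CoordChange U V)
  {ι : Type u} {F : SuperDomain ι}

/-! ### The transformation of the fields -/

/-- The components `Ψ^t_{[ν]}` with respect to the coordinates `y = Y(x)`, up to a sign. -/
noncomputable def component (F : SuperDomain ι) (t : ι) (N : Finset (Fin n)) :
    (jet U (superfield n F)).LocalFn :=
  iterSkew (Y.lower _ (thetaD U F)) N ((jet U (superfield n F)).coord (.field (t, ∅) 0))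

/-- The coordinates of the jet space over `V` expressed through those of the jet space over `U`. -/
noncomputable def transformCoord (F : SuperDomain ι) :
    JetCoord n (ι × Finset (Fin n)) → (jet U (superfield n F)).LocalFn
  | .base a => bas U _ (Y.subst ((baseDom V).coord a))
  | .field (t, N) m => sgn (N.card * F.parity t) •
      iter (Y.lower _ (totalD U (superfield n F))) m (Y.component F t N)

theorem transformCoord_scalar (t : ι) : Y.transformCoord F (.field (t, ∅) 0) =
    (jet U (superfield n F)).coord (.field (t, ∅) 0) := by
  rw [transformCoord, component, iterSkew_empty, iter_zero, Finset.card_empty, Nat.cast_zero,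
    zero_mul, sgn_zero, one_smul]

theorem transformCoord_field_mem (t : ι) (N : Finset (Fin n)) (m : Multiset (Fin n)) :
    Y.transformCoord F (.field (t, N) m) ∈ linForms U (superfield n F) := by
  refine Submodule.smul_mem _ _ (iter_induction (P := fun f => f ∈ linForms U (superfield n F))
    (fun a f hf => Y.lower_totalD_mem_linForms a hf) m ?_)
  exact iterSkew_induction (P := fun _ f => f ∈ linForms U (superfield n F))
    (coord_mem_linForms _ _) (fun a N _ hf => Y.lower_thetaD_mem_linForms a hf) N

theorem hasParity_transformCoord (i : JetCoord n (ι × Finset (Fin n))) :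
    (jet U (superfield n F)).HasParity (Y.transformCoord F i)
      ((jet V (superfield n F)).parity i) := by
  match i with
  | .base a => exact hasParity_bas _
  | .field (t, N) m =>
    rw [parity_superfield, add_comm]
    refine HasParity.smul (hasParity_iter (Y.isDer_lower isDer_totalD) m ?_) _
    refine hasParity_iterSkew (Y.isDer_lower isDer_thetaD) N ?_
    have := hasParity_coord (M := jet U (superfield n F)) (.field (t, ∅) 0)
    rwa [parity_superfield, Finset.card_empty, Nat.cast_zero, add_zero] at this

/-- The images of the field coordinates are linear in the fields and of the right parity, so the
even ones contain no odd fields and can be inserted into smooth functions. The domain conditions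
concern only `Y(x)` and the scalars, which are left unchanged. -/
theorem exists_transform :
    ∃ Θ : (jet V (superfield n F)).LocalFn →ₐ[ℝ] (jet U (superfield n F)).LocalFn,
      IsGeo Θ ∧ ∀ i, Θ ((jet V (superfield n F)).coord i) = Y.transformCoord F i := by
  refine exists_hom _ (fun i hi => ?_) (fun i hi => ?_) (fun p => ⟨?_, ?_⟩)
  · match i with
    | .base a => exact ofSmooth_body_bas _
    | .field (t, N) m =>
      exact ofSmooth_body_of_mem_linForms (Y.transformCoord_field_mem t N m)
        (hi ▸ Y.hasParity_transformCoord (F := F) (.field (t, N) m))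
  · rw [← (zmod_cases _).resolve_left hi]; exact Y.hasParity_transformCoord i
  · have := Y.mapsTo p.2.1
    simp only [transformCoord, bas_subst_coord, body_ofSmooth]
    exact this
  · have h : ∀ e : F.Even, (jet U (superfield n F)).parity (.field (e.1, ∅) 0) = 0 := fun e => by
      rw [parity_superfield, e.2, Finset.card_empty, Nat.cast_zero, zero_add]
    change (fun e : F.Even => (body _ (Y.transformCoord F (.field (e.1, ∅) 0))).1 p) ∈ F.dom
    have h2 : ∀ e : F.Even, body _ (Y.transformCoord F (.field (e.1, ∅) 0)) =
        (jet U (superfield n F)).proj ⟨_, h e⟩ := fun e => by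
      rw [transformCoord_scalar, coord_even (h e), body_ofSmooth]
    simp only [h2]
    exact p.2.2

/-- The fields over `V` expressed through the fields over `U`. -/
noncomputable def transform (F : SuperDomain ι) :
    (jet V (superfield n F)).LocalFn →ₐ[ℝ] (jet U (superfield n F)).LocalFn :=
  (Y.exists_transform (F := F)).choose

theorem isGeo_transform : IsGeo (Y.transform F) := (Y.exists_transform (F := F)).choose_spec.1

theorem transform_base (a : Fin n) : Y.transform F ((jet V (superfield n F)).coord (.base a)) =
    bas U _ (Y.subst ((baseDom V).coord a)) :=
  (Y.exists_transform (F := F)).choose_spec.2 _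

theorem transform_field (t : ι) (N : Finset (Fin n)) (m : Multiset (Fin n)) :
    Y.transform F ((jet V (superfield n F)).coord (.field (t, N) m)) = sgn (N.card * F.parity t) •
      iter (Y.lower _ (totalD U (superfield n F))) m (Y.component F t N) :=
  (Y.exists_transform (F := F)).choose_spec.2 _

theorem transform_scalar (t : ι) :
    Y.transform F ((jet V (superfield n F)).coord (.field (t, ∅) 0)) =
      (jet U (superfield n F)).coord (.field (t, ∅) 0) :=
  ((Y.exists_transform (F := F)).choose_spec.2 _).trans (Y.transformCoord_scalar t)

theorem transform_bas (f : (baseDom V).LocalFn) :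
    Y.transform F (bas V _ f) = bas U _ (Y.subst f) :=
  DFunLike.congr_fun ((Y.isGeo_transform.comp isGeo_bas).ext (isGeo_bas.comp Y.isGeo_subst)
    fun i => by rw [AlgHom.comp_apply, AlgHom.comp_apply, bas_coord, transform_base]) f

theorem transform_totalD (a : Fin n) (f : (jet V (superfield n F)).LocalFn) :
    Y.transform F (totalD V _ a f) = Y.lower _ (totalD U _) a (Y.transform F f) := by
  refine (isDer_totalD a).intertwine (Y.isDer_lower isDer_totalD a) Y.isGeo_transform
    (fun i => ?_) f
  match i with
  | .base b =>
    classical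
    rw [totalD_base, transform_base, Y.lower_bas_subst totalD_bas, pd_coord]
    by_cases h : b = a
    · rw [if_pos h, if_pos h.symm, map_one, map_one, map_one]
    · rw [if_neg h, if_neg (Ne.symm h), map_zero, map_zero, map_zero]
  | .field (t, N) m =>
    rw [totalD_field, transform_field, transform_field, (Y.isDer_lower isDer_totalD a).smul,
      iter_cons Y.lower_totalD_comm]

theorem lower_thetaD_component (a : Fin n) (t : ι) (N : Finset (Fin n)) :
    Y.lower _ (thetaD U F) a (Y.component F t N) =
      if a ∈ N then 0 else insSign a N • Y.component F t (insert a N) :=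
  iterSkew_step (fun a => (Y.isDer_lower isDer_thetaD a).smul) Y.lower_thetaD_anticomm a N _

/-- Restricted to undifferentiated fields for a genuine reason: on derivatives of fields the
commutator of the lowered total and `θ`-derivatives would contribute a Hessian term. -/
theorem transform_thetaD (a : Fin n) {f : (jet V (superfield n F)).LocalFn}
    (hf : (undiff V (superfield n F)).pullback f = f) :
    Y.transform F (thetaD V F a f) = Y.lower _ (thetaD U F) a (Y.transform F f) := by
  refine ((isDer_thetaD a).left Y.isGeo_transform).ext_undiff
    ((Y.isDer_lower isDer_thetaD a).right Y.isGeo_transform) (fun μ => ?_) (fun i => ?_) hf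
  · rw [thetaD_base, map_zero, transform_base, eq_zero_bas (Y.isDer_lower isDer_thetaD a)
      (Y.lower_thetaD_base a)]
  · obtain ⟨t, N⟩ := i
    rw [thetaD_field, transform_field, (Y.isDer_lower isDer_thetaD a).smul, iter_zero,
      lower_thetaD_component]
    split_ifs with h
    · rw [map_zero, smul_zero]
    · rw [map_smul, transform_field, smul_smul, smul_smul, iter_zero,
        Finset.card_insert_of_notMem h]
      congr 1
      push_cast
      rw [add_mul, one_mul, sgn_add]
      linear_combination (insSign a N * sgn (N.card * F.parity t)) * sgn_mul_self (F.parity t)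

theorem undiff_lower_thetaD (a : Fin n) (f : (jet U (superfield n F)).LocalFn) :
    (undiff U (superfield n F)).pullback (Y.lower _ (thetaD U F) a f) =
      Y.lower _ (thetaD U F) a ((undiff U (superfield n F)).pullback f) := by
  simp only [lower, map_sum, map_mul, undiff_bas, undiff_thetaD]

/-- The transformation lowers an index with the inverse Jacobi matrix, and lowering over `V` with
respect to the inverse change contributes the Jacobi matrix; the two cancel. -/
theorem transform_lower_symm
    {X : Fin n → (jet V (superfield n F)).LocalFn → (jet V (superfield n F)).LocalFn}
    {X' : Fin n → (jet U (superfield n F)).LocalFn → (jet U (superfield n F)).LocalFn}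
    {f : (jet V (superfield n F)).LocalFn}
    (h : ∀ a, Y.transform F (X a f) = Y.lower _ X' a (Y.transform F f)) (μ : Fin n) :
    Y.transform F (Y.symm.lower _ X μ f) = X' μ (Y.transform F f) := by
  simp only [lower.eq_1 Y.symm, map_sum, map_mul, transform_bas, subst_jacInv_symm, h]
  exact Y.sum_jac_lower μ _

/-- A field coordinate over `U` is, up to sign, a string of total and `θ`-derivatives of a scalar.
The inverse transformation replaces these operators by lowered ones over `V`, and the transformation
takes them back one at a time to the original operators. -/
theorem transform_transform_symm (f : (jet U (superfield n F)).LocalFn) :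
    Y.transform F (Y.symm.transform F f) = f := by
  refine DFunLike.congr_fun ((Y.isGeo_transform.comp Y.symm.isGeo_transform).ext isGeo_id
    fun i => ?_) f
  rw [AlgHom.comp_apply, AlgHom.id_apply]
  match i with
  | .base μ => rw [transform_base, transform_bas, subst_symm, bas_coord]
  | .field (t, N) m =>
    rw [transform_field, map_smul, iter_intertwine (X := Y.transform F)
      (D' := totalD U (superfield n F))
      (fun μ f => Y.transform_lower_symm (fun a => Y.transform_totalD a f) μ), component,
      iterSkew_map (X := Y.transform F) (D' := thetaD U F)
        -- The `θ`-derivatives are innermost in the string, so they act on undifferentiated fields,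
        -- where `transform_thetaD` applies.
        (P := fun f => (undiff V (superfield n F)).pullback f = f)
        (fun a f hf => by rw [undiff_lower_thetaD, hf])
        (fun μ f hf => Y.transform_lower_symm (fun a => Y.transform_thetaD a hf) μ) N
        (by rw [undiff_field, if_pos rfl]), transform_scalar,
      iterSkew_intertwine (D' := thetaD U F) (X := iter (totalD U (superfield n F)) m),
      iter_totalD_coord, ← coord_eq_iterSkew]
    exact fun ν f => (iter_intertwine (fun μ f => thetaD_totalD ν μ f) m f).symm

/-- The transformation of the fields is invertible. -/
noncomputable def transformEquiv (F : SuperDomain ι) :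
    (jet V (superfield n F)).LocalFn ≃ₐ[ℝ] (jet U (superfield n F)).LocalFn :=
  AlgEquiv.ofAlgHom (Y.transform F) (Y.symm.transform F)
    (AlgHom.ext Y.transform_transform_symm) (AlgHom.ext Y.symm.transform_transform_symm)

theorem transformEquiv_apply (f : (jet V (superfield n F)).LocalFn) :
    Y.transformEquiv F f = Y.transform F f := rfl

theorem isFieldTransformation_transformEquiv :
    Y.IsFieldTransformation (Y.transformEquiv F) where
  base a := by rw [transformEquiv_apply, transform_base, ofSmooth_deriv_zero]
  scalar t := Y.transform_scalar t
  tensor ν t N := by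
    simp only [transformEquiv_apply, ofSmooth_deriv_single,
      Y.transform_thetaD _ ((undiff_field (U := V) (F := superfield n F) (t, N) 0).trans
        (if_pos rfl)), sum_jac_lower]
  totalD μ f := by
    simp only [transformEquiv_apply, ofSmooth_deriv_single, transform_totalD, sum_jac_lower]

/-! ### The exterior derivative is independent of the coordinates -/

/-- Contractions are raised with the Jacobi matrix and `θ`-derivatives lowered with its inverse, so
their pairing is again the Kronecker symbol times the Euler field. -/
theorem raise_contr_thetaD (a b : Fin n) (f : (jet U (superfield n F)).LocalFn) :
    Y.raise _ (contr U F) a (Y.lower _ (thetaD U F) b f) =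
      (if a = b then euler U _ f else 0) -
        Y.lower _ (thetaD U F) b (Y.raise _ (contr U F) a f) := by
  have h1 : ∀ ρ, contr U F ρ (Y.lower _ (thetaD U F) b f) =
      bas U _ (Y.jacInv b ρ) * euler U _ f - Y.lower _ (thetaD U F) b (contr U F ρ f) := by
    intro ρ
    simp only [lower, (isDer_contr ρ).sum, (isDer_contr ρ).bas_mul (contr_base ρ), contr_thetaD,
      mul_sub, Finset.sum_sub_distrib, mul_ite, mul_zero]
    rw [Finset.sum_ite_eq' Finset.univ ρ, if_pos (Finset.mem_univ _)]
  simp only [raise, h1, mul_sub, Finset.sum_sub_distrib, (Y.isDer_lower isDer_thetaD b).sum,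
    (Y.isDer_lower isDer_thetaD b).bas_mul (Y.lower_thetaD_base b), ← mul_assoc, ← map_mul]
  rw [← Finset.sum_mul, ← map_sum]
  congr 1
  have := Y.jacInv_jac b a
  simp only [fun μ => (hasParity_base (Y.jac μ a)).comm (Y.jacInv b μ), this]
  by_cases h : a = b
  · rw [if_pos h, if_pos h.symm, map_one, one_mul]
  · rw [if_neg h, if_neg (Ne.symm h), map_zero, zero_mul]

/-- The change of the components under the motion along `y^b`. -/
noncomputable def drift (F : SuperDomain ι) (b : Fin n) (f : (jet U (superfield n F)).LocalFn) :
    (jet U (superfield n F)).LocalFn :=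
  ∑ a, ∑ ν, bas U _ (Y.hessInv b a ν) * thetaD U F ν (Y.raise _ (contr U F) a f)

theorem drift_lower_thetaD (b c : Fin n) (f : (jet U (superfield n F)).LocalFn) :
    Y.drift F b (Y.lower _ (thetaD U F) c f) =
      ∑ ν, bas U _ (Y.hessInv b c ν) * thetaD U F ν (euler U _ f) +
        Y.lower _ (thetaD U F) c (Y.drift F b f) := by
  simp only [drift, raise_contr_thetaD, (isDer_thetaD _).sub, thetaD_lower_thetaD, sub_neg_eq_add,
    mul_add, Finset.sum_add_distrib,
    (Y.isDer_lower isDer_thetaD c).sum,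
    (Y.isDer_lower isDer_thetaD c).bas_mul (Y.lower_thetaD_base c)]
  congr 1
  rw [Finset.sum_eq_single c]
  · simp only [if_true]
  · intro a _ ha; simp only [if_neg ha, (isDer_thetaD _).zero, mul_zero, Finset.sum_const_zero]
  · intro h; exact absurd (Finset.mem_univ _) h

theorem contr_scalar (a : Fin n) (t : ι) (m : Multiset (Fin n)) :
    contr U F a ((jet U (superfield n F)).coord (.field (t, ∅) m)) = 0 := by
  rw [contr_field, Finset.sum_empty]

theorem euler_component (t : ι) (N : Finset (Fin n)) :
    euler U _ (Y.component F t N) = Y.component F t N := by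
  have h : ∀ b f, euler U _ (Y.lower _ (thetaD U F) b f) =
      Y.lower _ (thetaD U F) b (euler U _ f) := fun b f => by
    simp only [lower, isDer_euler.sum, isDer_euler.bas_mul euler_base, euler_thetaD]
  rw [component, iterSkew_intertwine h, euler_field]

/-- The components over `V` depend on `x` explicitly only through the inverse Jacobi matrices, so
their explicit derivative is a Hessian acting on one skew index at a time. Both sides vanish on
scalars and acquire the same Hessian term when a lowered `θ`-derivative is applied. -/
theorem drift_component (b : Fin n) (t : ι) (N : Finset (Fin n)) :
    Y.drift F b (Y.component F t N) =
      Y.lower _ (fun μ => xD U (superfield n F) μ) b (Y.component F t N) := by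
  have key := iterSkew_induction (D := Y.lower _ (thetaD U F))
    (f := (jet U (superfield n F)).coord (.field (t, ∅) 0))
    (P := fun _ f => euler U _ f = f ∧
      Y.drift F b f = Y.lower _ (fun μ => xD U (superfield n F) μ) b f) ⟨?_, ?_⟩ ?_ N
  · exact key.2
  · exact euler_field _ _
  · simp only [drift, lower, raise, contr_scalar, xD_field, mul_zero, Finset.sum_const_zero,
      (isDer_thetaD _).zero]
  · rintro c N - ⟨h1, h2⟩
    constructor
    · simp only [lower, isDer_euler.sum, isDer_euler.bas_mul euler_base, euler_thetaD]
      rw [h1]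
    · rw [drift_lower_thetaD, h1, h2, Y.lower_lower_thetaD isDer_xD xD_bas thetaD_xD]

/-- Induction on the skew indices. Commuting `d^F` past a lowered `θ`-derivative leaves a total
derivative minus the explicit derivative; on the right the same total derivative appears, minus
Hessian terms. Their sum is the drift, which equals the explicit derivative by `drift_component`. -/
theorem dF_component (t : ι) (N : Finset (Fin n)) :
    dF U F (Y.component F t N) = ∑ a, Y.lower _ (totalD U (superfield n F)) a
      (Y.raise _ (contr U F) a (Y.component F t N)) := by
  induction N using Finset.induction_on_min with
  | empty =>
    rw [component, iterSkew_empty, dF_field, Finset.sum_empty]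
    simp only [raise, contr_scalar, mul_zero, Finset.sum_const_zero,
      (Y.isDer_lower isDer_totalD _).zero]
  | insert b N hb ih =>
    have e : Y.component F t (insert b N) = Y.lower _ (thetaD U F) b (Y.component F t N) :=
      iterSkew_insert_min _ hb _
    have e1 : dF U F (Y.lower _ (thetaD U F) b (Y.component F t N)) =
        Y.lower _ (totalD U _) b (Y.component F t N) -
          Y.lower _ (fun μ => xD U (superfield n F) μ) b (Y.component F t N) -
          Y.lower _ (thetaD U F) b (dF U F (Y.component F t N)) := by
      simp only [lower, isDer_dF.sum, isDer_dF.bas_mul dF_base, dF_thetaD, mul_sub,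
        Finset.sum_sub_distrib]
    have e2 : ∀ a, Y.lower _ (totalD U (superfield n F)) a
        (Y.raise _ (contr U F) a (Y.component F t (insert b N))) =
        (if a = b then Y.lower _ (totalD U _) b (Y.component F t N) else 0) -
          (∑ ν, bas U _ (Y.hessInv b a ν) *
            thetaD U F ν (Y.raise _ (contr U F) a (Y.component F t N)) +
          Y.lower _ (thetaD U F) b (Y.lower _ (totalD U _) a
            (Y.raise _ (contr U F) a (Y.component F t N)))) := by
      intro a
      rw [e, raise_contr_thetaD, (Y.isDer_lower isDer_totalD a).sub, euler_component,
        Y.lower_lower_thetaD isDer_totalD totalD_bas thetaD_totalD]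
      simp only [Y.hessInv_comm a b]
      congr 1
      split_ifs with h
      · rw [h]
      · exact (Y.isDer_lower isDer_totalD a).zero
    simp only [e2, Finset.sum_sub_distrib, Finset.sum_add_distrib]
    rw [e, e1, ih, (Y.isDer_lower isDer_thetaD b).sum, ← drift_component, drift,
      Finset.sum_ite_eq' Finset.univ b, if_pos (Finset.mem_univ _), sub_sub]

theorem undiff_contr (a : Fin n) (f : (jet U (superfield n F)).LocalFn) :
    (undiff U (superfield n F)).pullback (contr U F a f) =
      contr U F a ((undiff U (superfield n F)).pullback f) := by
  refine (isDer_contr a).intertwine (isDer_contr a) (Morphism.isGeo_pullback _) (fun i => ?_) f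
  match i with
  | .base ρ => rw [contr_base, map_zero, undiff_base, contr_base]
  | .field (t, N) m =>
    rw [contr_field, undiff_field, map_sum]
    by_cases hm : m = 0
    · rw [if_pos hm, contr_field]
      refine Finset.sum_congr rfl fun ν _ => ?_
      rw [map_smul]
      congr 1
      split_ifs
      · rw [undiff_field, if_pos hm]
      · exact map_zero _
    · rw [if_neg hm, (isDer_contr _).zero]
      refine Finset.sum_eq_zero fun ν _ => ?_
      rw [map_smul]
      split_ifs
      · rw [undiff_field, if_neg hm, smul_zero]
      · rw [map_zero, smul_zero]

/-- Contractions are characterized by vanishing on scalars and by their anticommutator with `∂/∂θ`.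
The transformed contraction and the raised one have both properties in common on undifferentiated
fields. -/
theorem transform_contr (a : Fin n) (t : ι) (N : Finset (Fin n)) :
    Y.transform F (contr V F a ((jet V (superfield n F)).coord (.field (t, N) 0))) =
      Y.raise _ (contr U F) a (Y.transform F ((jet V (superfield n F)).coord (.field (t, N) 0))) := by
  have key := iterSkew_induction (D := thetaD V F)
    (f := (jet V (superfield n F)).coord (.field (t, ∅) 0))
    (P := fun N f => (undiff V (superfield n F)).pullback f = f ∧ euler V _ f = f ∧
      Y.transform F f = Y.component F t N ∧
      Y.transform F (contr V F a f) = Y.raise _ (contr U F) a (Y.component F t N)) ?_ ?_ N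
  · obtain ⟨-, -, h3, h4⟩ := key
    rw [coord_eq_iterSkew, (isDer_contr a).smul, map_smul, map_smul, h3, h4,
      (Y.isDer_raise isDer_contr a).smul]
  · refine ⟨by rw [undiff_field, if_pos rfl], euler_field _ _, ?_, ?_⟩
    · rw [transform_scalar, component, iterSkew_empty]
    · simp only [component, iterSkew_empty, raise, contr_scalar, map_zero, mul_zero,
        Finset.sum_const_zero]
  · rintro b N hb ⟨h1, h2, h3, h4⟩
    have e : Y.component F t (insert b N) = Y.lower _ (thetaD U F) b (Y.component F t N) :=
      iterSkew_insert_min _ hb _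
    refine ⟨by rw [undiff_thetaD, h1], by rw [euler_thetaD, h2], ?_, ?_⟩
    · rw [Y.transform_thetaD b h1, h3, e]
    · rw [contr_thetaD, h2, map_sub, Y.transform_thetaD b (by rw [undiff_contr, h1]), h4, e,
        raise_contr_thetaD, euler_component]
      congr 1
      by_cases h : b = a
      · rw [if_pos h, if_pos h.symm, h3]
      · rw [if_neg h, if_neg (Ne.symm h), map_zero]

/-- The exterior derivative is independent of the choice of the coordinates. -/
theorem dF_transform (t : ι) (N : Finset (Fin n)) :
    dF U F (Y.transform F ((jet V (superfield n F)).coord (.field (t, N) 0))) =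
      Y.transform F (dF V F ((jet V (superfield n F)).coord (.field (t, N) 0))) := by
  rw [dF_eq_sum_contr, map_sum]
  simp only [transform_totalD, transform_contr]
  simp only [transform_field, iter_zero, isDer_dF.smul, dF_component,
    (Y.isDer_raise isDer_contr _).smul, (Y.isDer_lower isDer_totalD _).smul, Finset.smul_sum]

end CoordChange

/-! ### The differential of the parametrized parent formulation -/

section Aksz

variable {n : ℕ} {U V : TopologicalSpace.Opens (Fin n → ℝ)} {ι : Type u} {F : SuperDomain ι}

theorem fromTarget_coord (i : ι) :
    fromTarget U F (F.coord i) = (jet U (superfield n F)).coord (.field (i, ∅) 0) :=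
  Morphism.rename_coord i

theorem isGeo_fromTarget : IsGeo (fromTarget U F) := Morphism.isGeo_pullback _

theorem toExt_base (a : Fin n) :
    toExt V F ((jet V F).coord (.base a)) = (extJet V F).coord (.y a) :=
  Morphism.rename_coord _

theorem toExt_field (A : ι) (l : Multiset (Fin n)) :
    toExt V F ((jet V F).coord (.field A l)) = (extJet V F).coord (.psi A l) :=
  Morphism.rename_coord _

theorem isGeo_toExt : IsGeo (toExt V F) := Morphism.isGeo_pullback _

variable (T : GaugeTheory n V ι)

theorem GaugeTheory.hasParity_sTilde (k : ExtCoord n ι) :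
    (extJet V T.fields).HasParity (T.sTilde k) ((extJet V T.fields).parity k + 1) := by
  match k with
  | .y a =>
    have := hasParity_coord (M := extJet V T.fields) (.xi a)
    change HasParity _ _ (0 + 1)
    rwa [zero_add]
  | .xi a => exact hasParity_zero _
  | .psi A l =>
    refine HasParity.add (isGeo_toExt.hasParity (hasParity_iter isDer_totalD l (T.parity_S A)))
      (HasParity.sum fun a _ => ?_)
    have := (hasParity_coord (M := extJet V T.fields) (.xi a)).mul
      (hasParity_coord (M := extJet V T.fields) (.psi A (a ::ₘ l)))
    change HasParity _ _ (T.fields.parity A + 1)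
    rw [add_comm]
    exact this

theorem GaugeTheory.hasParity_fromTarget_sTilde (k : ExtCoord n ι) :
    (paramJet U V T.fields).HasParity (fromTarget U _ (T.sTilde k))
      ((extJet V T.fields).parity k + 1) :=
  isGeo_fromTarget.hasParity (T.hasParity_sTilde k)

theorem GaugeTheory.isDer_parametrizedDifferential :
    IsDer (AlgHom.id ℝ _) 1 (T.parametrizedDifferential U) :=
  isDer_dF.fun_add (isDer_prolong T.hasParity_fromTarget_sTilde)

theorem GaugeTheory.parametrizedDifferential_base (μ : Fin n) :
    T.parametrizedDifferential U ((paramJet U V T.fields).coord (.base μ)) = 0 := by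
  rw [parametrizedDifferential, aksz, dF_base, prolong_base, add_zero]

theorem GaugeTheory.parametrizedDifferential_field (k : ExtCoord n ι) (N : Finset (Fin n))
    (m : Multiset (Fin n)) :
    T.parametrizedDifferential U ((paramJet U V T.fields).coord (.field (k, N) m)) =
      dF U _ ((paramJet U V T.fields).coord (.field (k, N) m)) +
        sgn (N.card * ((extJet V T.fields).parity k + 1)) • iterSkew (thetaD U _) N
          (iter (totalD U _) m (fromTarget U _ (T.sTilde k))) := by
  rw [parametrizedDifferential, aksz, prolong_field]

theorem GaugeTheory.parametrizedDifferential_totalD (μ : Fin n)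
    (f : (paramJet U V T.fields).LocalFn) :
    T.parametrizedDifferential U (totalD U _ μ f) =
      totalD U _ μ (T.parametrizedDifferential U f) := by
  rw [parametrizedDifferential, aksz, aksz, dF_totalD,
    prolong_totalD T.hasParity_fromTarget_sTilde, (isDer_totalD μ).add]

/-- The prolonged part anticommutes with `∂/∂θ^ν`, so the whole inhomogeneity comes from `d^F`. -/
theorem GaugeTheory.parametrizedDifferential_thetaD (ν : Fin n)
    (f : (paramJet U V T.fields).LocalFn) :
    T.parametrizedDifferential U (thetaD U _ ν f) = totalD U _ ν f - xD U _ ν f -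
      thetaD U _ ν (T.parametrizedDifferential U f) := by
  rw [parametrizedDifferential, aksz, aksz, dF_thetaD,
    prolong_thetaD T.hasParity_fromTarget_sTilde, (isDer_thetaD ν).add]
  abel

end Aksz

namespace CoordChange

variable {n : ℕ} {U V : TopologicalSpace.Opens (Fin n → ℝ)} (Y : CoordChange U V)
  {ι : Type u} (F : SuperDomain ι)

/-! ### The eliminated fields -/

theorem w_eq (a : Fin n) (N : Finset (Fin n)) :
    Y.w F (a, N) = (paramJet U V F).coord (.field (.y a, N) 0) -
      if N = ∅ then bas U _ (Y.subst ((baseDom V).coord a)) else 0 := by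
  rw [w, ofSmooth_deriv_zero]

theorem v_eq (a : Fin n) (N : Finset (Fin n)) :
    Y.v F (a, N) = (paramJet U V F).coord (.field (.xi a, N) 0) +
      ∑ ν, if N = {ν} then bas U _ (Y.jac ν a) else 0 := by
  simp only [v, ofSmooth_deriv_single]

/-- The component form of `s y = d y + ξ`. The sign in the prolongation cancels the one relating
`ξ^a_{[N]}` to iterated `θ`-derivatives of `ξ^a`, so `ξ^a_{[N]}` enters with coefficient one, and
modulo derivatives of `w` the equation `s w = 0` reads `v = 0`. -/
theorem differential_w (T : GaugeTheory n V ι) (a : Fin n) (N : Finset (Fin n)) :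
    T.parametrizedDifferential U (Y.w T.fields (a, N)) = Y.v T.fields (a, N) +
      ∑ ν ∈ N, insSign ν N • totalD U _ ν (Y.w T.fields (a, N.erase ν)) := by
  have hp : (extJet V T.fields).parity (.y a) = 0 := rfl
  have hq : (extJet V T.fields).parity (.xi a) = 1 := rfl
  have h1 : T.parametrizedDifferential U (if N = ∅ then
      bas U (superfield n (extJet V T.fields)) (Y.subst ((baseDom V).coord a)) else 0) = 0 := by
    split_ifs
    · exact eq_zero_bas T.isDer_parametrizedDifferential T.parametrizedDifferential_base _
    · exact T.isDer_parametrizedDifferential.zero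
  -- The function `Y^a(x)` is subtracted only from the component without skew indices, so it is felt
  -- only when removing `ν` empties `N`, that is for `N = {ν}`.
  have h2 : ∀ ν ∈ N, insSign ν N • totalD U _ ν (Y.w T.fields (a, N.erase ν)) =
      insSign ν N • (paramJet U V T.fields).coord (.field (.y a, N.erase ν) {ν}) -
        if N = {ν} then bas U _ (Y.jac ν a) else 0 := by
    intro ν hν
    rw [w_eq, (isDer_totalD ν).sub, totalD_field, smul_sub]
    congr 1
    by_cases h : N = {ν}
    · rw [if_pos (by rw [h]; simp), if_pos h, totalD_bas, h, insSign, Finset.filter_false_of_mem,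
        Finset.card_empty, pow_zero, one_smul]
      · rfl
      · simp
    · rw [if_neg, if_neg h, (isDer_totalD ν).zero, smul_zero]
      rw [Finset.erase_eq_empty_iff]
      rintro (h' | h')
      · rw [h'] at hν; exact absurd hν (Finset.notMem_empty ν)
      · exact h h'
  have h3 : ∑ ν ∈ N, (if N = {ν} then bas U (superfield n (extJet V T.fields)) (Y.jac ν a) else 0) =
      ∑ ν, if N = {ν} then bas U _ (Y.jac ν a) else 0 := by
    refine Finset.sum_subset (Finset.subset_univ N) fun ν _ hν => if_neg ?_
    rintro rfl
    exact hν (Finset.mem_singleton_self ν)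
  rw [w_eq, T.isDer_parametrizedDifferential.sub, h1, sub_zero, v_eq, Finset.sum_congr rfl h2,
    Finset.sum_sub_distrib, h3, T.parametrizedDifferential_field, dF_field, hp, sgn_zero, zero_add,
    iter_zero]
  simp only [one_mul, Multiset.cons_zero]
  rw [GaugeTheory.sTilde, fromTarget_coord, iterSkew_thetaD_coord, hq, smul_smul, sgn_mul_self,
    one_smul]
  abel

/-- The derivatives of `s w` and of `v` differ by combinations of derivatives of `w`, which lie in
both ideals. -/
theorem equations_ideal (T : GaugeTheory n V ι) :
    Ideal.span
      (Set.range (fun q : (Fin n × Finset (Fin n)) × Multiset (Fin n) =>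
          iter (totalD U _) q.2 (Y.w T.fields q.1)) ∪
        Set.range (fun q : (Fin n × Finset (Fin n)) × Multiset (Fin n) =>
          iter (totalD U _) q.2 (T.parametrizedDifferential U (Y.w T.fields q.1)))) =
    Ideal.span
      (Set.range (fun q : (Fin n × Finset (Fin n)) × Multiset (Fin n) =>
          iter (totalD U _) q.2 (Y.w T.fields q.1)) ∪
        Set.range (fun q : (Fin n × Finset (Fin n)) × Multiset (Fin n) =>
          iter (totalD U _) q.2 (Y.v T.fields q.1 - (0 : Fin n × Finset (Fin n) → _) q.1))) := by
  have key : ∀ a N m, iter (totalD U _) m (T.parametrizedDifferential U (Y.w T.fields (a, N))) =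
      iter (totalD U _) m (Y.v T.fields (a, N)) +
        ∑ ν ∈ N, insSign ν N • iter (totalD U _) (ν ::ₘ m) (Y.w T.fields (a, N.erase ν)) := by
    intro a N m
    have hsum : ∀ (s : Finset (Fin n)) (g : Fin n → (paramJet U V T.fields).LocalFn),
        iter (totalD U _) m (∑ ν ∈ s, g ν) = ∑ ν ∈ s, iter (totalD U _) m (g ν) := fun s g =>
      map_sum (AddMonoidHom.mk' _ (iter_add isDer_totalD m)) g s
    rw [differential_w, iter_add isDer_totalD, hsum]
    congr 1
    refine Finset.sum_congr rfl fun ν _ => ?_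
    rw [iter_smul isDer_totalD, iter_cons totalD_comm,
      iter_intertwine (X := totalD U _ ν) (fun μ f => totalD_comm ν μ f)]
  have hw : ∀ (B : Set (paramJet U V T.fields).LocalFn) (a : Fin n) (N : Finset (Fin n))
      (m : Multiset (Fin n)),
      ∑ ν ∈ N, insSign ν N • iter (totalD U _) (ν ::ₘ m) (Y.w T.fields (a, N.erase ν)) ∈
        Ideal.span (Set.range (fun q : (Fin n × Finset (Fin n)) × Multiset (Fin n) =>
          iter (totalD U _) q.2 (Y.w T.fields q.1)) ∪ B) := by
    intro B a N m
    refine Ideal.sum_mem _ fun ν _ => ?_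
    rw [Algebra.smul_def]
    exact Ideal.mul_mem_left _ _ (Ideal.subset_span (Or.inl ⟨((a, N.erase ν), ν ::ₘ m), rfl⟩))
  apply le_antisymm
  · refine Ideal.span_le.2 (Set.union_subset (fun x hx => Ideal.subset_span (Or.inl hx)) ?_)
    rintro _ ⟨⟨⟨a, N⟩, m⟩, rfl⟩
    simp only [key]
    refine Ideal.add_mem _ (Ideal.subset_span (Or.inr ⟨((a, N), m), ?_⟩)) (hw _ a N m)
    simp only [Pi.zero_apply, sub_zero]
  · refine Ideal.span_le.2 (Set.union_subset (fun x hx => Ideal.subset_span (Or.inl hx)) ?_)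
    rintro _ ⟨⟨⟨a, N⟩, m⟩, rfl⟩
    simp only [Pi.zero_apply, sub_zero]
    rw [← add_sub_cancel_right (iter (totalD U _) m (Y.v T.fields (a, N)))
      (∑ ν ∈ N, insSign ν N • iter (totalD U _) (ν ::ₘ m) (Y.w T.fields (a, N.erase ν))), ← key]
    exact Ideal.sub_mem _ (Ideal.subset_span (Or.inr ⟨((a, N), m), rfl⟩)) (hw _ a N m)

/-! ### Jet coordinates adapted to the elimination -/

/-- The field of the parametrized theory with the same indices as a given new coordinate. -/
def oldField {n : ℕ} {ι : Type u} : ((ι × Multiset (Fin n)) × Finset (Fin n)) ⊕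
    ((Fin n × Finset (Fin n)) ⊕ (Fin n × Finset (Fin n))) → ExtCoord n ι × Finset (Fin n)
  | .inl t => (.psi t.1.1 t.1.2, t.2)
  | .inr (.inl q) => (.y q.1, q.2)
  | .inr (.inr q) => (.xi q.1, q.2)

/-- The inverse of `oldField`. -/
def newField {n : ℕ} {ι : Type u} : ExtCoord n ι × Finset (Fin n) →
    ((ι × Multiset (Fin n)) × Finset (Fin n)) ⊕
      ((Fin n × Finset (Fin n)) ⊕ (Fin n × Finset (Fin n)))
  | (.psi A l, N) => .inl ((A, l), N)
  | (.y a, N) => .inr (.inl (a, N))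
  | (.xi a, N) => .inr (.inr (a, N))

theorem oldField_newField (k : ExtCoord n ι × Finset (Fin n)) : oldField (newField k) = k := by
  obtain ⟨_ | _ | _, N⟩ := k <;> rfl

theorem newField_oldField (i : ((ι × Multiset (Fin n)) × Finset (Fin n)) ⊕
    ((Fin n × Finset (Fin n)) ⊕ (Fin n × Finset (Fin n)))) : newField (oldField i) = i := by
  obtain _ | _ | _ := i <;> rfl

/-- The difference of the derivatives of the new and of the old fields. -/
noncomputable def shift : ((ι × Multiset (Fin n)) × Finset (Fin n)) ⊕
    ((Fin n × Finset (Fin n)) ⊕ (Fin n × Finset (Fin n))) → Multiset (Fin n) →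
      (baseDom U).LocalFn
  | .inl _, _ => 0
  | .inr (.inl q), m => if q.2 = ∅ then
      -iter (fun μ => (baseDom U).pd μ) m (Y.subst ((baseDom V).coord q.1)) else 0
  | .inr (.inr q), m => ∑ ν, if q.2 = {ν} then
      iter (fun μ => (baseDom U).pd μ) m (Y.jac ν q.1) else 0

/-- Every new coordinate is an old one translated by a function of `x`; this makes the coordinate
change invertible by inspection. -/
theorem iter_newField (i : ((ι × Multiset (Fin n)) × Finset (Fin n)) ⊕
    ((Fin n × Finset (Fin n)) ⊕ (Fin n × Finset (Fin n)))) (m : Multiset (Fin n)) :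
    iter (totalD U _) m (Sum.elim (phi U V F) (Sum.elim (Y.w F) (Y.v F)) i) =
      (paramJet U V F).coord (.field (oldField i) m) + bas U _ (Y.shift i m) := by
  have h0 : iter (totalD U (superfield n (extJet V F))) m 0 = 0 := by
    have := iter_smul isDer_totalD m 0 (0 : (paramJet U V F).LocalFn)
    rwa [zero_smul, zero_smul] at this
  match i with
  | .inl t =>
    simp only [Sum.elim_inl, phi, shift, oldField, map_zero, add_zero]
    exact iter_totalD_coord _ _
  | .inr (.inl (a, N)) =>
    simp only [Sum.elim_inr, Sum.elim_inl, w_eq, shift, oldField]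
    rw [sub_eq_add_neg, iter_add isDer_totalD, iter_totalD_coord, ← neg_one_smul ℝ (ite _ _ _),
      iter_smul isDer_totalD]
    congr 1
    split_ifs
    · rw [iter_totalD_bas, map_neg, neg_one_smul]
    · rw [h0, smul_zero, map_zero]
  | .inr (.inr (a, N)) =>
    simp only [Sum.elim_inr, v_eq, shift, oldField]
    have hsum : ∀ (g : Fin n → (paramJet U V F).LocalFn),
        iter (totalD U _) m (∑ ν, g ν) = ∑ ν, iter (totalD U _) m (g ν) := fun g =>
      map_sum (AddMonoidHom.mk' _ (iter_add isDer_totalD m)) g _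
    rw [iter_add isDer_totalD, iter_totalD_coord, hsum, map_sum]
    congr 1
    refine Finset.sum_congr rfl fun ν _ => ?_
    split_ifs
    · rw [iter_totalD_bas]
    · rw [h0, map_zero]

/-- Translations occur only for `y^a` and `ξ^a_ν`, which are both even of ghost number zero: for the
latter, the skew index compensates the degree of `ξ^a`. Hence the gradings are respected and odd
coordinates are never translated. -/
theorem shift_eq_zero_or (i : ((ι × Multiset (Fin n)) × Finset (Fin n)) ⊕
    ((Fin n × Finset (Fin n)) ⊕ (Fin n × Finset (Fin n)))) (m : Multiset (Fin n)) :
    Y.shift i m = 0 ∨ (superfield n (extJet V F)).parity (oldField i) = 0 ∧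
      (superfield n (extJet V F)).gh (oldField i) = 0 := by
  match i with
  | .inl t => exact Or.inl rfl
  | .inr (.inl (a, N)) =>
    by_cases h : N = ∅
    · subst h
      exact Or.inr ⟨by simp [oldField, superfield, extJet, ExtCoord.parity],
        by simp [oldField, superfield, extJet, ExtCoord.gh]⟩
    · exact Or.inl (if_neg h)
  | .inr (.inr (a, N)) =>
    by_cases h : ∃ ν, N = {ν}
    · obtain ⟨ν, rfl⟩ := h
      refine Or.inr ⟨?_, by simp [oldField, superfield, extJet, ExtCoord.gh]⟩
      simp only [oldField, superfield, extJet, ExtCoord.parity, Finset.card_singleton, Nat.cast_one]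
      exact CharTwo.add_self_eq_zero 1
    · push Not at h
      exact Or.inl (Finset.sum_eq_zero fun ν _ => if_neg (h ν))

/-- The parities of the coordinates of `newDomain`. -/
def newParity (F : SuperDomain ι) : JetCoord n (((ι × Multiset (Fin n)) × Finset (Fin n)) ⊕
    ((Fin n × Finset (Fin n)) ⊕ (Fin n × Finset (Fin n)))) → ZMod 2
  | .base _ => 0
  | .field i _ => (superfield n (extJet V F)).parity (oldField i)

/-- The superdomain with coordinates `x^μ` and the derivatives of the remaining fields and of the
fields `w`, `v`. -/
def newDomain : SuperDomain (JetCoord n (((ι × Multiset (Fin n)) × Finset (Fin n)) ⊕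
    ((Fin n × Finset (Fin n)) ⊕ (Fin n × Finset (Fin n))))) where
  parity := newParity (V := V) F
  gh
    | .base _ => 0
    | .field i _ => (superfield n (extJet V F)).gh (oldField i)
  dom := {p | ((fun μ => p ⟨.base μ, rfl⟩) ∈ U ∧
      (fun a => p ⟨.field (.inr (.inl (a, ∅))) 0, by
        simp [newParity, oldField, superfield, extJet, ExtCoord.parity]⟩ +
          Y.toFun (fun μ => p ⟨.base μ, rfl⟩) a) ∈ V) ∧
    (fun e : F.Even => p ⟨.field (.inl ((e.1, 0), ∅)) 0, by
      simpa [newParity, oldField, superfield, extJet, ExtCoord.parity] using e.2⟩) ∈ F.dom}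
  isOpen_dom := by
    refine IsOpen.inter ?_ (F.isOpen_dom.preimage (continuous_pi fun _ => continuous_apply _))
    -- `Y` is continuous only on `U`, so openness of the condition `w + Y(x) ∈ V` is obtained inside
    -- the open set where `x ∈ U`.
    refine ContinuousOn.isOpen_inter_preimage 
      (s := {p : {i // newParity (V := V) F i = 0} → ℝ | (fun μ => p ⟨.base μ, rfl⟩) ∈ U})
      (t := (V : Set (Fin n → ℝ))) ?_
      (U.isOpen.preimage (continuous_pi fun _ => continuous_apply _)) V.isOpen
    refine continuousOn_pi.2 fun a => ContinuousOn.add (continuous_apply _).continuousOn ?_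
    refine (continuousOn_pi.1 Y.contDiffOn_toFun.continuousOn a).comp
      (continuous_pi fun _ => continuous_apply _).continuousOn ?_
    exact fun p hp => hp

/-- Functions of `x` in the new coordinates. -/
noncomputable def newBase : Morphism (Y.newDomain F) (baseDom U) :=
  Morphism.rename (fun μ => .base μ) (fun _ => rfl) (fun _ hp => hp.1.1)

theorem newBase_coord (μ : Fin n) :
    (Y.newBase F).pullback ((baseDom U).coord μ) = (Y.newDomain F).coord (.base μ) :=
  Morphism.rename_coord μ

theorem ofSmooth_body_add {κ : Type v} {M : SuperDomain κ} {f g : M.LocalFn}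
    (hf : M.ofSmooth (body M f) = f) (hg : M.ofSmooth (body M g) = g) :
    M.ofSmooth (body M (f + g)) = f + g := by
  rw [map_add, ← ofSmoothHom_apply, map_add, ofSmoothHom_apply, ofSmoothHom_apply, hf, hg]

theorem body_bas_subst (a : Fin n) (p : (jet U F).dom) :
    (body _ (bas U F (Y.subst ((baseDom V).coord a)))).1 p =
      Y.toFun (fun μ => p.1 ⟨.base μ, rfl⟩) a := by
  rw [bas_subst_coord, body_ofSmooth]; rfl

theorem body_newBase_subst (a : Fin n) (p : (Y.newDomain F).dom) :
    (body _ ((Y.newBase F).pullback (Y.subst ((baseDom V).coord a)))).1 p =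
      Y.toFun (fun μ => p.1 ⟨.base μ, rfl⟩) a := by
  have h : (baseDom V).parity a = 0 := rfl
  rw [subst, Morphism.pullback_coord_even _ h, Morphism.pullback_ofSmooth, body_ofSmooth]
  rfl

/-- Only even coordinates are translated, and by functions of `x`, so the hypotheses of `exists_hom`
hold. The domain condition `w + Y(x) ∈ V` becomes `y ∈ V` after substitution. -/
theorem exists_fromNew :
    ∃ Θ : (Y.newDomain F).LocalFn →ₐ[ℝ] (paramJet U V F).LocalFn, IsGeo Θ ∧
      (∀ μ, Θ ((Y.newDomain F).coord (.base μ)) = (paramJet U V F).coord (.base μ)) ∧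
      ∀ i m, Θ ((Y.newDomain F).coord (.field i m)) =
        (paramJet U V F).coord (.field (oldField i) m) + bas U _ (Y.shift i m) := by
  refine Exists.imp (fun Θ h => ⟨h.1, fun μ => h.2 _, fun i m => h.2 _⟩) (exists_hom (N := Y.newDomain F) (M := paramJet U V F)
    (fun | .base μ => (paramJet U V F).coord (.base μ)
         | .field i m => (paramJet U V F).coord (.field (oldField i) m) + bas U _ (Y.shift i m))
    ?_ ?_ ?_)
  · rintro (μ | ⟨i, m⟩) h
    · have h' : (paramJet U V F).parity (.base μ) = 0 := rfl
      simp only [coord_even h', body_ofSmooth]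
    · have h' : (paramJet U V F).parity (.field (oldField i) m) = 0 := h
      refine ofSmooth_body_add ?_ (ofSmooth_body_bas _)
      rw [coord_even h', body_ofSmooth]
  · rintro (μ | ⟨i, m⟩) h
    · exact absurd rfl h
    · have h' : (paramJet U V F).parity (.field (oldField i) m) ≠ 0 := h
      have e : Y.shift i m = 0 := (Y.shift_eq_zero_or F i m).resolve_right fun h'' => h h''.1
      simp only [e, map_zero, add_zero]
      rw [← (zmod_cases _).resolve_left h']
      exact hasParity_coord _
  · intro p
    refine ⟨⟨?_, ?_⟩, ?_⟩
    · have h' : ∀ μ, (paramJet U V F).parity (.base μ) = 0 := fun _ => rfl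
      simp only [coord_even (h' _), body_ofSmooth]
      exact p.2.1
    · have h' : ∀ μ, (paramJet U V F).parity (.base μ) = 0 := fun _ => rfl
      have h'' : ∀ a, (paramJet U V F).parity (.field (.y a, ∅) 0) = 0 := fun a => by
        simp [jet, JetCoord.parity, superfield, extJet, ExtCoord.parity]
      simp only [shift, oldField, if_true, iter_zero, map_neg, map_add, coord_even (h' _),
        coord_even (h'' _), body_ofSmooth]
      have e : ∀ a, ((body (paramJet U V F)) ((bas U (superfield n (extJet V F)))
        (Y.subst ((baseDom V).coord a)))).1 p = Y.toFun (fun μ => p.1 ⟨.base μ, rfl⟩) a :=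
        fun a => Y.body_bas_subst _ a p
      convert p.2.2.1 using 1
      funext a
      change p.1 _ + -_ + _ = p.1 _
      rw [e a]
      exact neg_add_cancel_right _ _
    · have h' : ∀ e : F.Even, (paramJet U V F).parity (.field (.psi e.1 0, ∅) 0) = 0 := fun e => by
        simpa [jet, JetCoord.parity, superfield, extJet, ExtCoord.parity] using e.2
      simp only [shift, oldField, map_zero, add_zero, coord_even (h' _), body_ofSmooth]
      exact p.2.2.2

theorem exists_toNew :
    ∃ Θ : (paramJet U V F).LocalFn →ₐ[ℝ] (Y.newDomain F).LocalFn, IsGeo Θ ∧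
      (∀ μ, Θ ((paramJet U V F).coord (.base μ)) = (Y.newDomain F).coord (.base μ)) ∧
      ∀ k m, Θ ((paramJet U V F).coord (.field k m)) =
        (Y.newDomain F).coord (.field (newField k) m) +
          (Y.newBase F).pullback (-Y.shift (newField k) m) := by
  have hpar : ∀ k m, (Y.newDomain F).parity (.field (newField k) m) =
      (paramJet U V F).parity (.field k m) := fun k m => by
    change (superfield n (extJet V F)).parity (oldField (newField k)) = _
    rw [oldField_newField]; rfl
  refine Exists.imp (fun Θ h => ⟨h.1, fun μ => h.2 _, fun i m => h.2 _⟩) (exists_hom (N := paramJet U V F) (M := Y.newDomain F)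
    (fun | .base μ => (Y.newDomain F).coord (.base μ)
         | .field k m => (Y.newDomain F).coord (.field (newField k) m) +
            (Y.newBase F).pullback (-Y.shift (newField k) m))
    ?_ ?_ ?_)
  · rintro (μ | ⟨k, m⟩) h
    · have h' : (Y.newDomain F).parity (.base μ) = 0 := rfl
      simp only [coord_even h', body_ofSmooth]
    · have h' := (hpar k m).trans h
      refine ofSmooth_body_add ?_ (ofSmooth_body_pullback _ _)
      rw [coord_even h', body_ofSmooth]
  · rintro (μ | ⟨k, m⟩) h
    · exact absurd rfl h
    · have h' : (Y.newDomain F).parity (.field (newField k) m) ≠ 0 := by rwa [hpar]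
      have e : Y.shift (newField k) m = 0 :=
        (Y.shift_eq_zero_or F (newField k) m).resolve_right fun h'' => h' h''.1
      simp only [e, neg_zero, map_zero, add_zero]
      rw [← (zmod_cases _).resolve_left h, ← hpar]
      exact hasParity_coord _
  · intro p
    refine ⟨?_, ?_, ?_⟩
    · have h' : ∀ μ, (Y.newDomain F).parity (.base μ) = 0 := fun _ => rfl
      simp only [coord_even (h' _), body_ofSmooth]
      exact p.2.1.1
    · have h'' : ∀ a, (Y.newDomain F).parity (.field (newField (.y a, ∅)) 0) = 0 := fun a => by
        simp [newDomain, newParity, newField, oldField, superfield, extJet, ExtCoord.parity]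
      convert p.2.1.2 using 1
      funext a
      change (body _ ((Y.newDomain F).coord (.field (newField (.y a, ∅)) 0) +
        (Y.newBase F).pullback (-Y.shift (newField (ι := ι) (.y a, ∅)) 0))).1 p = _
      rw [map_add, coord_even (h'' a), body_ofSmooth]
      simp only [newField, shift, if_true, iter_zero, neg_neg]
      change p.1 _ + _ = _
      rw [Y.body_newBase_subst F a p]
      rfl
    · have h' : ∀ e : F.Even, (Y.newDomain F).parity (.field (newField (.psi e.1 0, ∅)) 0) = 0 :=
        fun e => by
          simpa [newDomain, newParity, newField, oldField, superfield, extJet, ExtCoord.parity] using e.2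
      convert p.2.2 using 1
      funext e
      change (body _ ((Y.newDomain F).coord (.field (newField (.psi e.1 0, ∅)) 0) +
        (Y.newBase F).pullback (-Y.shift (newField (ι := ι) (.psi e.1 0, ∅)) 0))).1 p = _
      rw [map_add, coord_even (h' e), body_ofSmooth]
      simp only [newField, shift, neg_zero, map_zero, add_zero]
      rfl

theorem hasGhost_coord_add_bas {F : SuperDomain ι} (i : ι) (m : Multiset (Fin n))
    {c : (baseDom U).LocalFn} (h : c = 0 ∨ F.gh i = 0) :
    (jet U F).HasGhost ((jet U F).coord (.field i m) + bas U F c) (F.gh i) := by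
  have hd : IsDer (AlgHom.id ℝ _) 0 ((jet U F).vectorField
      fun i => ((jet U F).gh i : ℝ) • (jet U F).coord i) :=
    isDer_vectorField fun i => by rw [add_zero]; exact (hasParity_coord i).smul _
  rw [HasGhost, hd.add, vectorField_coord, eq_zero_bas hd (fun μ => by
    rw [vectorField_coord]
    change ((0 : ℤ) : ℝ) • _ = _
    rw [Int.cast_zero, zero_smul]), add_zero, smul_add]
  change (F.gh i : ℝ) • _ = _
  rcases h with h | h
  · rw [h, map_zero, smul_zero, add_zero]
  · rw [h, Int.cast_zero, zero_smul, zero_smul, add_zero]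

/-- The two substitutions translate by opposite amounts and fix `x`, hence are mutually inverse on
coordinates and therefore everywhere. Independence of the solution from `w`, `v` is immediate
because the solution is zero. -/
theorem isGeneralizedAuxiliary (T : GaugeTheory n V ι) :
    IsGeneralizedAuxiliary (T.parametrizedDifferential U) (phi U V T.fields) (Y.w T.fields)
      (Y.v T.fields) 0 where
  exists_coordinates := by
    obtain ⟨Φ, hΦ, hΦb, hΦf⟩ := Y.exists_fromNew T.fields
    obtain ⟨Ψ, hΨ, hΨb, hΨf⟩ := Y.exists_toNew T.fields
    have e1 : ∀ c, Φ ((Y.newBase T.fields).pullback c) = bas U _ c := fun c =>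
      DFunLike.congr_fun ((hΦ.comp (Morphism.isGeo_pullback _)).ext isGeo_bas fun μ => by
        rw [AlgHom.comp_apply, newBase_coord, hΦb, bas_coord]) c
    have e2 : ∀ c, Ψ (bas U _ c) = (Y.newBase T.fields).pullback c := fun c =>
      DFunLike.congr_fun ((hΨ.comp isGeo_bas).ext (Morphism.isGeo_pullback _) fun μ => by
        rw [AlgHom.comp_apply, newBase_coord, bas_coord, hΨb]) c
    have h1 : Φ.comp Ψ = AlgHom.id ℝ _ := (hΦ.comp hΨ).ext isGeo_id fun i => by
      rw [AlgHom.comp_apply, AlgHom.id_apply]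
      match i with
      | .base μ => rw [hΨb, hΦb]
      | .field k m =>
        rw [hΨf, map_add, hΦf, e1, oldField_newField, map_neg, add_neg_cancel_right]
    have h2 : Ψ.comp Φ = AlgHom.id ℝ _ := (hΨ.comp hΦ).ext isGeo_id fun i => by
      rw [AlgHom.comp_apply, AlgHom.id_apply]
      match i with
      | .base μ => rw [hΦb, hΨb]
      | .field k m =>
        rw [hΦf, map_add, hΨf, e2, newField_oldField, map_neg, neg_add_cancel_right]
    refine ⟨Y.newDomain T.fields, AlgEquiv.ofAlgHom Φ Ψ h1 h2, hΦb, fun i m => ?_,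
      fun k => hΦ.hasParity (hasParity_coord k), fun k => ?_, fun c k m => ?_⟩
    · rw [iter_newField]; exact hΦf i m
    · match k with
      | .base μ =>
        change HasGhost _ (Φ _) 0
        rw [hΦb, HasGhost, vectorField_coord]; rfl
      | .field i m =>
        change HasGhost _ (Φ _) _
        rw [hΦf]
        exact hasGhost_coord_add_bas _ _ ((Y.shift_eq_zero_or T.fields i m).imp_right And.right)
    · rw [Pi.zero_apply, map_zero, map_zero]
  equations := Y.equations_ideal T

/-! ### The restriction to the surface -/

theorem surface_base (μ : Fin n) :
    (Y.surface F).pullback ((paramJet U V F).coord (.base μ)) = (parentJet U F).coord (.base μ) := by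
  have h : (paramJet U V F).parity (.base μ) = 0 := rfl
  have h' : (parentJet U F).parity (.base μ) = 0 := rfl
  rw [Morphism.pullback_coord_even _ h, coord_even h']; rfl

theorem surface_bas (c : (baseDom U).LocalFn) :
    (Y.surface F).pullback (bas U _ c) = bas U _ c :=
  DFunLike.congr_fun (((Morphism.isGeo_pullback _).comp isGeo_bas).ext isGeo_bas fun μ => by
    rw [AlgHom.comp_apply, bas_coord, surface_base, bas_coord]) c

theorem surface_psi (A : ι) (l : Multiset (Fin n)) (N : Finset (Fin n)) (m : Multiset (Fin n)) :
    (Y.surface F).pullback ((paramJet U V F).coord (.field (.psi A l, N) m)) =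
      (parentJet U F).coord (.field ((A, l), N) m) := by
  by_cases h : (paramJet U V F).parity (.field (.psi A l, N) m) = 0
  · have h' : (parentJet U F).parity (.field ((A, l), N) m) = 0 := h
    rw [Morphism.pullback_coord_even _ h, coord_even h']; rfl
  · have h' : (parentJet U F).parity (.field ((A, l), N) m) ≠ 0 := h
    rw [Morphism.pullback_coord_odd _ h, coord_odd h']; rfl

theorem surface_y (a : Fin n) (N : Finset (Fin n)) (m : Multiset (Fin n)) :
    (Y.surface F).pullback ((paramJet U V F).coord (.field (.y a, N) m)) =
      if N = ∅ then bas U _ (iter (fun μ => (baseDom U).pd μ) m (Y.subst ((baseDom V).coord a)))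
        else 0 := by
  by_cases h : (paramJet U V F).parity (.field (.y a, N) m) = 0
  · rw [Morphism.pullback_coord_even _ h, ← ofSmooth_deriv]
    simp only [surface]
    split_ifs
    · rfl
    · exact TensorProduct.zero_tmul _ _
  · rw [Morphism.pullback_coord_odd _ h, if_neg]
    · simp only [surface, map_zero, TensorProduct.tmul_zero]
    · rintro rfl
      exact h (by simp [jet, JetCoord.parity, superfield, extJet, ExtCoord.parity])

theorem surface_xi (a : Fin n) (N : Finset (Fin n)) (m : Multiset (Fin n)) :
    (Y.surface F).pullback ((paramJet U V F).coord (.field (.xi a, N) m)) =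
      -∑ ν, if N = {ν} then bas U _ (iter (fun μ => (baseDom U).pd μ) m (Y.jac ν a)) else 0 := by
  by_cases h : (paramJet U V F).parity (.field (.xi a, N) m) = 0
  · rw [Morphism.pullback_coord_even _ h]
    simp only [surface]
    rw [← ofSmoothHom_apply, map_neg, map_sum]
    congr 1
    refine Finset.sum_congr rfl fun ν _ => ?_
    split_ifs
    · rw [ofSmoothHom_apply, ofSmooth_deriv, iter_cons pd_base_comm,
        iter_intertwine (X := (baseDom U).pd ν) (fun μ f => pd_base_comm ν μ f)]
      rfl
    · exact map_zero _
  · rw [Morphism.pullback_coord_odd _ h, Finset.sum_eq_zero, neg_zero]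
    · simp only [surface, map_zero, TensorProduct.tmul_zero]
    · intro ν _
      refine if_neg ?_
      rintro rfl
      apply h
      simp only [jet, JetCoord.parity, superfield, extJet, ExtCoord.parity, Finset.card_singleton,
        Nat.cast_one]
      exact CharTwo.add_self_eq_zero 1

theorem isRestriction : IsRestriction (G := superfield n (jetFibre n F)) (phi U V F) (Y.w F)
    (Y.v F) 0 (Y.surface F).pullback where
  base μ := Y.surface_base F μ
  phi i m := by
    have := Y.iter_newField F (.inl i) m
    simp only [Sum.elim_inl, shift, map_zero, add_zero] at this
    rw [this]
    exact Y.surface_psi F _ _ _ _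
  w_eq b m := by
    have := Y.iter_newField F (.inr (.inl b)) m
    simp only [Sum.elim_inr, Sum.elim_inl] at this
    rw [this, map_add, surface_bas]
    simp only [oldField, surface_y, shift]
    split_ifs
    · rw [map_neg, add_neg_cancel]
    · rw [map_zero, add_zero]
  v_eq c m := by
    have := Y.iter_newField F (.inr (.inr c)) m
    simp only [Sum.elim_inr] at this
    rw [Pi.zero_apply, sub_zero, this, map_add, surface_bas]
    simp only [oldField, surface_xi, shift, map_sum]
    rw [neg_add_eq_zero]
    refine Finset.sum_congr rfl fun ν _ => ?_
    split_ifs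
    · rfl
    · rw [map_zero]

end CoordChange

/-! ### The derivatives in `y` and the differential `σ^F` -/

section Parent

variable {n : ℕ} {U V : TopologicalSpace.Opens (Fin n → ℝ)} {ι : Type u} {F : SuperDomain ι}

/-- `∂^F/∂y^a`: the vector field that adds `a` to the symmetric multi-indices `(λ)`. -/
noncomputable def yD (U : TopologicalSpace.Opens (Fin n → ℝ)) (F : SuperDomain ι) (a : Fin n) :
    (parentJet U F).LocalFn → (parentJet U F).LocalFn :=
  (parentJet U F).vectorField fun
    | .base _ => 0
    | .field ((A, l), N) m => (parentJet U F).coord (.field ((A, a ::ₘ l), N) m)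

theorem hasParity_parentJet (A : ι) (l l' : Multiset (Fin n)) (N : Finset (Fin n))
    (m : Multiset (Fin n)) : (parentJet U F).HasParity
      ((parentJet U F).coord (.field ((A, l'), N) m))
      ((parentJet U F).parity (.field ((A, l), N) m)) :=
  hasParity_coord (M := parentJet U F) (.field ((A, l'), N) m)

theorem isDer_yD (a : Fin n) : IsDer (AlgHom.id ℝ _) 0 (yD U F a) := by
  refine isDer_vectorField ?_
  rintro (μ | ⟨⟨⟨A, l⟩, N⟩, m⟩)
  · exact hasParity_zero _
  · rw [add_zero]
    exact hasParity_parentJet A l _ N m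

theorem yD_base (a μ : Fin n) : yD U F a ((parentJet U F).coord (.base μ)) = 0 :=
  vectorField_coord _ _

theorem yD_field (a : Fin n) (A : ι) (l : Multiset (Fin n)) (N : Finset (Fin n))
    (m : Multiset (Fin n)) : yD U F a ((parentJet U F).coord (.field ((A, l), N) m)) =
      (parentJet U F).coord (.field ((A, a ::ₘ l), N) m) :=
  vectorField_coord _ _

theorem yD_thetaD (a ν : Fin n) (f : (parentJet U F).LocalFn) :
    thetaD U (jetFibre n F) ν (yD U F a f) = yD U F a (thetaD U (jetFibre n F) ν f) := by
  refine (isDer_thetaD ν).commute (isDer_yD a) ?_ f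
  rintro (μ | ⟨⟨⟨A, l⟩, N⟩, m⟩)
  · rw [yD_base, thetaD_base, (isDer_thetaD ν).zero, (isDer_yD a).zero]
  · rw [yD_field, thetaD_field, thetaD_field]
    split_ifs
    · rw [(isDer_yD a).zero]
    · rw [(isDer_yD a).smul, yD_field]; rfl

theorem undiff_yD (a : Fin n) (f : (parentJet U F).LocalFn) :
    (undiff U (superfield n (jetFibre n F))).pullback (yD U F a f) =
      yD U F a ((undiff U (superfield n (jetFibre n F))).pullback f) := by
  refine (isDer_yD a).intertwine (isDer_yD a) (Morphism.isGeo_pullback _) ?_ f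
  rintro (μ | ⟨⟨⟨A, l⟩, N⟩, m⟩)
  · rw [yD_base, undiff_base, yD_base, map_zero]
  · rw [yD_field, undiff_field, undiff_field]
    split_ifs
    · rw [yD_field]
    · rw [(isDer_yD a).zero]

theorem isDer_sigmaF : IsDer (AlgHom.id ℝ _) 1 (sigmaF V F) := by
  refine isDer_vectorField ?_
  rintro (μ | ⟨⟨⟨A, l⟩, N⟩, m⟩)
  · exact hasParity_zero _
  · exact HasParity.sum fun ν hν =>
      (hasParity_erase (F := jetFibre n F) (t := (A, l)) (t' := (A, ν ::ₘ l)) rfl hν m m).smul _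

theorem sigmaF_base (μ : Fin n) : sigmaF V F ((parentJet V F).coord (.base μ)) = 0 :=
  vectorField_coord _ _

theorem sigmaF_field (A : ι) (l : Multiset (Fin n)) (N : Finset (Fin n)) (m : Multiset (Fin n)) :
    sigmaF V F ((parentJet V F).coord (.field ((A, l), N) m)) =
      ∑ ν ∈ N, (sgn (F.parity A) * insSign ν N) •
        (parentJet V F).coord (.field ((A, ν ::ₘ l), N.erase ν) m) :=
  vectorField_coord _ _

theorem sigmaF_totalD (μ : Fin n) (f : (parentJet V F).LocalFn) :
    sigmaF V F (totalD V _ μ f) = totalD V _ μ (sigmaF V F f) := by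
  refine isDer_sigmaF.commute (isDer_totalD μ) ?_ f
  rintro (ν | ⟨⟨⟨A, l⟩, N⟩, m⟩)
  · rw [sigmaF_base, totalD_base, (isDer_totalD μ).zero]
    split_ifs
    · exact isDer_sigmaF.one
    · exact isDer_sigmaF.zero
  · rw [totalD_field, sigmaF_field, sigmaF_field, (isDer_totalD μ).sum]
    refine Finset.sum_congr rfl fun ν _ => ?_
    rw [(isDer_totalD μ).smul, totalD_field]

/-- The contraction identity once more, with the contracted index now added to `(λ)`. As `∂^F/∂y^a`
kills `x`, no explicit correction is needed, in contrast to `dF_thetaD`. -/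
theorem sigmaF_thetaD (a : Fin n) (f : (parentJet V F).LocalFn) :
    sigmaF V F (thetaD V (jetFibre n F) a f) =
      yD V F a f - thetaD V (jetFibre n F) a (sigmaF V F f) := by
  rw [eq_sub_iff_add_eq]
  refine (isDer_sigmaF.comm_odd (isDer_thetaD a) (isDer_thetaD a) fun _ => rfl).ext
    (isDer_yD a) ?_ f
  rintro (ν | ⟨⟨⟨A, l⟩, N⟩, m⟩)
  · rw [thetaD_base, sigmaF_base, isDer_sigmaF.zero, (isDer_thetaD a).zero, yD_base, add_zero]
  · rw [yD_field]
    exact contraction_thetaD (t := (A, l)) (m := m)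
      (g := fun ρ N => (parentJet V F).coord (.field ((A, ρ ::ₘ l), N) m)) isDer_sigmaF
      (fun ρ ν N => thetaD_field ν (A, ρ ::ₘ l) N m) (fun N => sigmaF_field A l N m) a N

theorem toParent_base (a : Fin n) :
    toParent V F ((jet V F).coord (.base a)) = (parentJet V F).coord (.base a) :=
  Morphism.rename_coord _

theorem toParent_field (A : ι) (l : Multiset (Fin n)) :
    toParent V F ((jet V F).coord (.field A l)) = (parentJet V F).coord (.field ((A, l), ∅) 0) :=
  Morphism.rename_coord _

theorem isGeo_toParent : IsGeo (toParent V F) := Morphism.isGeo_pullback _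

theorem undiff_toParent (f : (jet V F).LocalFn) :
    (undiff V (superfield n (jetFibre n F))).pullback (toParent V F f) = toParent V F f := by
  refine DFunLike.congr_fun (((Morphism.isGeo_pullback _).comp isGeo_toParent).ext isGeo_toParent
    fun i => ?_) f
  rw [AlgHom.comp_apply]
  match i with
  | .base a => rw [toParent_base, undiff_base]
  | .field A l => rw [toParent_field, undiff_field, if_pos rfl]

theorem isDer_yTotalD (a : Fin n) : IsDer (AlgHom.id ℝ _) 0 (yTotalD V F a) := by
  refine isDer_vectorField ?_
  rintro (μ | ⟨⟨⟨A, l⟩, N⟩, m⟩)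
  · rw [add_zero]
    dsimp only
    split_ifs
    · exact hasParity_one
    · exact hasParity_zero _
  · rw [add_zero]
    exact hasParity_parentJet A l _ N m

theorem toParent_totalD (a : Fin n) (f : (jet V F).LocalFn) :
    toParent V F (totalD V F a f) = yTotalD V F a (toParent V F f) := by
  refine (isDer_totalD a).intertwine (isDer_yTotalD a) isGeo_toParent ?_ f
  rintro (μ | ⟨A, l⟩)
  · rw [totalD_base, toParent_base, yTotalD, vectorField_coord]
    dsimp only
    split_ifs
    · exact map_one _
    · exact map_zero _
  · rw [totalD_field, toParent_field, toParent_field, yTotalD, vectorField_coord]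

variable (T : GaugeTheory n V ι)

/-- The replacement of jet indices carries `∂_a` to `∂/∂x^a + ∂^F/∂y^a`, so differentiating before
or after it gives the same function. In this form `s̄` can be compared with `s̃`, which is built
from the derivatives of `S^A` on the original jet space. -/
theorem GaugeTheory.sBar_eq : T.sBar = prolong V (jetFibre n T.fields) fun t =>
    toParent V T.fields (iter (totalD V T.fields) t.2 (T.S t.1)) := by
  rw [sBar]
  congr 1
  funext t
  exact (iter_intertwine toParent_totalD _ _).symm

theorem GaugeTheory.hasParity_toParent (t : ι × Multiset (Fin n)) :
    (parentJet V T.fields).HasParity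
      (toParent V T.fields (iter (totalD V T.fields) t.2 (T.S t.1)))
      ((jetFibre n T.fields).parity t + 1) :=
  isGeo_toParent.hasParity (hasParity_iter isDer_totalD _ (T.parity_S _))

/-- `s̄ - σ^F`. -/
noncomputable def GaugeTheory.fibreDifferential (f : (parentJet V T.fields).LocalFn) :
    (parentJet V T.fields).LocalFn :=
  T.sBar f - sigmaF V T.fields f

theorem GaugeTheory.parentDifferential_eq (f : (parentJet V T.fields).LocalFn) :
    T.parentDifferential f = dF V (jetFibre n T.fields) f + T.fibreDifferential f := by
  rw [parentDifferential, fibreDifferential]; abel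

theorem GaugeTheory.isDer_fibreDifferential : IsDer (AlgHom.id ℝ _) 1 T.fibreDifferential := by
  refine IsDer.fun_sub ?_ isDer_sigmaF
  rw [sBar_eq]
  exact isDer_prolong T.hasParity_toParent

theorem GaugeTheory.isDer_parentDifferential : IsDer (AlgHom.id ℝ _) 1 T.parentDifferential := by
  rw [funext T.parentDifferential_eq]
  exact isDer_dF.fun_add T.isDer_fibreDifferential

theorem GaugeTheory.parentDifferential_base (μ : Fin n) :
    T.parentDifferential ((parentJet V T.fields).coord (.base μ)) = 0 := by
  rw [parentDifferential, dF_base, sigmaF_base, sBar, prolong_base, sub_zero, add_zero]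

theorem GaugeTheory.parentDifferential_totalD (μ : Fin n) (f : (parentJet V T.fields).LocalFn) :
    T.parentDifferential (totalD V _ μ f) = totalD V _ μ (T.parentDifferential f) := by
  rw [parentDifferential, parentDifferential, dF_totalD, sigmaF_totalD, sBar_eq,
    prolong_totalD T.hasParity_toParent, (isDer_totalD μ).add, (isDer_totalD μ).sub]

/-- `s̄` anticommutes with `∂/∂θ^a`, so only `σ^F` contributes. Together with the values on scalars
this relation pins the operator down on undifferentiated fields. -/
theorem GaugeTheory.fibreDifferential_thetaD (a : Fin n) (f : (parentJet V T.fields).LocalFn) :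
    T.fibreDifferential (thetaD V _ a f) =
      -thetaD V _ a (T.fibreDifferential f) - yD V T.fields a f := by
  rw [fibreDifferential, fibreDifferential, sigmaF_thetaD, sBar_eq,
    prolong_thetaD T.hasParity_toParent, (isDer_thetaD a).sub]
  abel

theorem GaugeTheory.fibreDifferential_scalar (A : ι) (l : Multiset (Fin n)) :
    T.fibreDifferential ((parentJet V T.fields).coord (.field ((A, l), ∅) 0)) =
      toParent V T.fields (iter (totalD V T.fields) l (T.S A)) := by
  rw [fibreDifferential, sigmaF_field, sBar_eq, prolong_field, Finset.sum_empty, sub_zero,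
    iterSkew_empty, iter_zero, Finset.card_empty, Nat.cast_zero, zero_mul, sgn_zero, one_smul]

end Parent

/-! ### The inclusion of the remaining fields -/

section Inclusion

variable {n : ℕ} {U V : TopologicalSpace.Opens (Fin n → ℝ)} {ι : Type u} {F : SuperDomain ι}

/-- The remaining fields as a part of the fields of the parametrized parent formulation. -/
noncomputable def incl (U V : TopologicalSpace.Opens (Fin n → ℝ)) (F : SuperDomain ι) :
    (parentJet U F).LocalFn →ₐ[ℝ] (paramJet U V F).LocalFn :=
  (Morphism.rename (M := paramJet U V F) (N := parentJet U F)
    (fun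
      | .base μ => .base μ
      | .field t m => .field (.psi t.1.1 t.1.2, t.2) m)
    (by rintro (_ | _) <;> rfl)
    (fun _ hp => ⟨hp.1, hp.2.2⟩)).pullback

theorem isGeo_incl : IsGeo (incl U V F) := Morphism.isGeo_pullback _

theorem incl_base (μ : Fin n) :
    incl U V F ((parentJet U F).coord (.base μ)) = (paramJet U V F).coord (.base μ) :=
  Morphism.rename_coord _

theorem incl_field (t : ι × Multiset (Fin n)) (N : Finset (Fin n)) (m : Multiset (Fin n)) :
    incl U V F ((parentJet U F).coord (.field (t, N) m)) =
      (paramJet U V F).coord (.field (.psi t.1 t.2, N) m) :=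
  Morphism.rename_coord _

theorem incl_totalD (μ : Fin n) (f : (parentJet U F).LocalFn) :
    incl U V F (totalD U _ μ f) = totalD U _ μ (incl U V F f) := by
  refine (isDer_totalD μ).intertwine (isDer_totalD μ) isGeo_incl ?_ f
  rintro (ν | ⟨⟨t, N⟩, m⟩)
  · rw [totalD_base, incl_base, totalD_base]
    split_ifs
    · exact map_one _
    · exact map_zero _
  · rw [totalD_field, incl_field, incl_field, totalD_field]

theorem incl_thetaD (ν : Fin n) (f : (parentJet U F).LocalFn) :
    incl U V F (thetaD U _ ν f) = thetaD U _ ν (incl U V F f) := by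
  refine (isDer_thetaD ν).intertwine (isDer_thetaD ν) isGeo_incl ?_ f
  rintro (μ | ⟨⟨t, N⟩, m⟩)
  · rw [thetaD_base, incl_base, thetaD_base, map_zero]
  · rw [thetaD_field, incl_field, thetaD_field]
    split_ifs
    · exact map_zero _
    · rw [map_smul, incl_field]; rfl

end Inclusion

namespace CoordChange

variable {n : ℕ} {U V : TopologicalSpace.Opens (Fin n → ℝ)} (Y : CoordChange U V)
  {ι : Type u} {F : SuperDomain ι}

/-! ### The restriction to the surface and the vector fields -/

theorem surface_incl (f : (parentJet U F).LocalFn) :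
    (Y.surface F).pullback (incl U V F f) = f := by
  refine DFunLike.congr_fun (((Morphism.isGeo_pullback _).comp isGeo_incl).ext isGeo_id
    fun i => ?_) f
  rw [AlgHom.comp_apply, AlgHom.id_apply]
  match i with
  | .base μ => rw [incl_base, surface_base]
  | .field (t, N) m => rw [incl_field, surface_psi]

theorem surface_totalD (μ : Fin n) (f : (paramJet U V F).LocalFn) :
    (Y.surface F).pullback (totalD U _ μ f) = totalD U _ μ ((Y.surface F).pullback f) := by
  refine (isDer_totalD μ).intertwine (isDer_totalD μ) (Morphism.isGeo_pullback _) ?_ f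
  rintro (ν | ⟨⟨y | y | y, N⟩, m⟩)
  · rw [totalD_base, surface_base, totalD_base]
    split_ifs
    · exact map_one _
    · exact map_zero _
  · rw [totalD_field, surface_y, surface_y, iter_cons pd_base_comm]
    split_ifs
    · rw [totalD_bas]
    · rw [(isDer_totalD μ).zero]
  · rw [totalD_field, surface_xi, surface_xi, (isDer_totalD μ).neg, (isDer_totalD μ).sum]
    congr 1
    refine Finset.sum_congr rfl fun ν _ => ?_
    rw [iter_cons pd_base_comm]
    split_ifs
    · rw [totalD_bas]
    · rw [(isDer_totalD μ).zero]
  · rw [totalD_field, surface_psi, surface_psi, totalD_field]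

/-- The odd vector field `∑_a (∂Y^a/∂x^ν) ∂/∂ξ^a`, prolonged to the derivatives of `ξ^a`. -/
noncomputable def xiD (F : SuperDomain ι) (ν : Fin n) :
    (paramJet U V F).LocalFn → (paramJet U V F).LocalFn :=
  (paramJet U V F).vectorField fun
    | .field (.xi a, N) m =>
        if N = ∅ then bas U _ (iter (fun μ => (baseDom U).pd μ) m (Y.jac ν a)) else 0
    | _ => 0

theorem isDer_xiD (ν : Fin n) : IsDer (AlgHom.id ℝ _) 1 (Y.xiD F ν) := by
  refine isDer_vectorField ?_
  rintro (μ | ⟨⟨y | a | y, N⟩, m⟩)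
  · exact hasParity_zero _
  · exact hasParity_zero _
  · dsimp only
    split_ifs with h
    · have : (paramJet U V F).parity (.field (.xi a, N) m) + 1 = 0 := by
        subst h
        simp only [jet, JetCoord.parity, superfield, extJet, ExtCoord.parity, Finset.card_empty,
          Nat.cast_zero, add_zero]
        exact CharTwo.add_self_eq_zero 1
      rw [this]
      exact hasParity_bas _
    · exact hasParity_zero _
  · exact hasParity_zero _

theorem xiD_base (ν μ : Fin n) : Y.xiD F ν ((paramJet U V F).coord (.base μ)) = 0 :=
  vectorField_coord _ _

theorem xiD_y (ν a : Fin n) (N : Finset (Fin n)) (m : Multiset (Fin n)) :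
    Y.xiD F ν ((paramJet U V F).coord (.field (.y a, N) m)) = 0 :=
  vectorField_coord _ _

theorem xiD_xi (ν a : Fin n) (N : Finset (Fin n)) (m : Multiset (Fin n)) :
    Y.xiD F ν ((paramJet U V F).coord (.field (.xi a, N) m)) =
      if N = ∅ then bas U _ (iter (fun μ => (baseDom U).pd μ) m (Y.jac ν a)) else 0 :=
  vectorField_coord _ _

theorem xiD_psi (ν : Fin n) (A : ι) (l : Multiset (Fin n)) (N : Finset (Fin n))
    (m : Multiset (Fin n)) :
    Y.xiD F ν ((paramJet U V F).coord (.field (.psi A l, N) m)) = 0 :=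
  vectorField_coord _ _

/-- The coefficients of `xiD` are functions of `x`, which `∂/∂θ` kills, and `xiD` itself kills every
component of `ξ^a` carrying a skew index. -/
theorem xiD_thetaD (ν μ : Fin n) (f : (paramJet U V F).LocalFn) :
    Y.xiD F ν (thetaD U _ μ f) = -thetaD U _ μ (Y.xiD F ν f) := by
  refine (Y.isDer_xiD ν).anticommute (isDer_thetaD μ) ?_ f
  rintro (ρ | ⟨⟨y | a | y, N⟩, m⟩)
  · rw [thetaD_base, xiD_base, (isDer_thetaD μ).zero, (Y.isDer_xiD ν).zero, add_zero]
  · rw [thetaD_field, xiD_y, (isDer_thetaD μ).zero, add_zero]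
    split_ifs
    · rw [(Y.isDer_xiD ν).zero]
    · rw [(Y.isDer_xiD ν).smul, xiD_y, smul_zero]
  · have h : thetaD U (extJet V F) μ
        (Y.xiD F ν ((paramJet U V F).coord (.field (.xi a, N) m))) = 0 := by
      rw [xiD_xi]
      split_ifs
      · exact thetaD_bas _ _
      · exact (isDer_thetaD μ).zero
    rw [h, thetaD_field, add_zero]
    split_ifs
    · rw [(Y.isDer_xiD ν).zero]
    · rw [(Y.isDer_xiD ν).smul, xiD_xi, if_neg (Finset.insert_ne_empty _ _), smul_zero]
  · rw [thetaD_field, xiD_psi, (isDer_thetaD μ).zero, add_zero]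
    split_ifs
    · rw [(Y.isDer_xiD ν).zero]
    · rw [(Y.isDer_xiD ν).smul, xiD_psi, smul_zero]

theorem xiD_iterSkew_thetaD (ν : Fin n) (N : Finset (Fin n)) (f : (paramJet U V F).LocalFn) :
    Y.xiD F ν (iterSkew (thetaD U _) N f) =
      sgn N.card • iterSkew (thetaD U _) N (Y.xiD F ν f) := by
  refine iterSkew_induction (P := fun N g => Y.xiD F ν g =
    sgn N.card • iterSkew (thetaD U _) N (Y.xiD F ν f)) ?_ (fun a N h hg => ?_) N
  · rw [Finset.card_empty, Nat.cast_zero, sgn_zero, one_smul, iterSkew_empty]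
  · have ha : a ∉ N := fun h' => lt_irrefl a (h a h')
    rw [xiD_thetaD, hg, iterSkew_insert_min _ h, (isDer_thetaD a).smul,
      Finset.card_insert_of_notMem ha, Nat.cast_add, Nat.cast_one, sgn_add, sgn_one, ← neg_smul,
      mul_neg_one]

/-- The surface is not preserved by `∂/∂θ^ν`: there `ξ^a` vanishes, while `∂ξ^a/∂θ^ν = -ξ^a_ν` takes
the value `∂Y^a/∂x^ν`. The field `xiD` records exactly this defect. -/
theorem surface_thetaD (ν : Fin n) (f : (paramJet U V F).LocalFn) :
    (Y.surface F).pullback (thetaD U _ ν f) =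
      thetaD U _ ν ((Y.surface F).pullback f) + (Y.surface F).pullback (Y.xiD F ν f) := by
  have hg : IsGeo (Y.surface F).pullback := Morphism.isGeo_pullback _
  refine ((isDer_thetaD ν).left hg).ext
    (((isDer_thetaD ν).right hg).fun_add ((Y.isDer_xiD ν).left hg)) ?_ f
  rintro (ρ | ⟨⟨y | a | y, N⟩, m⟩)
  · rw [thetaD_base, xiD_base, surface_base, thetaD_base, map_zero, add_zero]
  · rw [thetaD_field, xiD_y, surface_y, map_zero, add_zero]
    have h : ∀ c : (baseDom U).LocalFn, thetaD U (jetFibre n F) ν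
        (if N = ∅ then bas U _ c else 0) = 0 := fun c => by
      split_ifs
      · exact thetaD_bas _ _
      · exact (isDer_thetaD ν).zero
    rw [h]
    split_ifs
    · exact map_zero _
    · rw [map_smul, surface_y, if_neg (Finset.insert_ne_empty _ _), smul_zero]
  · have h : thetaD U (jetFibre n F) ν
        ((Y.surface F).pullback ((paramJet U V F).coord (.field (.xi a, N) m))) = 0 := by
      rw [surface_xi, (isDer_thetaD ν).neg, (isDer_thetaD ν).sum, Finset.sum_eq_zero, neg_zero]
      intro μ _
      split_ifs
      · exact thetaD_bas _ _
      · exact (isDer_thetaD ν).zero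
    rw [h, zero_add, thetaD_field, xiD_xi]
    -- On the surface only components of `ξ^a` with a single skew index are nonzero. Inserting `ν`
    -- produces such a component just for `N = ∅`; for nonempty `N` there are at least two indices.
    by_cases hN : N = ∅
    · subst hN
      have hp : (extJet V F).parity (.xi a) = 1 := rfl
      have hs : insSign ν (∅ : Finset (Fin n)) = 1 := insSign_min (by simp)
      rw [if_neg (Finset.notMem_empty ν), if_pos rfl, map_smul, surface_xi, surface_bas, hp,
        sgn_one, hs, Finset.sum_eq_single ν]
      · rw [if_pos (by simp), mul_one, neg_one_smul, neg_neg]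
      · intro μ _ hμ
        refine if_neg fun h' => hμ ?_
        have : ν ∈ ({μ} : Finset (Fin n)) := h' ▸ Finset.mem_insert_self ν ∅
        exact (Finset.mem_singleton.1 this).symm
      · exact fun h' => absurd (Finset.mem_univ ν) h'
    · rw [if_neg hN, map_zero]
      split_ifs with hν
      · exact map_zero _
      · rw [map_smul, surface_xi, Finset.sum_eq_zero, neg_zero, smul_zero]
        intro μ _
        refine if_neg fun h' => ?_
        have := congrArg Finset.card h'
        rw [Finset.card_insert_of_notMem hν, Finset.card_singleton] at this
        exact hN (Finset.card_eq_zero.1 (by omega))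
  · rw [thetaD_field, xiD_psi, surface_psi, thetaD_field, map_zero, add_zero]
    split_ifs
    · exact map_zero _
    · rw [map_smul, surface_psi]; rfl

/-! ### The reduced differential -/

variable (T : GaugeTheory n V ι)

theorem isDer_surface_incl : IsDer (AlgHom.id ℝ _) 1 fun f =>
    (Y.surface T.fields).pullback (T.parametrizedDifferential U (incl U V T.fields f)) :=
  ((T.isDer_parametrizedDifferential.right isGeo_incl).comp_left
    (Morphism.isGeo_pullback _)).congr_hom (AlgHom.ext (Y.surface_incl))

/-- Including the remaining fields and then restricting is the identity, so the composite on the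
right is a derivation along the identity; it has the coefficients that define the reduced
differential. -/
theorem reduced_eq (f : (parentJet U T.fields).LocalFn) : Y.reduced T f =
    (Y.surface T.fields).pullback (T.parametrizedDifferential U (incl U V T.fields f)) := by
  rw [reduced, reducedDifferential]
  refine (isDer_vectorField (p := 1) ?_).ext (Y.isDer_surface_incl T) ?_ f
  · rintro (μ | ⟨t, m⟩)
    · exact hasParity_zero _
    · dsimp only
      rw [phi, iter_totalD_coord, ← incl_field, add_comm]
      exact (Y.isDer_surface_incl T).hasParity
        (hasParity_coord (M := parentJet U T.fields) (.field t m))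
  · rintro (μ | ⟨t, m⟩)
    · rw [vectorField_coord, incl_base, T.parametrizedDifferential_base, map_zero]
    · rw [vectorField_coord]
      dsimp only
      rw [phi, iter_totalD_coord, ← incl_field]

theorem isDer_reduced : IsDer (AlgHom.id ℝ _) 1 (Y.reduced T) := by
  rw [funext (Y.reduced_eq T)]
  exact Y.isDer_surface_incl T

theorem reduced_base (μ : Fin n) : Y.reduced T ((parentJet U T.fields).coord (.base μ)) = 0 := by
  rw [reduced_eq, incl_base, T.parametrizedDifferential_base, map_zero]

theorem reduced_totalD (μ : Fin n) (f : (parentJet U T.fields).LocalFn) :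
    Y.reduced T (totalD U _ μ f) = totalD U _ μ (Y.reduced T f) := by
  rw [reduced_eq, reduced_eq, incl_totalD, T.parametrizedDifferential_totalD, surface_totalD]

theorem xiD_toExt (ν : Fin n) (f : (jet V F).LocalFn) :
    Y.xiD F ν (fromTarget U _ (toExt V F f)) = 0 := by
  refine ((Y.isDer_xiD ν).right (isGeo_fromTarget.comp isGeo_toExt)).eq_zero ?_ f
  rintro (a | ⟨A, l⟩)
  · rw [AlgHom.comp_apply, toExt_base, fromTarget_coord, xiD_y]
  · rw [AlgHom.comp_apply, toExt_field, fromTarget_coord, xiD_psi]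

/-- The part coming from `S^A` does not involve `ξ`; in `ξ^a ∂_a` the defect simply replaces `ξ^a`
by `∂Y^a/∂x^ν`. -/
theorem xiD_sTilde (ν : Fin n) (A : ι) (l : Multiset (Fin n)) :
    Y.xiD T.fields ν (fromTarget U _ (T.sTilde (.psi A l))) =
      ∑ a, bas U _ (Y.jac ν a) *
        (paramJet U V T.fields).coord (.field (.psi A (a ::ₘ l), ∅) 0) := by
  rw [GaugeTheory.sTilde, map_add, (Y.isDer_xiD ν).add, xiD_toExt, zero_add, map_sum,
    (Y.isDer_xiD ν).sum]
  refine Finset.sum_congr rfl fun a _ => ?_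
  rw [map_mul, fromTarget_coord, fromTarget_coord, (Y.isDer_xiD ν).leibniz, xiD_psi, mul_zero,
    add_zero, AlgHom.id_apply, xiD_xi, if_pos rfl, iter_zero]

theorem iterSkew_thetaD_sum_bas (N : Finset (Fin n)) (c : Fin n → (baseDom U).LocalFn)
    (f : Fin n → (jet U (superfield n F)).LocalFn) :
    iterSkew (thetaD U F) N (∑ a, bas U _ (c a) * f a) =
      ∑ a, bas U _ (c a) * iterSkew (thetaD U F) N (f a) := by
  refine iterSkew_induction (P := fun N g => g = ∑ a, bas U _ (c a) * iterSkew (thetaD U F) N (f a))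
    ?_ (fun ν N h hg => ?_) N
  · simp only [iterSkew_empty]
  · rw [hg, (isDer_thetaD ν).sum]
    refine Finset.sum_congr rfl fun a _ => ?_
    rw [(isDer_thetaD ν).bas_mul (thetaD_base ν), iterSkew_insert_min _ h]

theorem xiD_dF_psi (ν : Fin n) (A : ι) (l : Multiset (Fin n)) (N : Finset (Fin n))
    (m : Multiset (Fin n)) :
    Y.xiD F ν (dF U _ ((paramJet U V F).coord (.field (.psi A l, N) m))) = 0 := by
  rw [dF_field, (Y.isDer_xiD ν).sum]
  refine Finset.sum_eq_zero fun μ _ => ?_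
  rw [(Y.isDer_xiD ν).smul, xiD_psi, smul_zero]

theorem xiD_parametrizedDifferential_psi (ν : Fin n) (A : ι) (l : Multiset (Fin n))
    (N : Finset (Fin n)) :
    Y.xiD T.fields ν (T.parametrizedDifferential U
        ((paramJet U V T.fields).coord (.field (.psi A l, N) 0))) =
      ∑ a, bas U _ (Y.jac ν a) *
        (paramJet U V T.fields).coord (.field (.psi A (a ::ₘ l), N) 0) := by
  rw [T.parametrizedDifferential_field, (Y.isDer_xiD ν).add, xiD_dF_psi, zero_add,
    (Y.isDer_xiD ν).smul, xiD_iterSkew_thetaD, iter_zero, xiD_sTilde, iterSkew_thetaD_sum_bas,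
    smul_smul, Finset.smul_sum]
  refine Finset.sum_congr rfl fun a _ => ?_
  have h : (extJet V T.fields).parity (.psi A (a ::ₘ l)) = T.fields.parity A := rfl
  have h' : (extJet V T.fields).parity (.psi A l) = T.fields.parity A := rfl
  -- Three signs meet, with `x` the number of skew indices and `p` the parity of the field: from the
  -- prolongation, from moving `xiD` past the `θ`-derivatives, and from recovering the component.
  -- Their exponents add up to zero modulo 2.
  have e : ∀ x p : ZMod 2, x * (p + 1) + x + x * p = 0 := by decide
  rw [iterSkew_thetaD_coord, mul_smul_comm, smul_smul, h, h', ← sgn_add, ← sgn_add, e, sgn_zero,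
    one_smul]

/-- The total derivative comes from the anticommutator before restriction; the last sum is the
defect of the restriction and is the seed of `-σ^F`. -/
theorem reduced_thetaD_field (ν : Fin n) (A : ι) (l : Multiset (Fin n)) (N : Finset (Fin n)) :
    Y.reduced T (thetaD U _ ν ((parentJet U T.fields).coord (.field ((A, l), N) 0))) =
      totalD U _ ν ((parentJet U T.fields).coord (.field ((A, l), N) 0)) -
        thetaD U _ ν (Y.reduced T ((parentJet U T.fields).coord (.field ((A, l), N) 0))) -
          ∑ a, bas U _ (Y.jac ν a) *
            yD U T.fields a ((parentJet U T.fields).coord (.field ((A, l), N) 0)) := by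
  rw [reduced_eq, reduced_eq, incl_thetaD, T.parametrizedDifferential_thetaD, map_sub, map_sub,
    surface_thetaD, ← incl_totalD, surface_incl, incl_field, xD_field, map_zero,
    xiD_parametrizedDifferential_psi, map_sum, sub_zero, sub_add_eq_sub_sub]
  congr 1
  refine Finset.sum_congr rfl fun a _ => ?_
  rw [map_mul, surface_bas, surface_psi, yD_field]

/-- The part of the reduced differential that does not differentiate with respect to `x`. -/
noncomputable def fibreReduced (f : (parentJet U T.fields).LocalFn) :
    (parentJet U T.fields).LocalFn :=
  Y.reduced T f - dF U (jetFibre n T.fields) f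

theorem isDer_fibreReduced : IsDer (AlgHom.id ℝ _) 1 (Y.fibreReduced T) :=
  (Y.isDer_reduced T).fun_sub isDer_dF

theorem fibreReduced_base (μ : Fin n) :
    Y.fibreReduced T ((parentJet U T.fields).coord (.base μ)) = 0 := by
  rw [fibreReduced, reduced_base, dF_base, sub_zero]

/-- Subtracting `d^F` removes the total derivative. The formula is confined to undifferentiated
fields, since applying a total derivative to it would also differentiate the Jacobi matrix. -/
theorem fibreReduced_thetaD (ν : Fin n) {f : (parentJet U T.fields).LocalFn}
    (hf : (undiff U (superfield n (jetFibre n T.fields))).pullback f = f) :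
    Y.fibreReduced T (thetaD U _ ν f) = -thetaD U _ ν (Y.fibreReduced T f) -
      ∑ a, bas U _ (Y.jac ν a) * yD U T.fields a f := by
  have h := ((Y.isDer_fibreReduced T).comm_odd (isDer_thetaD ν) (isDer_thetaD ν)
    fun _ => rfl).ext_undiff
    ((IsDer.fun_zero isGeo_id 0).fun_sub (IsDer.fun_sum Finset.univ isGeo_id fun a _ =>
      (isDer_yD a).fun_mul (hasParity_bas (Y.jac ν a)))) (fun μ => ?_) ?_ hf
  · rw [eq_sub_of_add_eq h]; abel
  · simp only [thetaD_base, fibreReduced_base, (Y.isDer_fibreReduced T).zero,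
      (isDer_thetaD ν).zero, yD_base, mul_zero, Finset.sum_const_zero, sub_zero, add_zero]
  · rintro ⟨⟨A, l⟩, N⟩
    simp only [fibreReduced]
    rw [reduced_thetaD_field, dF_thetaD, xD_field, (isDer_thetaD ν).sub]
    abel

/-- The inverse Jacobi matrix absorbs the Jacobi matrix, and what remains has the same shape as
`GaugeTheory.fibreDifferential_thetaD` over `V`. -/
theorem fibreReduced_lower_thetaD (b : Fin n) {f : (parentJet U T.fields).LocalFn}
    (hf : (undiff U (superfield n (jetFibre n T.fields))).pullback f = f) :
    Y.fibreReduced T (Y.lower _ (thetaD U _) b f) =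
      -Y.lower _ (thetaD U _) b (Y.fibreReduced T f) - yD U T.fields b f := by
  have h : ∀ ν, Y.fibreReduced T (bas U _ (Y.jacInv b ν) * thetaD U _ ν f) =
      -(bas U _ (Y.jacInv b ν) * thetaD U _ ν (Y.fibreReduced T f)) -
        ∑ a, bas U _ (Y.jacInv b ν * Y.jac ν a) * yD U T.fields a f := fun ν => by
    rw [(Y.isDer_fibreReduced T).bas_mul (Y.fibreReduced_base T), Y.fibreReduced_thetaD T ν hf,
      mul_sub, mul_neg, Finset.mul_sum]
    simp only [map_mul, mul_assoc]
  simp only [lower]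
  rw [(Y.isDer_fibreReduced T).sum, Finset.sum_congr rfl fun ν _ => h ν, Finset.sum_sub_distrib,
    Finset.sum_neg_distrib, Finset.sum_comm]
  simp only [← Finset.sum_mul, ← map_sum, jacInv_jac]
  congr 1
  rw [Finset.sum_eq_single b]
  · rw [if_pos rfl, map_one, one_mul]
  · intro a _ ha
    rw [if_neg (Ne.symm ha), map_zero, zero_mul]
  · exact fun h' => absurd (Finset.mem_univ b) h'

/-- Both routes put `y = Y(x)` and leave the scalars `Ψ^A_{(λ)}` unchanged. -/
theorem surface_toExt (f : (jet V F).LocalFn) :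
    (Y.surface F).pullback (fromTarget U _ (toExt V F f)) =
      Y.transform (jetFibre n F) (toParent V F f) := by
  refine DFunLike.congr_fun ((((Morphism.isGeo_pullback _).comp isGeo_fromTarget).comp
    isGeo_toExt).ext (Y.isGeo_transform.comp isGeo_toParent) fun i => ?_) f
  rw [AlgHom.comp_apply, AlgHom.comp_apply, AlgHom.comp_apply]
  match i with
  | .base a =>
    rw [toExt_base, fromTarget_coord, surface_y, if_pos rfl, iter_zero, toParent_base,
      transform_base]
  | .field A l =>
    rw [toExt_field, fromTarget_coord, surface_psi, toParent_field, transform_scalar]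

/-- Without skew indices `ξ^a` itself restricts to zero, so `ξ^a ∂_a` disappears and only the
derivatives of `S^A` at `y = Y(x)` remain. Neither `d^F` nor `σ^F` contributes on such fields. -/
theorem fibreReduced_scalar (A : ι) (l : Multiset (Fin n)) :
    Y.fibreReduced T ((parentJet U T.fields).coord (.field ((A, l), ∅) 0)) =
      Y.transform (jetFibre n T.fields)
        (T.fibreDifferential ((parentJet V T.fields).coord (.field ((A, l), ∅) 0))) := by
  rw [T.fibreDifferential_scalar, ← surface_toExt, fibreReduced, reduced_eq, incl_field,
    T.parametrizedDifferential_field, dF_field, dF_field, Finset.sum_empty, Finset.sum_empty,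
    zero_add, sub_zero, iterSkew_empty, iter_zero, Finset.card_empty, Nat.cast_zero, zero_mul,
    sgn_zero, one_smul, GaugeTheory.sTilde, map_add, map_add, map_sum, map_sum,
    Finset.sum_eq_zero (s := Finset.univ), add_zero]
  intro a _
  rw [map_mul, map_mul, fromTarget_coord, surface_xi, Finset.sum_eq_zero, neg_zero, zero_mul]
  exact fun ν _ => if_neg (Finset.singleton_ne_empty ν).symm

theorem lower_comm {p : ZMod 2} {Z : (jet U F).LocalFn → (jet U F).LocalFn}
    {X : Fin n → (jet U F).LocalFn → (jet U F).LocalFn} (hZ : IsDer (AlgHom.id ℝ _) p Z)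
    (h0 : ∀ ν, Z ((jet U F).coord (.base ν)) = 0) {f : (jet U F).LocalFn}
    (h : ∀ μ, Z (X μ f) = X μ (Z f)) (a : Fin n) : Z (Y.lower F X a f) = Y.lower F X a (Z f) := by
  simp only [lower]
  rw [hZ.sum]
  exact Finset.sum_congr rfl fun μ _ => by rw [hZ.bas_mul h0, h]

theorem yD_lower_thetaD (a b : Fin n) (f : (parentJet U F).LocalFn) :
    yD U F a (Y.lower _ (thetaD U _) b f) = Y.lower _ (thetaD U _) b (yD U F a f) :=
  Y.lower_comm (isDer_yD a) (yD_base a) (fun ν => (yD_thetaD a ν f).symm) b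

/-- Induction on the skew indices, starting from `fibreReduced_scalar`: the operators over `U` and
`V` obey matching relations with the lowered and the ordinary `θ`-derivatives. -/
theorem fibreReduced_transform (A : ι) (l : Multiset (Fin n)) (N : Finset (Fin n)) :
    Y.fibreReduced T (Y.transform (jetFibre n T.fields)
        ((parentJet V T.fields).coord (.field ((A, l), N) 0))) =
      Y.transform (jetFibre n T.fields)
        (T.fibreDifferential ((parentJet V T.fields).coord (.field ((A, l), N) 0))) := by
  let Θ := Y.transform (jetFibre n T.fields)
  let u {W : TopologicalSpace.Opens (Fin n → ℝ)} :=
    (undiff W (superfield n (jetFibre n T.fields))).pullback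
  -- The relations with `∂/∂θ` hold on undifferentiated fields only, so the induction must also
  -- carry that `g`, its transform and its image under the fibre differential are of this kind.
  -- Compatibility of the transformation with `∂^F/∂y^a` matches the terms produced by `σ^F`.
  have key : ∀ g, u g = g ∧ u (Θ g) = Θ g ∧
      u (T.fibreDifferential g) = T.fibreDifferential g ∧
      (∀ a, yD U T.fields a (Θ g) = Θ (yD V T.fields a g)) ∧
      Y.fibreReduced T (Θ g) = Θ (T.fibreDifferential g) →
      ∀ b, u (thetaD V _ b g) = thetaD V _ b g ∧ u (Θ (thetaD V _ b g)) = Θ (thetaD V _ b g) ∧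
      u (T.fibreDifferential (thetaD V _ b g)) = T.fibreDifferential (thetaD V _ b g) ∧
      (∀ a, yD U T.fields a (Θ (thetaD V _ b g)) = Θ (yD V T.fields a (thetaD V _ b g))) ∧
      Y.fibreReduced T (Θ (thetaD V _ b g)) = Θ (T.fibreDifferential (thetaD V _ b g)) := by
    rintro g ⟨h1, h2, h3, h4, h5⟩ b
    have hy : ∀ a, u (yD V T.fields a g) = yD V T.fields a g := fun a => by
      simp only [u] at h1 ⊢
      rw [undiff_yD, h1]
    have ht := Y.transform_thetaD b h1
    refine ⟨?_, ?_, ?_, fun a => ?_, ?_⟩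
    · simp only [u] at h1 ⊢
      rw [undiff_thetaD, h1]
    · simp only [u, Θ] at h2 ⊢
      rw [ht, undiff_lower_thetaD, h2]
    · simp only [u] at h3 hy ⊢
      rw [T.fibreDifferential_thetaD, map_sub, map_neg, undiff_thetaD, h3, hy]
    · simp only [Θ] at h4 ⊢
      rw [ht, yD_lower_thetaD, h4, ← Y.transform_thetaD b (hy a), yD_thetaD]
    · simp only [Θ] at h2 h4 h5 ⊢
      rw [ht, Y.fibreReduced_lower_thetaD T b h2, h5, h4, T.fibreDifferential_thetaD, map_sub,
        map_neg, Y.transform_thetaD b h3]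
  have hN := iterSkew_induction (D := thetaD V (jetFibre n T.fields))
    (P := fun _ g => u g = g ∧ u (Θ g) = Θ g ∧
      u (T.fibreDifferential g) = T.fibreDifferential g ∧
      (∀ a, yD U T.fields a (Θ g) = Θ (yD V T.fields a g)) ∧
      Y.fibreReduced T (Θ g) = Θ (T.fibreDifferential g))
    (f := (parentJet V T.fields).coord (.field ((A, l), ∅) 0))
    ⟨by simp only [u]; rw [undiff_field, if_pos rfl],
      by simp only [u, Θ]; rw [transform_scalar, undiff_field, if_pos rfl],
      by simp only [u]; rw [T.fibreDifferential_scalar, undiff_toParent],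
      fun a => by simp only [Θ]; rw [transform_scalar, yD_field, yD_field, transform_scalar],
      by simp only [Θ]; rw [transform_scalar, fibreReduced_scalar]⟩
    (fun a _ _ h => key _ h a) N
  have := hN.2.2.2.2
  rw [coord_eq_iterSkew, map_smul, (Y.isDer_fibreReduced T).smul, T.isDer_fibreDifferential.smul,
    map_smul, this]

theorem reduced_lower_totalD (a : Fin n) (f : (parentJet U T.fields).LocalFn) :
    Y.reduced T (Y.lower _ (totalD U _) a f) = Y.lower _ (totalD U _) a (Y.reduced T f) :=
  Y.lower_comm (Y.isDer_reduced T) (Y.reduced_base T) (fun μ => Y.reduced_totalD T μ f) a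

/-- On undifferentiated fields the claim is the invariance of `d^F` together with
`fibreReduced_transform`. Both composites intertwine `∂_a` over `V` with its lowered counterpart
over `U`, which extends the claim to all derivatives of the fields. -/
theorem reduced_transform (f : (parentJet V T.fields).LocalFn) :
    Y.reduced T (Y.transform (jetFibre n T.fields) f) =
      Y.transform (jetFibre n T.fields) (T.parentDifferential f) := by
  refine ((Y.isDer_reduced T).right Y.isGeo_transform).ext
    (T.isDer_parentDifferential.left Y.isGeo_transform) ?_ f
  rintro (a | ⟨⟨⟨A, l⟩, N⟩, m⟩)
  · rw [transform_base, T.parentDifferential_base, map_zero,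
      eq_zero_bas (Y.isDer_reduced T) (Y.reduced_base T)]
  · have h : Y.reduced T (Y.transform (jetFibre n T.fields)
          ((parentJet V T.fields).coord (.field ((A, l), N) 0))) =
        Y.transform (jetFibre n T.fields)
          (T.parentDifferential ((parentJet V T.fields).coord (.field ((A, l), N) 0))) := by
      rw [T.parentDifferential_eq, map_add, ← dF_transform, ← fibreReduced_transform, fibreReduced]
      abel
    rw [← iter_totalD_coord,
      iter_intertwine (X := fun f => Y.reduced T (Y.transform (jetFibre n T.fields) f))
        (D' := Y.lower _ (totalD U _))
        (fun a f => by rw [transform_totalD, reduced_lower_totalD]),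
      iter_intertwine (X := fun f => Y.transform (jetFibre n T.fields) (T.parentDifferential f))
        (D' := Y.lower _ (totalD U _))
        (fun a f => by rw [T.parentDifferential_totalD, transform_totalD]), h]

/-! ### The identical change of coordinates -/

theorem refl_subst (f : (baseDom V).LocalFn) : (refl V).subst f = f := by
  refine DFunLike.congr_fun ((refl V).isGeo_subst.ext isGeo_id fun a => ?_) f
  have h : (baseDom V).parity a = 0 := rfl
  rw [AlgHom.id_apply, subst, Morphism.pullback_coord_even _ h, coord_even h]
  rfl

theorem refl_jacInv (a μ : Fin n) : (refl V).jacInv a μ = if a = μ then 1 else 0 := by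
  have h : (refl V).symm = refl V := rfl
  rw [jacInv, h, refl_subst, refl_subst, pd_coord]
  split_ifs <;> rfl

theorem refl_lower {X : Fin n → (jet V F).LocalFn → (jet V F).LocalFn} (a : Fin n) :
    (refl V).lower F X a = X a := by
  funext f
  rw [lower, Finset.sum_eq_single a]
  · rw [refl_jacInv, if_pos rfl, map_one, one_mul]
  · intro μ _ h
    rw [refl_jacInv, if_neg (Ne.symm h), map_zero, zero_mul]
  · exact fun h => absurd (Finset.mem_univ a) h

/-- For the identical change of coordinates the lowered operators are the original ones, and the
sign in the transformation cancels the one from iterating `∂/∂θ`. -/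
theorem refl_transform (f : (jet V (superfield n F)).LocalFn) : (refl V).transform F f = f := by
  refine DFunLike.congr_fun ((refl V).isGeo_transform.ext isGeo_id fun i => ?_) f
  rw [AlgHom.id_apply]
  match i with
  | .base a => rw [transform_base, refl_subst, bas_coord]
  | .field (t, N) m =>
    rw [transform_field, component, funext (refl_lower (V := V) (X := totalD V (superfield n F))),
      funext (refl_lower (V := V) (X := thetaD V F)), iterSkew_thetaD_coord,
      iter_smul isDer_totalD, iter_totalD_coord, smul_smul, sgn_mul_self, one_smul]

theorem refl_reduced : (refl V).reduced T = T.parentDifferential := by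
  funext f
  have := (refl V).reduced_transform T f
  rwa [refl_transform, refl_transform] at this

end CoordChange

end ParentBRST

/-! ### Assembly of the proposition -/

theorem proposition2p7 {n : ℕ} {V : TopologicalSpace.Opens (Fin n → ℝ)} {ι : Type*}
    (T : ParentBRST.GaugeTheory n V ι) :
    (∀ (U : TopologicalSpace.Opens (Fin n → ℝ)) (Y : ParentBRST.CoordChange U V),
      ParentBRST.IsGeneralizedAuxiliary (T.parametrizedDifferential U)
        (ParentBRST.CoordChange.phi U V T.fields) (Y.w T.fields) (Y.v T.fields) 0 ∧
      ParentBRST.IsRestriction (G := ParentBRST.superfield n (ParentBRST.jetFibre n T.fields))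
        (ParentBRST.CoordChange.phi U V T.fields) (Y.w T.fields) (Y.v T.fields) 0
        (Y.surface T.fields).pullback ∧
      ∃ Θ : (ParentBRST.parentJet V T.fields).LocalFn ≃ₐ[ℝ]
          (ParentBRST.parentJet U T.fields).LocalFn,
        Y.IsFieldTransformation Θ ∧
        ∀ f, Y.reduced T (Θ f) = Θ (T.parentDifferential f)) ∧
    (ParentBRST.CoordChange.refl V).reduced T = T.parentDifferential :=
  ⟨fun _ Y => ⟨Y.isGeneralizedAuxiliary T, Y.isRestriction T.fields,
    Y.transformEquiv _, Y.isFieldTransformation_transformEquiv, Y.reduced_transform T⟩,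
    ParentBRST.CoordChange.refl_reduced T⟩
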